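/- Let $\mathbb H^3$ be three-dimensional hyperbolic space with volume measure $\mu$, let $\mathbf 0\in\mathbb H^3$ be a fixed origin and let $(r,\theta)\in(0,\infty)\times\mathbb S^2$ be geodesic polar coordinates about $\mathbf 0$. There is an absolute constant $C>0$ such that the following holds. Let $V:\mathbb H^3\to\mathbb R$ be either $V=0$ or, more generally, a smooth, compactly supported function with $V\ge 0$ and $\partial_r V\le 0$. Let $J\subseteq\mathbb R$ be an interval and let $\vec u=(u,\partial_t u)\in C(J;H^1(\mathbb H^3)\times L^2(\mathbb H^3))$ be a real-valued solution of $$\partial_t^2u-\Delta_{\mathbb H^3}u+Vu=-|u|^4u \quad\text{on } J\times\mathbb H^3 ,$$ that is, the equation holds in the weak sense and $u\in L^5(K;L^{10}(\mathbb H^3))$ for every compact interval $K\subseteq J$. Then $u\in L^6(J\times\mathbb H^3)$, and for every $t\in J$ $$\|u\|_{L^6(J\times\mathbb H^3)}^6\le C\,\mathcal E(\vec u(t)),\qquad \mathcal E(\vec u)=\frac12\int_{\mathbb H^3}\bigl(|\partial_tu|^2+|\nabla u|^2+V|u|^2\bigr)\,d\mu+\frac16\int_{\mathbb H^3}|u|^6\,d\mu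 .$$ -/

import Mathlib

open MeasureTheory Filter Topology
open scoped ContDiff ENNReal

noncomputable section

namespace HypWave

/-- The coordinate space `ℝ³`. -/
abbrev E3 : Type := EuclideanSpace ℝ (Fin 3)

/-- The Minkowski form `diag(1, 1, 1, -1)` on `ℝ³ × ℝ`. -/
def mink (y z : E3 × ℝ) : ℝ := inner ℝ y.1 z.1 - y.2 * z.2

/-- Hyperbolic space `ℍ³` as the upper sheet of the unit hyperboloid. -/
def hyperboloid : Set (E3 × ℝ) := {y | mink y y = -1 ∧ 0 < y.2}

/-- The global parametrization `x ↦ (x, √(1 + |x|²))` of the hyperboloid by `ℝ³`. All functions on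
`ℍ³` are written in this global chart; the geodesic polar coordinates `(r, θ)` of the point
`(sinh r · θ, cosh r)` correspond to `x = sinh r · θ`. -/
def chart (x : E3) : E3 × ℝ := (x, Real.sqrt (1 + ‖x‖ ^ 2))

/-- The hyperbolic metric in the chart: the pull-back of the Minkowski form. -/
def metric (x : E3) : Matrix (Fin 3) (Fin 3) ℝ := fun i j =>
  mink (fderiv ℝ chart x (EuclideanSpace.single i 1))
    (fderiv ℝ chart x (EuclideanSpace.single j 1))

/-- The Riemannian volume `μ` of `ℍ³` in the chart, with density `√(det g)`. -/
def vol : Measure E3 :=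
  (volume : Measure E3).withDensity fun x => ENNReal.ofReal (Real.sqrt (metric x).det)

/-- The inner product `g^{ij} p_i q_j` of two covectors at `x`. -/
def cometric (x : E3) (p q : Fin 3 → ℝ) : ℝ := ∑ i, ∑ j, (metric x)⁻¹ i j * p i * q j

/-- The components `∂_i f` of the differential of a function. -/
def diff (f : E3 → ℝ) (x : E3) : Fin 3 → ℝ := fun i => fderiv ℝ f x (EuclideanSpace.single i 1)

/-- Test functions: `C_0^∞(ℍ³)`. -/
def IsTest (φ : E3 → ℝ) : Prop := ContDiff ℝ ∞ φ ∧ HasCompactSupport φ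

/-- The squared `H¹` distance of `f` and `h`, whose differentials are `p` and `q`. -/
def h1DistSq (f : E3 → ℝ) (p : E3 → Fin 3 → ℝ) (h : E3 → ℝ) (q : E3 → Fin 3 → ℝ) : ℝ≥0∞ :=
  ∫⁻ x, ENNReal.ofReal ((f x - h x) ^ 2 + cometric x (p x - q x) (p x - q x)) ∂vol

/-- `f ∈ H¹(ℍ³)` with weak differential `p`: the pair `(f, p)` is in the completion of the pairs
`(φ, dφ)`, `φ ∈ C_0^∞(ℍ³)`, for the `H¹` norm. -/
structure IsH1 (f : E3 → ℝ) (p : E3 → Fin 3 → ℝ) : Prop where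
  meas : AEStronglyMeasurable f vol
  meas_diff : AEStronglyMeasurable p vol
  approx : ∀ ε : ℝ≥0∞, 0 < ε → ∃ φ : E3 → ℝ, IsTest φ ∧ h1DistSq f p φ (diff φ) < ε

/-- Smooth, compactly supported, nonnegative potentials with `∂_r V ≤ 0` in geodesic polar
coordinates `(r, θ)`. -/
structure IsRepulsive (V : E3 → ℝ) : Prop where
  smooth : ContDiff ℝ ∞ V
  compact : HasCompactSupport V
  nonneg : ∀ x, 0 ≤ V x
  repulsive : ∀ θ : E3, ‖θ‖ = 1 → ∀ r : ℝ, 0 < r →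
    deriv (fun ρ : ℝ => V (Real.sinh ρ • θ)) r ≤ 0

/-- `(u, ∂ₜu) = (u, v)` is a solution of `∂ₜ²u - Δu + V u = -|u|⁴ u` on the time interval `J`, in
the class `C(J; H¹ × L²(ℍ³))`, with spatial differential `du = p`. The equation holds weakly, and
`u` has finite Strichartz norm `L⁵ₜL¹⁰ₓ` on compact subintervals of `J`. -/
structure IsSolution (V : E3 → ℝ) (J : Set ℝ) (u : ℝ → E3 → ℝ) (p : ℝ → E3 → Fin 3 → ℝ)
    (v : ℝ → E3 → ℝ) : Prop where
  /-- a jointly measurable representative is used -/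
  meas : AEStronglyMeasurable (Function.uncurry u) ((volume.restrict J).prod vol)
  memH1 : ∀ t ∈ J, IsH1 (u t) (p t)
  memL2 : ∀ t ∈ J, MemLp (v t) 2 vol
  cont_u : ∀ t ∈ J, Tendsto (fun s => h1DistSq (u s) (p s) (u t) (p t)) (𝓝[J] t) (𝓝 0)
  cont_v : ∀ t ∈ J, Tendsto (fun s => eLpNorm (v s - v t) 2 vol) (𝓝[J] t) (𝓝 0)
  strichartz : ∀ a ∈ J, ∀ b ∈ J, ∫⁻ t in Set.Icc a b, eLpNorm (u t) 10 vol ^ 5 < ⊤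
  /-- `∂ₜ u = v` -/
  deriv_u : ∀ φ : E3 → ℝ, IsTest φ → ∀ t ∈ J,
    HasDerivWithinAt (fun s => ∫ x, u s x * φ x ∂vol) (∫ x, v t x * φ x ∂vol) J t
  /-- `∂ₜ v = Δu - V u - |u|⁴ u` -/
  deriv_v : ∀ φ : E3 → ℝ, IsTest φ → ∀ t ∈ J,
    HasDerivWithinAt (fun s => ∫ x, v s x * φ x ∂vol)
      (-∫ x, (cometric x (p t x) (diff φ x) + V x * u t x * φ x + |u t x| ^ 4 * u t x * φ x) ∂vol)
      J t

/-- The energy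
`½ ∫ (v² + |du|² + V u²) dμ + ⅙ ∫ |u|⁶ dμ` of the state `(u, v)` with `du = p`. -/
def energy (V : E3 → ℝ) (u : E3 → ℝ) (p : E3 → Fin 3 → ℝ) (v : E3 → ℝ) : ℝ :=
  1 / 2 * ∫ x, (v x ^ 2 + cometric x (p x) (p x) + V x * u x ^ 2) ∂vol
    + 1 / 6 * ∫ x, |u x| ^ 6 ∂vol

/-! The chart parametrizes the hyperboloid, and the metric has the expected closed form. -/

theorem chart_injective : Function.Injective chart := fun _ _ h => congrArg Prod.fst h

theorem range_chart : Set.range chart = hyperboloid := by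
  ext ⟨a, b⟩
  constructor
  · rintro ⟨x, hx⟩
    rw [← hx]
    have h1 : (0 : ℝ) < 1 + ‖x‖ ^ 2 := by positivity
    refine ⟨?_, Real.sqrt_pos.2 h1⟩
    simp only [mink, chart, real_inner_self_eq_norm_sq, Real.mul_self_sqrt h1.le]
    ring
  · rintro ⟨h1, h2⟩
    refine ⟨a, ?_⟩
    simp only [mink, real_inner_self_eq_norm_sq] at h1 h2
    have h3 : 1 + ‖a‖ ^ 2 = b ^ 2 := by linarith
    simp only [chart, h3, Real.sqrt_sq h2.le]

theorem hasFDerivAt_chart (x : E3) :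
    HasFDerivAt chart ((ContinuousLinearMap.id ℝ E3).prod
      ((1 / Real.sqrt (1 + ‖x‖ ^ 2)) • innerSL ℝ x)) x := by
  have h1 : (1 + ‖x‖ ^ 2 : ℝ) ≠ 0 := by positivity
  have h2 : HasFDerivAt (fun y : E3 => 1 + ‖y‖ ^ 2) (2 • innerSL ℝ x) x :=
    (hasStrictFDerivAt_norm_sq x).hasFDerivAt.const_add 1
  have h3 : (1 / (2 * Real.sqrt (1 + ‖x‖ ^ 2))) • (2 • innerSL ℝ x)
      = (1 / Real.sqrt (1 + ‖x‖ ^ 2)) • innerSL ℝ x := by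
    ext y
    simp
    ring
  have h4 := h2.sqrt h1
  rw [h3] at h4
  exact (hasFDerivAt_id x).prodMk h4

theorem metric_apply (x : E3) (i j : Fin 3) :
    metric x i j = (if i = j then 1 else 0) - x i * x j / (1 + ‖x‖ ^ 2) := by
  have h1 : (0 : ℝ) < 1 + ‖x‖ ^ 2 := by positivity
  have h2 := Real.mul_self_sqrt h1.le
  have h3 := (Real.sqrt_pos.2 h1).ne'
  simp only [metric, (hasFDerivAt_chart x).fderiv, mink, ContinuousLinearMap.prod_apply]
  have h4 : (Real.sqrt (1 + ‖x‖ ^ 2))⁻¹ * (Real.sqrt (1 + ‖x‖ ^ 2))⁻¹ = (1 + ‖x‖ ^ 2)⁻¹ := by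
    rw [← mul_inv, h2]
  simp [EuclideanSpace.inner_single_right, eq_comm]
  linear_combination (-(x i * x j)) * h4

theorem det_metric (x : E3) : (metric x).det = (1 + ‖x‖ ^ 2)⁻¹ := by
  have h1 : (1 + ‖x‖ ^ 2 : ℝ) ≠ 0 := by positivity
  have h2 : ‖x‖ ^ 2 = x 0 ^ 2 + x 1 ^ 2 + x 2 ^ 2 := by
    simp [EuclideanSpace.norm_sq_eq, Fin.sum_univ_three]
  rw [Matrix.det_fin_three]
  simp only [metric_apply]
  simp
  field_simp
  rw [h2]
  ring

theorem inv_metric_apply (x : E3) (i j : Fin 3) :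
    (metric x)⁻¹ i j = (if i = j then 1 else 0) + x i * x j := by
  have h1 : (1 + ‖x‖ ^ 2 : ℝ) ≠ 0 := by positivity
  have h2 : ‖x‖ ^ 2 = x 0 ^ 2 + x 1 ^ 2 + x 2 ^ 2 := by
    simp [EuclideanSpace.norm_sq_eq, Fin.sum_univ_three]
  have h3 : metric x * Matrix.of (fun i j : Fin 3 => (if i = j then (1 : ℝ) else 0) + x i * x j) = 1 := by
    ext a b
    simp only [Matrix.mul_apply, Matrix.of_apply, metric_apply, Fin.sum_univ_three]
    fin_cases a <;> fin_cases b <;> simp <;> field_simp <;> rw [h2] <;> ring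
  rw [Matrix.inv_eq_right_inv h3, Matrix.of_apply]

end HypWave

end

/-! This is a Morawetz estimate with the vector field `x · ∇ = tanh r ∂_r`, the hyperbolic gradient
of `log cosh r`. Let `κ = (1 + ‖x‖²)^(-1/4)` be the square root of the volume density.
Multiplication by `κ` maps `L²(ℍ³)` isometrically onto `L²(ℝ³, dx)`, where the natural multiplier is
`A = x · ∇ + 3/2`, the antisymmetric generator of the unitary dilations. For `ψ = κ u` the Dirichlet
form becomes `‖∇ψ‖² + ‖x · ∇ψ‖² + ⟪x · ∇ψ, ψ⟫ + ∫ m ψ²` with `m = tanh² r / 4 + V` (`conj_form`).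

Testing the equation with `A ψ` produces the following terms. The part of the form built from `x ·
∇ψ` commutes with dilations and contributes nothing. The rest gives `‖∇ψ‖² - ½ ∫ (x · ∇m) ψ²`, which
is nonnegative: a Hardy inequality absorbs `tanh² r / 4`, and `x · ∇V ≤ 0` by repulsivity
(`commutator_nonneg`). The nonlinearity gives at least `2/3 ∫ |u|⁶ dμ`, since the field has
divergence at least `2` for the hyperbolic volume (`integral_sextic_le`). The boundary terms `⟪∂ₜψ,
A ψ⟫` are at most the energy, because `‖A ψ‖²` is bounded by the form (`norm_generator_sq_le`).
Hence `2/3 ∫∫ |u|⁶ ≤ 2 E`, which is the constant `3`.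

For a solution of mere energy class neither `A ψ` nor `∂ₜψ` is an admissible test function. The
virial identity is therefore derived with symmetric dilation quotients, which are antisymmetric and
bounded by `A` on the energy space, and the quadratic energy identity with symmetric time
differences; the parameter then tends to zero (`WeakEvolution.virial`, `WeakEvolution.energy`). The
nonlinearity is truncated so that it acts continuously on `L²` and has a convex primitive. The
truncation is removed by dominated convergence, because the `L⁵ₜL¹⁰ₓ` norm places `|u|⁴u` in
`L¹ₜL²ₓ`. The same bound makes the potential energy finite at almost every time, and the truncated
identities carry this to every time, so no Sobolev embedding enters. -/

noncomputable section

namespace HypWave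

/-! ### Abstract weak evolutions: product rule, energy identity, virial identity. -/

section Evolution

variable {K H : Type*} [NormedAddCommGroup K] [NormedSpace ℝ K]
  [NormedAddCommGroup H] [InnerProductSpace ℝ H]

/-- On a partition of mesh below `δ` both sides telescope, so `|e b - e a| ≤ ε (G b - G a)` with `G`
independent of `ε`; let `ε → 0`. This replaces differentiation of `e`, which need not be
differentiable in the uses below. -/
theorem eq_of_increments_small {e G : ℝ → ℝ} {a b : ℝ} (hab : a ≤ b)
    (h : ∀ ε > 0, ∃ δ > 0, ∀ s t, a ≤ s → s ≤ t → t ≤ b → t - s < δ →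
      |e t - e s| ≤ ε * (G t - G s)) : e b = e a := by
  have key : ∀ ε > 0, |e b - e a| ≤ ε * (G b - G a) := by
    intro ε hε
    obtain ⟨δ, hδ, H⟩ := h ε hε
    obtain ⟨n, hn⟩ := exists_nat_gt ((b - a) / δ)
    have hn0 : 0 < (n : ℝ) := lt_of_le_of_lt (div_nonneg (by linarith) hδ.le) hn
    set p : ℕ → ℝ := fun i => a + i * ((b - a) / n) with hp
    have hstep : 0 ≤ (b - a) / n := div_nonneg (by linarith) hn0.le
    have hsmall : (b - a) / n < δ := by
      rw [div_lt_iff₀ hn0]; rw [div_lt_iff₀ hδ] at hn; linarith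
    have hp0 : p 0 = a := by simp [hp]
    have hpn : p n = b := by simp only [hp]; field_simp; ring
    have hle : ∀ i ∈ Finset.range n, |e (p (i + 1)) - e (p i)| ≤ ε * (G (p (i + 1)) - G (p i)) := by
      intro i hi
      have hi' : i + 1 ≤ n := Finset.mem_range.1 hi
      apply H
      · simp only [hp]; have : 0 ≤ (i : ℝ) * ((b - a) / n) := by positivity
        linarith
      · simp only [hp]; push_cast; linarith
      · rw [← hpn]; simp only [hp]
        have : ((i + 1 : ℕ) : ℝ) ≤ n := by exact_mod_cast hi'
        nlinarith
      · simp only [hp]; push_cast; linarith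
    calc |e b - e a| = |∑ i ∈ Finset.range n, (e (p (i + 1)) - e (p i))| := by
          rw [Finset.sum_range_sub (fun i => e (p i)), hp0, hpn]
      _ ≤ ∑ i ∈ Finset.range n, |e (p (i + 1)) - e (p i)| := Finset.abs_sum_le_sum_abs _ _
      _ ≤ ∑ i ∈ Finset.range n, ε * (G (p (i + 1)) - G (p i)) := Finset.sum_le_sum hle
      _ = ε * (G b - G a) := by
          rw [← Finset.mul_sum, Finset.sum_range_sub (fun i => G (p i)), hp0, hpn]
  have h0 : |e b - e a| ≤ 0 := by
    have hlim : Tendsto (fun ε : ℝ => ε * (G b - G a)) (𝓝[>] 0) (𝓝 0) := by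
      have : Tendsto (fun ε : ℝ => ε * (G b - G a)) (𝓝 0) (𝓝 (0 * (G b - G a))) :=
        (continuous_id.mul continuous_const).tendsto 0
      rw [zero_mul] at this
      exact this.mono_left nhdsWithin_le_nhds
    exact ge_of_tendsto hlim (by filter_upwards [self_mem_nhdsWithin] with ε hε using key ε hε)
  exact sub_eq_zero.1 (abs_eq_zero.1 (le_antisymm h0 (abs_nonneg _)))

/-- Product rule for `⟪v, ι x⟫`, where `v` has a derivative only in the dual of `K`. -/
theorem inner_sub_inner_eq_integral [CompleteSpace H] (ι : K →L[ℝ] H) (S : Set K) {a b : ℝ} (hab : a ≤ b)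
    {v y : ℝ → H} {x : ℝ → K} {l : ℝ → K → ℝ} {g : ℝ → ℝ}
    (hv : ContinuousOn v (Set.Icc a b)) (hx : ContinuousOn x (Set.Icc a b))
    (hy : ContinuousOn y (Set.Icc a b)) (hxS : ∀ t ∈ Set.Icc a b, x t ∈ S)
    (hxy : ∀ s ∈ Set.Icc a b, ∀ t ∈ Set.Icc a b, ι (x t) - ι (x s) = ∫ τ in s..t, y τ)
    (hg : IntervalIntegrable g volume a b) (hg0 : ∀ τ, 0 ≤ g τ)
    (hl : ∀ τ φ ψ, |l τ φ - l τ ψ| ≤ g τ * ‖φ - ψ‖)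
    (hli : IntervalIntegrable (fun τ => l τ (x τ)) volume a b)
    (hlφ : ∀ φ ∈ S, IntervalIntegrable (fun τ => l τ φ) volume a b)
    (hvl : ∀ φ ∈ S, ∀ s ∈ Set.Icc a b, ∀ t ∈ Set.Icc a b,
      inner ℝ (v t - v s) (ι φ) = ∫ τ in s..t, l τ φ) :
    inner ℝ (v b) (ι (x b)) - inner ℝ (v a) (ι (x a))
      = ∫ τ in a..b, (l τ (x τ) + inner ℝ (v τ) (y τ)) := by
  have hvy : IntervalIntegrable (fun τ => inner ℝ (v τ) (y τ)) volume a b := by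
    apply ContinuousOn.intervalIntegrable
    rw [Set.uIcc_of_le hab]
    exact hv.inner hy
  have hI : IntervalIntegrable (fun τ => l τ (x τ) + inner ℝ (v τ) (y τ)) volume a b := hli.add hvy
  have hyn : IntervalIntegrable (fun τ => ‖y τ‖) volume a b := by
    apply ContinuousOn.intervalIntegrable
    rw [Set.uIcc_of_le hab]
    exact hy.norm
  have hGi : IntervalIntegrable (fun τ => g τ + ‖y τ‖) volume a b := hg.add hyn
  have hsub : ∀ {s t : ℝ}, a ≤ s → s ≤ t → t ≤ b → Set.uIcc s t ⊆ Set.uIcc a b := by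
    intro s t h1 h2 h3
    rw [Set.uIcc_of_le h2, Set.uIcc_of_le hab]
    exact Set.Icc_subset_Icc h1 h3
  -- The criterion is applied to the difference of the two sides. The majorant collects `g`, the
  -- Lipschitz constant of the functionals `l τ`, and the speed `‖y‖`.
  have main := eq_of_increments_small (e := fun t => inner ℝ (v t) (ι (x t))
    - ∫ τ in a..t, (l τ (x τ) + inner ℝ (v τ) (y τ))) (G := fun t => ∫ τ in a..t, (g τ + ‖y τ‖)) hab ?_
  · simp only [intervalIntegral.integral_same, sub_zero] at main
    linarith
  intro ε hε
  have hux := isCompact_Icc.uniformContinuousOn_of_continuous hx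
  have huv := isCompact_Icc.uniformContinuousOn_of_continuous hv
  rw [Metric.uniformContinuousOn_iff] at hux huv
  obtain ⟨δ1, hδ1, h1⟩ := hux ε hε
  obtain ⟨δ2, hδ2, h2⟩ := huv ε hε
  refine ⟨min δ1 δ2, lt_min hδ1 hδ2, fun s t has hst htb hd => ?_⟩
  have hs : s ∈ Set.Icc a b := ⟨has, hst.trans htb⟩
  have ht : t ∈ Set.Icc a b := ⟨has.trans hst, htb⟩
  have e1 : (∫ τ in a..t, (l τ (x τ) + inner ℝ (v τ) (y τ)))
      - ∫ τ in a..s, (l τ (x τ) + inner ℝ (v τ) (y τ))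
      = ∫ τ in s..t, (l τ (x τ) + inner ℝ (v τ) (y τ)) :=
    intervalIntegral.integral_interval_sub_left
      (hI.mono_set (hsub le_rfl (has.trans hst) htb)) (hI.mono_set (hsub le_rfl has hs.2))
  have e2 : (∫ τ in a..t, (g τ + ‖y τ‖)) - ∫ τ in a..s, (g τ + ‖y τ‖)
      = ∫ τ in s..t, (g τ + ‖y τ‖) :=
    intervalIntegral.integral_interval_sub_left
      (hGi.mono_set (hsub le_rfl (has.trans hst) htb)) (hGi.mono_set (hsub le_rfl has hs.2))
  have hst' := hsub has hst htb
  have iy : IntervalIntegrable y volume s t :=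
    (ContinuousOn.intervalIntegrable (by rw [Set.uIcc_of_le hab]; exact hy) :
      IntervalIntegrable y volume a b).mono_set hst'
  have ivy : IntervalIntegrable (fun τ => inner ℝ (v s) (y τ)) volume s t :=
    ⟨(innerSL ℝ (v s)).integrable_comp iy.1, (innerSL ℝ (v s)).integrable_comp iy.2⟩
  have e3 : inner ℝ (v s) (∫ τ in s..t, y τ) = ∫ τ in s..t, inner ℝ (v s) (y τ) :=
    ((innerSL ℝ (v s)).intervalIntegral_comp_comm iy).symm
  -- Split the increment of the product with `x` frozen at time `t` and `v` frozen at time `s`. Only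
  -- the errors of freezing remain, and uniform continuity makes them small.
  have e4 : (inner ℝ (v t) (ι (x t)) - ∫ τ in a..t, (l τ (x τ) + inner ℝ (v τ) (y τ)))
      - (inner ℝ (v s) (ι (x s)) - ∫ τ in a..s, (l τ (x τ) + inner ℝ (v τ) (y τ)))
      = ∫ τ in s..t, ((l τ (x t) - l τ (x τ)) + (inner ℝ (v s) (y τ) - inner ℝ (v τ) (y τ))) := by
    have e5 : inner ℝ (v t) (ι (x t)) - inner ℝ (v s) (ι (x s))
        = inner ℝ (v t - v s) (ι (x t)) + inner ℝ (v s) (ι (x t) - ι (x s)) := by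
      rw [inner_sub_left, inner_sub_right]; ring
    have e6 : (∫ τ in s..t, ((l τ (x t) - l τ (x τ)) + (inner ℝ (v s) (y τ) - inner ℝ (v τ) (y τ))))
        = ((∫ τ in s..t, l τ (x t)) + ∫ τ in s..t, inner ℝ (v s) (y τ))
          - ∫ τ in s..t, (l τ (x τ) + inner ℝ (v τ) (y τ)) := by
      rw [← intervalIntegral.integral_add ((hlφ _ (hxS t ht)).mono_set hst') ivy,
        ← intervalIntegral.integral_sub (((hlφ _ (hxS t ht)).mono_set hst').add ivy)
          (hI.mono_set hst')]
      congr 1; ext τ; ring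
    rw [e6, ← e3, ← hxy s hs t ht, ← hvl _ (hxS t ht) s hs t ht]
    linarith
  rw [e4, e2, ← intervalIntegral.integral_const_mul, ← Real.norm_eq_abs]
  refine intervalIntegral.norm_integral_le_of_norm_le hst ?_ ((hGi.mono_set hst').const_mul ε)
  refine Eventually.of_forall fun τ hτ => ?_
  have hτ' : τ ∈ Set.Icc a b := ⟨has.trans hτ.1.le, hτ.2.trans htb⟩
  have d1 : ‖x t - x τ‖ ≤ ε := by
    rw [← dist_eq_norm]
    refine (h1 t ht τ hτ' ?_).le
    rw [Real.dist_eq, abs_of_nonneg (by linarith [hτ.2])]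
    linarith [hτ.1, min_le_left δ1 δ2]
  have d2 : ‖v s - v τ‖ ≤ ε := by
    rw [← dist_eq_norm]
    refine (h2 s hs τ hτ' ?_).le
    rw [Real.dist_eq, abs_sub_comm, abs_of_nonneg (by linarith [hτ.1])]
    linarith [hτ.2, min_le_right δ1 δ2]
  have d3 : ‖inner ℝ (v s - v τ) (y τ)‖ ≤ ε * ‖y τ‖ :=
    (norm_inner_le_norm _ _).trans (by gcongr)
  have hgn : |l τ (x t) - l τ (x τ)| ≤ g τ * ε := by
    exact (hl τ _ _).trans (mul_le_mul_of_nonneg_left d1 (hg0 τ))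
  rw [← inner_sub_left]
  calc _ ≤ ‖l τ (x t) - l τ (x τ)‖ + ‖inner ℝ (v s - v τ) (y τ)‖ := norm_add_le _ _
    _ ≤ g τ * ε + ε * ‖y τ‖ := add_le_add hgn d3
    _ = ε * (g τ + ‖y τ‖) := by ring

/-- An abstract weak solution of `ι U' = v`, `v' = -Q(U, ·) - N`, in integrated form. -/
structure WeakEvolution (ι : K →L[ℝ] H) (Q : K →L[ℝ] K →L[ℝ] ℝ) (S : Set K) (J : Set ℝ)
    (U : ℝ → K) (v N : ℝ → H) : Prop where
  ordConnected : J.OrdConnected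
  continuous_state : ContinuousOn U J
  continuous_velocity : ContinuousOn v J
  integrable_force : ∀ a ∈ J, ∀ b ∈ J, IntervalIntegrable N volume a b
  mem : ∀ t ∈ J, U t ∈ S
  state : ∀ s ∈ J, ∀ t ∈ J, ι (U t) - ι (U s) = ∫ τ in s..t, v τ
  velocity : ∀ φ ∈ S, ∀ s ∈ J, ∀ t ∈ J,
    inner ℝ (v t - v s) (ι φ) = ∫ τ in s..t, -(Q (U τ) φ + inner ℝ (N τ) (ι φ))

namespace WeakEvolution

variable {ι : K →L[ℝ] H} {Q : K →L[ℝ] K →L[ℝ] ℝ} {S : Set K} {J : Set ℝ} {U : ℝ → K} {v N : ℝ → H}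

theorem Icc_subset (h : WeakEvolution ι Q S J U v N) {a b : ℝ} (ha : a ∈ J) (hb : b ∈ J) :
    Set.Icc a b ⊆ J := h.ordConnected.out ha hb

theorem intervalIntegrable_form (h : WeakEvolution ι Q S J U v N) {a b : ℝ} (hab : a ≤ b)
    (ha : a ∈ J) (hb : b ∈ J) {x : ℝ → K} (hx : ContinuousOn x (Set.Icc a b)) :
    IntervalIntegrable (fun τ => Q (U τ) (x τ)) volume a b := by
  apply ContinuousOn.intervalIntegrable
  rw [Set.uIcc_of_le hab]
  exact (Q.continuous.comp_continuousOn (h.continuous_state.mono (h.Icc_subset ha hb))).clm_apply hx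

theorem _root_.IntervalIntegrable.inner_continuousOn {N y : ℝ → H} {a b : ℝ} (hab : a ≤ b)
    (hN : IntervalIntegrable N volume a b) (hy : ContinuousOn y (Set.Icc a b)) :
    IntervalIntegrable (fun τ => inner ℝ (N τ) (y τ)) volume a b := by
  obtain ⟨C, hC⟩ := isCompact_Icc.exists_bound_of_continuousOn hy
  have hC0 : 0 ≤ C := (norm_nonneg _).trans (hC a (Set.left_mem_Icc.2 hab))
  have hi := (intervalIntegrable_iff_integrableOn_Ioc_of_le hab).1 hN
  rw [intervalIntegrable_iff_integrableOn_Ioc_of_le hab]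
  refine Integrable.mono' (hi.norm.mul_const C) ?_ ?_
  · exact hi.aestronglyMeasurable.inner
      ((hy.mono Set.Ioc_subset_Icc_self).aestronglyMeasurable measurableSet_Ioc)
  · filter_upwards [ae_restrict_mem measurableSet_Ioc] with τ hτ
    exact (norm_inner_le_norm _ _).trans
      (mul_le_mul_of_nonneg_left (hC τ (Set.Ioc_subset_Icc_self hτ)) (norm_nonneg _))

/-- This allows a test function moving in time. It is used below with time differences of `U`
(energy) and with `B n (U t)` (virial). -/
theorem inner_sub_inner [CompleteSpace H] (h : WeakEvolution ι Q S J U v N) {a b : ℝ} (hab : a ≤ b)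
    (ha : a ∈ J) (hb : b ∈ J) {x : ℝ → K} {y : ℝ → H} (hx : ContinuousOn x (Set.Icc a b))
    (hy : ContinuousOn y (Set.Icc a b)) (hxS : ∀ t ∈ Set.Icc a b, x t ∈ S)
    (hxy : ∀ s ∈ Set.Icc a b, ∀ t ∈ Set.Icc a b, ι (x t) - ι (x s) = ∫ τ in s..t, y τ) :
    inner ℝ (v b) (ι (x b)) - inner ℝ (v a) (ι (x a))
      = ∫ τ in a..b, (-(Q (U τ) (x τ) + inner ℝ (N τ) (ι (x τ))) + inner ℝ (v τ) (y τ)) := by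
  have hJ := h.Icc_subset ha hb
  have hl : ∀ {z : ℝ → K}, ContinuousOn z (Set.Icc a b) →
      IntervalIntegrable (fun τ => -(Q (U τ) (z τ) + inner ℝ (N τ) (ι (z τ)))) volume a b :=
    fun hz => ((h.intervalIntegrable_form hab ha hb hz).add
      ((h.integrable_force a ha b hb).inner_continuousOn hab (ι.continuous.comp_continuousOn hz))).neg
  refine inner_sub_inner_eq_integral ι S hab (l := fun τ φ => -(Q (U τ) φ + inner ℝ (N τ) (ι φ)))
    (g := fun τ => ‖Q‖ * ‖U τ‖ + ‖N τ‖ * ‖ι‖) (h.continuous_velocity.mono hJ) hx hy hxS hxy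
    ?_ (fun τ => by positivity) ?_ (hl hx) (fun φ _ => hl continuousOn_const)
    (fun φ hφ s hs t ht => h.velocity φ hφ s (hJ hs) t (hJ ht))
  · refine IntervalIntegrable.add (ContinuousOn.intervalIntegrable ?_)
      ((h.integrable_force a ha b hb).norm.mul_const _)
    rw [Set.uIcc_of_le hab]
    exact continuousOn_const.mul (h.continuous_state.mono hJ).norm
  · intro τ φ ψ
    have e : -(Q (U τ) φ + inner ℝ (N τ) (ι φ)) - -(Q (U τ) ψ + inner ℝ (N τ) (ι ψ))
        = -(Q (U τ) (φ - ψ) + inner ℝ (N τ) (ι (φ - ψ))) := by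
      rw [map_sub, map_sub, inner_sub_right]; ring
    rw [e, abs_neg]
    have b1 : |Q (U τ) (φ - ψ)| ≤ ‖Q‖ * ‖U τ‖ * ‖φ - ψ‖ := Q.le_opNorm₂ _ _
    have b2 : |inner ℝ (N τ) (ι (φ - ψ))| ≤ ‖N τ‖ * (‖ι‖ * ‖φ - ψ‖) :=
      (abs_real_inner_le_norm _ _).trans
        (mul_le_mul_of_nonneg_left (ι.le_opNorm _) (norm_nonneg _))
    calc _ ≤ |Q (U τ) (φ - ψ)| + |inner ℝ (N τ) (ι (φ - ψ))| := abs_add_le _ _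
      _ ≤ _ := by rw [add_mul]; linarith

/-- Backward averages of a jointly continuous function over a shrinking diagonal. -/
theorem tendsto_average_shift {J : Set ℝ} {F : ℝ → ℝ → ℝ} (hF : ContinuousOn (Function.uncurry F) (J ×ˢ J))
    {a b c : ℝ} (ha : a < c) (hb : c < b) (hJ : Set.Icc a b ⊆ J) :
    Tendsto (fun h : ℝ => h⁻¹ * ∫ τ in (c - h)..c, F τ (τ + h)) (𝓝[>] 0) (𝓝 (F c c)) := by
  have hcJ : J ∈ 𝓝 c := mem_of_superset (Icc_mem_nhds ha hb) hJ
  have hcont : ContinuousAt (Function.uncurry F) (c, c) :=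
    hF.continuousAt (prod_mem_nhds hcJ hcJ)
  rw [Metric.tendsto_nhds]
  intro ε hε
  obtain ⟨δ, hδ, H⟩ := Metric.continuousAt_iff.1 hcont (ε / 2) (half_pos hε)
  have hd : 0 < min δ (min (c - a) (b - c)) := lt_min hδ (lt_min (by linarith) (by linarith))
  filter_upwards [Ioo_mem_nhdsGT hd] with h hh
  have h0 : 0 < h := hh.1
  have hl1 : h < δ := hh.2.trans_le (min_le_left _ _)
  have hl2 : h < c - a := hh.2.trans_le ((min_le_right _ _).trans (min_le_left _ _))
  have hl3 : h < b - c := hh.2.trans_le ((min_le_right _ _).trans (min_le_right _ _))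
  have hint : IntervalIntegrable (fun τ => F τ (τ + h)) volume (c - h) c := by
    apply ContinuousOn.intervalIntegrable
    rw [Set.uIcc_of_le (by linarith)]
    refine hF.comp (f := fun τ : ℝ => (τ, τ + h)) (by fun_prop) fun τ hτ => ⟨hJ ⟨?_, ?_⟩, hJ ⟨?_, ?_⟩⟩ <;>
      simp only <;> linarith [hτ.1, hτ.2]
  have e : h⁻¹ * (∫ τ in (c - h)..c, F τ (τ + h)) - F c c
      = h⁻¹ * ∫ τ in (c - h)..c, (F τ (τ + h) - F c c) := by
    rw [intervalIntegral.integral_sub hint intervalIntegrable_const, intervalIntegral.integral_const]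
    simp only [smul_eq_mul]; field_simp; ring
  rw [Real.dist_eq, e, abs_mul, abs_of_pos (inv_pos.2 h0), ← Real.norm_eq_abs]
  have hb := intervalIntegral.norm_integral_le_of_norm_le_const
    (f := fun τ => F τ (τ + h) - F c c) (a := c - h) (b := c) (C := ε / 2) ?_
  · rw [show |c - (c - h)| = h by rw [sub_sub_cancel, abs_of_pos h0]] at hb
    calc h⁻¹ * _ ≤ h⁻¹ * (ε / 2 * h) := by gcongr
      _ = ε / 2 := by field_simp
      _ < ε := half_lt_self hε
  · intro τ hτ
    rw [Set.uIoc_of_le (by linarith)] at hτ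
    have := H (x := (τ, τ + h)) (by
      rw [Prod.dist_eq, Real.dist_eq, Real.dist_eq]
      refine max_lt ?_ ?_ <;> rw [abs_lt] <;> constructor <;> simp only <;> linarith [hτ.1, hτ.2])
    rw [Real.dist_eq] at this
    exact this.le

theorem norm_state_sub_le (h : WeakEvolution ι Q S J U v N) {a b s t C : ℝ} (ha : a ∈ J) (hb : b ∈ J)
    (hC : ∀ τ ∈ Set.Icc a b, ‖v τ‖ ≤ C) (hs : s ∈ Set.Icc a b) (ht : t ∈ Set.Icc a b) :
    ‖ι (U t) - ι (U s)‖ ≤ C * |t - s| := by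
  rw [h.state s (h.Icc_subset ha hb hs) t (h.Icc_subset ha hb ht)]
  refine intervalIntegral.norm_integral_le_of_norm_le_const fun τ hτ => hC τ ?_
  exact Set.uIcc_subset_Icc hs ht (Set.uIoc_subset_uIcc hτ)

theorem hasDerivAt_state [CompleteSpace H] (h : WeakEvolution ι Q S J U v N) {t : ℝ} (ht : J ∈ 𝓝 t) :
    HasDerivAt (fun s => ι (U s)) (v t) t := by
  have htJ : t ∈ J := mem_of_mem_nhds ht
  have h1 : HasDerivAt (fun s => ∫ τ in t..s, v τ) (v t) t := by
    refine intervalIntegral.integral_hasDerivAt_right (by simp) ?_ (h.continuous_velocity.continuousAt ht)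
    exact (h.continuous_velocity.mono interior_subset).stronglyMeasurableAtFilter isOpen_interior t
      (mem_interior_iff_mem_nhds.2 ht)
  have h2 := h1.const_add (ι (U t))
  refine h2.congr_of_eventuallyEq ?_
  filter_upwards [ht] with s hs
  rw [← h.state t htJ s hs]; abel

/-- The velocity lies only in `H`, so it cannot be a test function; `U (τ + r) - U (τ - r)` can. For
the symmetric kernel `F s t = ⟪v s, v t⟫ - Q (U s) (U t)` the integrand is `F τ (τ + r) - F (τ - r)
τ` up to the force, so its integral telescopes to windows of length `r` at the two ends. Divide by
`r` and let `r → 0`. The margins `a' < a` and `b < b'` leave room for the shifts. -/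
theorem energy_interior [CompleteSpace H] (h : WeakEvolution ι Q S J U v N)
    (hQ : ∀ x y, Q x y = Q y x) (hS : ∀ x ∈ S, ∀ y ∈ S, x - y ∈ S) {a b a' b' : ℝ} (ha' : a' ∈ J) (hb' : b' ∈ J)
    (haa : a' < a) (hab : a ≤ b) (hbb : b < b') :
    (‖v b‖ ^ 2 + Q (U b) (U b)) - (‖v a‖ ^ 2 + Q (U a) (U a))
      = -2 * ∫ τ in a..b, inner ℝ (N τ) (v τ) := by
  have hJ : Set.Icc a' b' ⊆ J := h.Icc_subset ha' hb'
  have hnh : ∀ {t}, a' < t → t < b' → J ∈ 𝓝 t := fun h1 h2 => mem_of_superset (Icc_mem_nhds h1 h2) hJ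
  set F : ℝ → ℝ → ℝ := fun s t => inner ℝ (v s) (v t) - Q (U s) (U t) with hF
  have hFc : ContinuousOn (Function.uncurry F) (J ×ˢ J) := by
    have c1 : ContinuousOn (fun p : ℝ × ℝ => v p.1) (J ×ˢ J) :=
      h.continuous_velocity.comp continuousOn_fst fun p hp => hp.1
    have c2 : ContinuousOn (fun p : ℝ × ℝ => v p.2) (J ×ˢ J) :=
      h.continuous_velocity.comp continuousOn_snd fun p hp => hp.2
    have c3 : ContinuousOn (fun p : ℝ × ℝ => U p.1) (J ×ˢ J) :=
      h.continuous_state.comp continuousOn_fst fun p hp => hp.1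
    have c4 : ContinuousOn (fun p : ℝ × ℝ => U p.2) (J ×ˢ J) :=
      h.continuous_state.comp continuousOn_snd fun p hp => hp.2
    exact (c1.inner c2).sub ((Q.continuous.comp_continuousOn c3).clm_apply c4)
  have hFs : ∀ s t, F s t = F t s := fun s t => by
    simp only [hF, real_inner_comm (v t) (v s), hQ (U s) (U t)]
  have haJ : a ∈ J := hJ ⟨haa.le, hab.trans hbb.le⟩
  have hbJ : b ∈ J := hJ ⟨haa.le.trans hab, hbb.le⟩
  set d := min (a - a') (b' - b) with hd
  have hd0 : 0 < d := lt_min (by linarith) (by linarith)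
  have key : ∀ h' ∈ Set.Ioo 0 d,
      (inner ℝ (v b) (h'⁻¹ • (ι (U (b + h')) - ι (U (b - h'))))
        - inner ℝ (v a) (h'⁻¹ • (ι (U (a + h')) - ι (U (a - h')))))
      = (h'⁻¹ * (∫ τ in (b - h')..b, F τ (τ + h')) - h'⁻¹ * ∫ τ in (a - h')..a, F τ (τ + h'))
        - ∫ τ in a..b, inner ℝ (N τ) (h'⁻¹ • (ι (U (τ + h')) - ι (U (τ - h')))) := by
    intro r hr
    have r0 : 0 < r := hr.1
    have r1 : r < a - a' := hr.2.trans_le (min_le_left _ _)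
    have r2 : r < b' - b := hr.2.trans_le (min_le_right _ _)
    have sp : ∀ τ ∈ Set.Icc a b, τ + r ∈ J := fun τ hτ => hJ ⟨by linarith [hτ.1], by linarith [hτ.2]⟩
    have sm : ∀ τ ∈ Set.Icc a b, τ - r ∈ J := fun τ hτ => hJ ⟨by linarith [hτ.1], by linarith [hτ.2]⟩
    have cUp : ContinuousOn (fun τ => U (τ + r)) (Set.Icc a b) :=
      h.continuous_state.comp (by fun_prop) sp
    have cUm : ContinuousOn (fun τ => U (τ - r)) (Set.Icc a b) :=
      h.continuous_state.comp (by fun_prop) sm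
    have cvp : ContinuousOn (fun τ => v (τ + r)) (Set.Icc a b) :=
      h.continuous_velocity.comp (by fun_prop) sp
    have cvm : ContinuousOn (fun τ => v (τ - r)) (Set.Icc a b) :=
      h.continuous_velocity.comp (by fun_prop) sm
    have subI : ∀ {s t}, s ∈ Set.Icc a b → t ∈ Set.Icc a b → Set.uIcc s t ⊆ Set.Icc a b :=
      fun hs ht => Set.uIcc_subset_Icc hs ht
    have pr := h.inner_sub_inner hab haJ hbJ (x := fun τ => U (τ + r) - U (τ - r))
      (y := fun τ => v (τ + r) - v (τ - r)) (cUp.sub cUm) (cvp.sub cvm)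
      (fun t ht => hS _ (h.mem _ (sp t ht)) _ (h.mem _ (sm t ht))) ?_
    · have i1 : IntervalIntegrable (fun τ => inner ℝ (N τ) (ι (U (τ + r) - U (τ - r)))) volume a b :=
        (h.integrable_force a haJ b hbJ).inner_continuousOn hab
          (ι.continuous.comp_continuousOn (cUp.sub cUm))
      have cF : ∀ {s t : ℝ}, a' ≤ s → s ≤ t → t + r ≤ b' →
          IntervalIntegrable (fun τ => F τ (τ + r)) volume s t := by
        intro s t h1 h2 h3
        apply ContinuousOn.intervalIntegrable
        rw [Set.uIcc_of_le h2]
        refine hFc.comp (f := fun τ : ℝ => (τ, τ + r)) (by fun_prop)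
          fun τ hτ => ⟨hJ ⟨?_, ?_⟩, hJ ⟨?_, ?_⟩⟩ <;> simp only <;> linarith [hτ.1, hτ.2]
      have i2 : IntervalIntegrable (fun τ => F τ (τ + r)) volume a b :=
        cF (by linarith) hab (by linarith)
      have i3 : IntervalIntegrable (fun τ => F (τ - r) (τ - r + r)) volume a b := by
        have := (cF (s := a - r) (t := b - r) (by linarith) (by linarith) (by linarith)).comp_sub_right r
        simpa using this
      have e1 : (∫ τ in a..b, (-(Q (U τ) (U (τ + r) - U (τ - r))
          + inner ℝ (N τ) (ι (U (τ + r) - U (τ - r)))) + inner ℝ (v τ) (v (τ + r) - v (τ - r))))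
          = (∫ τ in a..b, F τ (τ + r)) - (∫ τ in a..b, F (τ - r) (τ - r + r))
            - ∫ τ in a..b, inner ℝ (N τ) (ι (U (τ + r) - U (τ - r))) := by
        rw [← intervalIntegral.integral_sub i2 i3, ← intervalIntegral.integral_sub (i2.sub i3) i1]
        congr 1; ext τ
        rw [sub_add_cancel, hFs (τ - r) τ]
        simp only [hF, map_sub, inner_sub_right]
        ring
      have e2 : (∫ τ in a..b, F (τ - r) (τ - r + r)) = ∫ τ in (a - r)..(b - r), F τ (τ + r) :=
        intervalIntegral.integral_comp_sub_right (fun τ => F τ (τ + r)) r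
      have e3 : (∫ τ in a..b, F τ (τ + r)) - ∫ τ in (a - r)..(b - r), F τ (τ + r)
          = (∫ τ in (b - r)..b, F τ (τ + r)) - ∫ τ in (a - r)..a, F τ (τ + r) := by
        have q1 := intervalIntegral.integral_add_adjacent_intervals
          (cF (s := a - r) (t := a) (by linarith) (by linarith) (by linarith)) i2
        have q2 := intervalIntegral.integral_add_adjacent_intervals
          (cF (s := a - r) (t := b - r) (by linarith) (by linarith) (by linarith))
          (cF (s := b - r) (t := b) (by linarith) (by linarith) (by linarith))
        linarith
      rw [e1, e2, e3] at pr
      simp only [inner_smul_right]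
      rw [intervalIntegral.integral_const_mul]
      simp only [map_sub] at pr
      rw [← mul_sub, pr]; ring
    · intro s hs t ht
      have j1 : IntervalIntegrable (fun τ => v (τ + r)) volume s t :=
        (cvp.mono (subI hs ht)).intervalIntegrable
      have j2 : IntervalIntegrable (fun τ => v (τ - r)) volume s t :=
        (cvm.mono (subI hs ht)).intervalIntegrable
      rw [intervalIntegral.integral_sub j1 j2, intervalIntegral.integral_comp_add_right v,
        intervalIntegral.integral_comp_sub_right v, ← h.state _ (sp s hs) _ (sp t ht),
        ← h.state _ (sm s hs) _ (sm t ht)]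
      simp only [map_sub]; abel
  have hlim : ∀ c, a' < c → c < b' →
      Tendsto (fun r : ℝ => r⁻¹ • (ι (U (c + r)) - ι (U (c - r)))) (𝓝[>] 0) (𝓝 ((2 : ℝ) • v c)) := by
    intro c h1 h2
    have hd := h.hasDerivAt_state (hnh h1 h2)
    have d1 : HasDerivAt (fun r : ℝ => ι (U (c + r))) (v c) 0 := by
      have : HasDerivAt (fun s => ι (U s)) (v c) (c + 0) := by simpa using hd
      exact this.comp_const_add c 0
    have d2 : HasDerivAt (fun r : ℝ => ι (U (c - r))) (-v c) 0 := by
      have : HasDerivAt (fun s => ι (U s)) (v c) (c - 0) := by simpa using hd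
      exact this.comp_const_sub c 0
    have d3 := (d1.sub d2).tendsto_slope_zero_right
    simp only [Pi.sub_apply, zero_add, add_zero, sub_zero, sub_self, sub_neg_eq_add] at d3
    rwa [two_smul]
  obtain ⟨C, hC⟩ := isCompact_Icc.exists_bound_of_continuousOn (h.continuous_velocity.mono hJ)
  have L1 := ((tendsto_const_nhds (x := v b)).inner (𝕜 := ℝ) (hlim b (by linarith) hbb)).sub
    ((tendsto_const_nhds (x := v a)).inner (𝕜 := ℝ) (hlim a haa (by linarith)))
  have L2 := (tendsto_average_shift hFc (by linarith : a' < b) hbb hJ).sub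
    (tendsto_average_shift hFc haa (by linarith : a < b') hJ)
  have L3 : Tendsto (fun r : ℝ => ∫ τ in a..b, inner ℝ (N τ) (r⁻¹ • (ι (U (τ + r)) - ι (U (τ - r)))))
      (𝓝[>] 0) (𝓝 (∫ τ in a..b, inner ℝ (N τ) ((2 : ℝ) • v τ))) := by
    refine intervalIntegral.tendsto_integral_filter_of_dominated_convergence
      (fun τ => ‖N τ‖ * (2 * C)) ?_ ?_ ((h.integrable_force a haJ b hbJ).norm.mul_const _) ?_
    · filter_upwards [Ioo_mem_nhdsGT hd0] with r hr
      have r1 : r < a - a' := hr.2.trans_le (min_le_left _ _)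
      have r2 : r < b' - b := hr.2.trans_le (min_le_right _ _)
      have cc : ContinuousOn (fun τ => r⁻¹ • (ι (U (τ + r)) - ι (U (τ - r)))) (Set.Icc a b) := by
        refine continuousOn_const.smul (ContinuousOn.sub ?_ ?_)
        · exact ι.continuous.comp_continuousOn (h.continuous_state.comp (by fun_prop)
            fun τ hτ => hJ ⟨by linarith [hτ.1, hr.1], by linarith [hτ.2]⟩)
        · exact ι.continuous.comp_continuousOn (h.continuous_state.comp (by fun_prop)
            fun τ hτ => hJ ⟨by linarith [hτ.1], by linarith [hτ.2, hr.1]⟩)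
      have := ((h.integrable_force a haJ b hbJ).inner_continuousOn hab cc).1.aestronglyMeasurable
      rwa [Set.uIoc_of_le hab]
    · filter_upwards [Ioo_mem_nhdsGT hd0] with r hr
      have r0 : 0 < r := hr.1
      have r1 : r < a - a' := hr.2.trans_le (min_le_left _ _)
      have r2 : r < b' - b := hr.2.trans_le (min_le_right _ _)
      refine Eventually.of_forall fun τ hτ => ?_
      rw [Set.uIoc_of_le hab] at hτ
      refine (norm_inner_le_norm _ _).trans (mul_le_mul_of_nonneg_left ?_ (norm_nonneg _))
      -- The bound `C` on the velocity makes `ι ∘ U` Lipschitz, so the difference quotients are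
      -- dominated by `2 C`.
      have := h.norm_state_sub_le ha' hb' hC (s := τ - r) (t := τ + r)
        ⟨by linarith [hτ.1], by linarith [hτ.2]⟩ ⟨by linarith [hτ.1], by linarith [hτ.2]⟩
      rw [show |τ + r - (τ - r)| = 2 * r by rw [show τ + r - (τ - r) = 2 * r by ring, abs_of_pos (by linarith)]] at this
      rw [norm_smul, norm_inv, Real.norm_of_nonneg r0.le]
      calc _ ≤ r⁻¹ * (C * (2 * r)) := by gcongr
        _ = 2 * C := by field_simp
    · refine Eventually.of_forall fun τ hτ => ?_
      rw [Set.uIoc_of_le hab] at hτ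
      exact tendsto_const_nhds.inner (hlim τ (by linarith [hτ.1]) (by linarith [hτ.2]))
  -- The left side tends to the increment of `2 ‖v‖²` and the windows to that of `F c c = ‖v‖² - Q
  -- (U, U)`. Subtracting leaves the increment of `‖v‖² + Q (U, U)`.
  have fin := tendsto_nhds_unique (L1.congr' (by filter_upwards [Ioo_mem_nhdsGT hd0] with r hr using key r hr))
    (L2.sub L3)
  simp only [inner_smul_right, real_inner_self_eq_norm_sq, hF, intervalIntegral.integral_const_mul] at fin
  linarith

/-- Endpoints of `J` leave no room for shifts. The function `f` below is constant on the open
interval by the interior identity and continuous on the closed one, hence constant there. -/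
theorem energy [CompleteSpace H] (h : WeakEvolution ι Q S J U v N)
    (hQ : ∀ x y, Q x y = Q y x) (hS : ∀ x ∈ S, ∀ y ∈ S, x - y ∈ S) {a b : ℝ} (ha : a ∈ J) (hb : b ∈ J)
    (hab : a ≤ b) :
    (‖v b‖ ^ 2 + Q (U b) (U b)) - (‖v a‖ ^ 2 + Q (U a) (U a))
      = -2 * ∫ τ in a..b, inner ℝ (N τ) (v τ) := by
  rcases hab.eq_or_lt with rfl | hlt
  · simp
  have hJ := h.Icc_subset ha hb
  have hi : IntervalIntegrable (fun τ => inner ℝ (N τ) (v τ)) volume a b :=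
    (h.integrable_force a ha b hb).inner_continuousOn hab (h.continuous_velocity.mono hJ)
  set m := (a + b) / 2 with hm
  have hm' : m ∈ Set.Ioo a b := ⟨by linarith, by linarith⟩
  set f : ℝ → ℝ := fun t => (‖v t‖ ^ 2 + Q (U t) (U t)) + 2 * ∫ τ in a..t, inner ℝ (N τ) (v τ) with hf
  have cf : ContinuousOn f (Set.Icc a b) := by
    have c1 := h.continuous_state.mono hJ
    refine ContinuousOn.add (((h.continuous_velocity.mono hJ).norm.pow 2).add
      ((Q.continuous.comp_continuousOn c1).clm_apply c1)) (continuousOn_const.mul ?_)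
    have := intervalIntegral.continuousOn_primitive_interval'
      (f := fun τ => inner ℝ (N τ) (v τ)) (μ := volume) hi Set.left_mem_uIcc
    rwa [Set.uIcc_of_le hab] at this
  have hsub : ∀ {t}, t ∈ Set.Icc a b →
      IntervalIntegrable (fun τ => inner ℝ (N τ) (v τ)) volume a t := fun ht =>
    hi.mono_set (Set.uIcc_subset_uIcc_left (by rwa [Set.uIcc_of_le hab]))
  have conn : ∀ s ∈ Set.Ioo a b, ∀ t ∈ Set.Ioo a b, s ≤ t → f t = f s := by
    intro s hs t ht hst
    have := h.energy_interior hQ hS ha hb hs.1 hst ht.2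
    have e := intervalIntegral.integral_interval_sub_left
      (hsub ⟨ht.1.le, ht.2.le⟩) (hsub ⟨hs.1.le, hs.2.le⟩)
    simp only [hf]
    linarith
  have hE : Set.EqOn f (fun _ => f m) (Set.Ioo a b) := fun t ht => by
    rcases le_total m t with h1 | h1
    · exact conn m hm' t ht h1
    · exact (conn t ht m hm' h1).symm
  have hE' := hE.of_subset_closure cf continuousOn_const Set.Ioo_subset_Icc_self
    (by rw [closure_Ioo hlt.ne])
  have := (hE' (Set.right_mem_Icc.2 hab)).trans (hE' (Set.left_mem_Icc.2 hab)).symm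
  simp only [hf, intervalIntegral.integral_same] at this
  linarith

/-- Virial identity: test the equation with `B n (U t)`, `B n` antisymmetric, and let `n → ∞`. -/
theorem virial [CompleteSpace H] (h : WeakEvolution ι Q S J U v N) {B : ℕ → K →L[ℝ] K} {B' : ℕ → H →L[ℝ] H}
    {A : K →L[ℝ] H} {P : K → ℝ} {C : ℝ} (hBS : ∀ n, ∀ x ∈ S, B n x ∈ S)
    (hB : ∀ n x, ι (B n x) = B' n (ι x)) (hanti : ∀ n x, inner ℝ x (B' n x) = 0)
    (hbd : ∀ n, ∀ x ∈ S, ‖B' n (ι x)‖ ≤ C * ‖x‖)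
    (hlim : ∀ x ∈ S, ∀ y, Tendsto (fun n => inner ℝ y (B' n (ι x))) atTop (𝓝 (inner ℝ y (A x))))
    (hQbd : ∀ n, ∀ x ∈ S, |Q x (B n x)| ≤ C * ‖x‖ ^ 2)
    (hQlim : ∀ x ∈ S, Tendsto (fun n => Q x (B n x)) atTop (𝓝 (P x)))
    {a b : ℝ} (ha : a ∈ J) (hb : b ∈ J) (hab : a ≤ b) :
    inner ℝ (v b) (A (U b)) - inner ℝ (v a) (A (U a))
      = -∫ τ in a..b, (P (U τ) + inner ℝ (N τ) (A (U τ))) := by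
  have hJ := h.Icc_subset ha hb
  have cU := h.continuous_state.mono hJ
  have cv := h.continuous_velocity.mono hJ
  have key : ∀ n, inner ℝ (v b) (B' n (ι (U b))) - inner ℝ (v a) (B' n (ι (U a)))
      = ∫ τ in a..b, -(Q (U τ) (B n (U τ)) + inner ℝ (N τ) (B' n (ι (U τ)))) := by
    intro n
    have pr := h.inner_sub_inner hab ha hb (x := fun τ => B n (U τ)) (y := fun τ => B' n (v τ))
      ((B n).continuous.comp_continuousOn cU) ((B' n).continuous.comp_continuousOn cv)
      (fun t ht => hBS n _ (h.mem t (hJ ht))) ?_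
    -- The kinetic term `⟪v, B' n v⟫` vanishes by antisymmetry.
    · simpa only [hB, hanti, add_zero] using pr
    · intro s hs t ht
      have j : IntervalIntegrable v volume s t :=
        (cv.mono (Set.uIcc_subset_Icc hs ht)).intervalIntegrable
      rw [hB, hB, ← map_sub, h.state s (hJ hs) t (hJ ht), (B' n).intervalIntegral_comp_comm j]
  obtain ⟨R, hR⟩ := isCompact_Icc.exists_bound_of_continuousOn cU
  have hR0 : 0 ≤ R := (norm_nonneg _).trans (hR a (Set.left_mem_Icc.2 hab))
  have hC : ∀ τ ∈ Set.Icc a b, C * ‖U τ‖ ≤ |C| * R := fun τ hτ =>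
    mul_le_mul (le_abs_self C) (hR τ hτ) (norm_nonneg _) (abs_nonneg _)
  have hC2 : ∀ τ ∈ Set.Icc a b, C * ‖U τ‖ ^ 2 ≤ |C| * R ^ 2 := fun τ hτ =>
    mul_le_mul (le_abs_self C) (pow_le_pow_left₀ (norm_nonneg _) (hR τ hτ) 2) (by positivity) (abs_nonneg _)
  have L1 := (hlim _ (h.mem b hb) (v b)).sub (hlim _ (h.mem a ha) (v a))
  have L2 : Tendsto (fun n => ∫ τ in a..b, -(Q (U τ) (B n (U τ)) + inner ℝ (N τ) (B' n (ι (U τ)))))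
      atTop (𝓝 (∫ τ in a..b, -(P (U τ) + inner ℝ (N τ) (A (U τ))))) := by
    refine intervalIntegral.tendsto_integral_filter_of_dominated_convergence
      (fun τ => |C| * R ^ 2 + ‖N τ‖ * (|C| * R)) (Eventually.of_forall fun n => ?_)
      (Eventually.of_forall fun n => Eventually.of_forall fun τ hτ => ?_)
      (intervalIntegrable_const.add ((h.integrable_force a ha b hb).norm.mul_const _))
      (Eventually.of_forall fun τ hτ => ?_)
    · have i1 := h.intervalIntegrable_form hab ha hb (x := fun τ => B n (U τ))
        ((B n).continuous.comp_continuousOn cU)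
      have i2 := (h.integrable_force a ha b hb).inner_continuousOn hab
        (y := fun τ => B' n (ι (U τ))) ((B' n).continuous.comp_continuousOn (ι.continuous.comp_continuousOn cU))
      rw [Set.uIoc_of_le hab]
      exact (i1.add i2).neg.1.aestronglyMeasurable
    · rw [Set.uIoc_of_le hab] at hτ
      have hτ' := Set.Ioc_subset_Icc_self hτ
      rw [norm_neg]
      refine (norm_add_le _ _).trans (add_le_add ((hQbd n _ (h.mem τ (hJ hτ'))).trans (hC2 τ hτ')) ?_)
      exact (norm_inner_le_norm _ _).trans (mul_le_mul_of_nonneg_left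
        ((hbd n _ (h.mem τ (hJ hτ'))).trans (hC τ hτ')) (norm_nonneg _))
    · rw [Set.uIoc_of_le hab] at hτ
      have hτ' := h.mem τ (hJ (Set.Ioc_subset_Icc_self hτ))
      exact ((hQlim _ hτ').add (hlim _ hτ' _)).neg
  rw [← intervalIntegral.integral_neg]
  exact tendsto_nhds_unique (L1.congr key) L2

end WeakEvolution

end Evolution

/-! ### The Euler field, test functions and the centrifugal potential. -/

/-- The Euler vector field `x · ∇`; it is the gradient of `log cosh r`. -/
def euler (f : E3 → ℝ) (x : E3) : ℝ := fderiv ℝ f x x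

/-- The Euclidean gradient in the chart. -/
def grad (f : E3 → ℝ) (x : E3) : E3 := WithLp.toLp 2 (diff f x)

theorem sum_coord_smul (x : E3) : ∑ i, x i • (EuclideanSpace.single i 1 : E3) = x := by
  ext j
  simp [Finset.sum_apply, Pi.single_apply]

theorem fderiv_apply_eq_sum (f : E3 → ℝ) (x y : E3) : fderiv ℝ f x y = ∑ i, y i * diff f x i := by
  conv_lhs => rw [← sum_coord_smul y]
  simp [diff]

theorem inner_grad (f : E3 → ℝ) (x y : E3) : inner ℝ y (grad f x) = fderiv ℝ f x y := by
  rw [fderiv_apply_eq_sum]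
  simp [grad, PiLp.inner_apply, mul_comm]

theorem euler_eq_inner (f : E3 → ℝ) (x : E3) : euler f x = inner ℝ x (grad f x) :=
  (inner_grad f x x).symm

theorem grad_add {f h : E3 → ℝ} {x : E3} (hf : DifferentiableAt ℝ f x) (hh : DifferentiableAt ℝ h x) :
    grad (fun y => f y + h y) x = grad f x + grad h x := by
  ext i
  simp [grad, diff, fderiv_fun_add hf hh]

theorem grad_const_smul (c : ℝ) (f : E3 → ℝ) (x : E3) (hf : DifferentiableAt ℝ f x) :
    grad (fun y => c * f y) x = c • grad f x := by
  ext i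
  simp [grad, diff, fderiv_const_mul hf]

theorem grad_mul {f h : E3 → ℝ} {x : E3} (hf : DifferentiableAt ℝ f x) (hh : DifferentiableAt ℝ h x) :
    grad (fun y => f y * h y) x = f x • grad h x + h x • grad f x := by
  ext i
  simp [grad, diff, fderiv_fun_mul hf hh]

theorem euler_mul {f h : E3 → ℝ} {x : E3} (hf : DifferentiableAt ℝ f x) (hh : DifferentiableAt ℝ h x) :
    euler (fun y => f y * h y) x = f x * euler h x + h x * euler f x := by
  simp [euler, fderiv_fun_mul hf hh]

namespace IsTest

variable {f h : E3 → ℝ}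

theorem continuous (hf : IsTest f) : Continuous f := hf.1.continuous

theorem differentiableAt (hf : IsTest f) (x : E3) : DifferentiableAt ℝ f x :=
  hf.1.differentiable (by simp) x

theorem memLp (hf : IsTest f) (p : ℝ≥0∞) : MemLp f p volume :=
  hf.continuous.memLp_of_hasCompactSupport hf.2

theorem integrable (hf : IsTest f) : Integrable f volume :=
  hf.continuous.integrable_of_hasCompactSupport hf.2

theorem add (hf : IsTest f) (hh : IsTest h) : IsTest (fun x => f x + h x) :=
  ⟨hf.1.add hh.1, hf.2.add hh.2⟩

theorem mul_left (hm : ContDiff ℝ ∞ h) (hf : IsTest f) : IsTest (fun x => h x * f x) :=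
  ⟨hm.mul hf.1, hf.2.mul_left⟩

theorem mul (hh : IsTest h) (hf : IsTest f) : IsTest (fun x => h x * f x) := hf.mul_left hh.1

theorem const_mul (c : ℝ) (hf : IsTest f) : IsTest (fun x => c * f x) := hf.mul_left contDiff_const

theorem zero : IsTest (fun _ => 0) := ⟨contDiff_const, HasCompactSupport.zero⟩

theorem contDiff_fderiv (hf : ContDiff ℝ ∞ f) : ContDiff ℝ ∞ (fderiv ℝ f) :=
  hf.fderiv_right (by simp)

theorem fderiv_apply (hf : IsTest f) (y : E3) : IsTest (fun x => fderiv ℝ f x y) :=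
  ⟨(contDiff_fderiv hf.1).clm_apply contDiff_const, hf.2.fderiv_apply (𝕜 := ℝ) y⟩

theorem euler (hf : IsTest f) : IsTest (euler f) := by
  refine ⟨(contDiff_fderiv hf.1).clm_apply contDiff_id, ?_⟩
  refine (hf.2.fderiv (𝕜 := ℝ)).mono fun x hx => ?_
  contrapose! hx
  simp only [Function.mem_support, not_not] at hx ⊢
  simp [HypWave.euler, hx]

theorem continuous_grad (hf : IsTest f) : Continuous (grad f) := by
  have : Continuous (fun x => diff f x) :=
    continuous_pi fun i => (hf.fderiv_apply _).continuous
  exact (PiLp.continuous_toLp 2 _).comp this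

theorem hasCompactSupport_grad (hf : IsTest f) : HasCompactSupport (grad f) := by
  refine (hf.2.fderiv (𝕜 := ℝ)).mono fun x hx => ?_
  contrapose! hx
  simp only [Function.mem_support, not_not] at hx ⊢
  ext i
  simp [grad, diff, hx]

theorem memLp_grad (hf : IsTest f) (p : ℝ≥0∞) : MemLp (grad f) p volume :=
  hf.continuous_grad.memLp_of_hasCompactSupport hf.hasCompactSupport_grad

theorem comp_smul (hf : IsTest f) {c : ℝ} (hc : c ≠ 0) : IsTest (fun x => f (c • x)) :=
  ⟨hf.1.comp (contDiff_const_smul c), hf.2.comp_homeomorph (Homeomorph.smulOfNeZero c hc)⟩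

end IsTest

theorem integral_coord_mul_fderiv {f : E3 → ℝ} (hf : ContDiff ℝ 1 f) (hs : HasCompactSupport f) (i : Fin 3) :
    ∫ x : E3, x i * fderiv ℝ f x (EuclideanSpace.single i 1) = -∫ x, f x := by
  have hd : ∀ x : E3, fderiv ℝ (fun y : E3 => y i) x (EuclideanSpace.single i 1) = 1 := by
    intro x
    have : (fun y : E3 => y i) = EuclideanSpace.proj (𝕜 := ℝ) i := by ext y; simp
    rw [this, ContinuousLinearMap.fderiv]
    simp
  have hc : Continuous (fun x : E3 => x i) := by fun_prop
  have hcf : Continuous (fun x => fderiv ℝ f x (EuclideanSpace.single i 1)) :=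
    (hf.continuous_fderiv (by simp)).clm_apply continuous_const
  have h := integral_mul_fderiv_eq_neg_fderiv_mul_of_integrable (μ := (volume : Measure E3))
    (f := fun y : E3 => y i) (g := f) (v := EuclideanSpace.single i 1) ?_ ?_ ?_
    (fun x _ => by fun_prop) (fun x _ => hf.differentiable (by simp) x)
  · simpa [hd] using h
  · simp only [hd, one_mul]
    exact hf.continuous.integrable_of_hasCompactSupport hs
  · exact (hc.mul hcf).integrable_of_hasCompactSupport ((hs.fderiv_apply (𝕜 := ℝ) _).mul_left)
  · exact (hc.mul hf.continuous).integrable_of_hasCompactSupport hs.mul_left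

/-- The field `x` has divergence `3` in `ℝ³`. Regularity `C¹` suffices, as needed later for the
truncated primitive. -/
theorem integral_euler {f : E3 → ℝ} (hf : ContDiff ℝ 1 f) (hs : HasCompactSupport f) :
    ∫ x, euler f x = -3 * ∫ x, f x := by
  have hi : ∀ i : Fin 3, Integrable (fun x : E3 => x i * fderiv ℝ f x (EuclideanSpace.single i 1)) := by
    intro i
    have hc : Continuous (fun x : E3 => x i) := by fun_prop
    exact (hc.mul ((hf.continuous_fderiv (by simp)).clm_apply
      continuous_const)).integrable_of_hasCompactSupport ((hs.fderiv_apply (𝕜 := ℝ) _).mul_left)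
  simp only [euler, fun x => fderiv_apply_eq_sum f x x]
  simp only [diff]
  rw [integral_finsetSum _ fun i _ => hi i]
  simp only [integral_coord_mul_fderiv hf hs, Fin.sum_univ_three]
  ring

theorem euler_radial {φ : ℝ → ℝ} {φ' : ℝ} {x : E3} (h : HasDerivAt φ φ' (‖x‖ ^ 2)) :
    euler (fun y : E3 => φ (‖y‖ ^ 2)) x = 2 * ‖x‖ ^ 2 * φ' := by
  have h2 : HasFDerivAt (fun y : E3 => ‖y‖ ^ 2) (2 • innerSL ℝ x) x :=
    (hasStrictFDerivAt_norm_sq x).hasFDerivAt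
  have := (h.comp_hasFDerivAt x h2).fderiv
  change fderiv ℝ (φ ∘ fun y : E3 => ‖y‖ ^ 2) x x = _
  rw [this]
  simp
  ring

theorem one_add_norm_sq_pos (x : E3) : 0 < 1 + ‖x‖ ^ 2 := by positivity

theorem contDiff_radial_inv : ContDiff ℝ ∞ (fun x : E3 => (1 + ‖x‖ ^ 2)⁻¹) :=
  (contDiff_const.add (contDiff_norm_sq ℝ)).inv fun x => (one_add_norm_sq_pos x).ne'

theorem hasDerivAt_one_add_inv {s : ℝ} (hs : 0 ≤ s) :
    HasDerivAt (fun s : ℝ => (1 + s)⁻¹) (-((1 + s) ^ 2)⁻¹) s := by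
  have h : (1 + s) ≠ 0 := by positivity
  have := ((hasDerivAt_id s).const_add 1).inv h
  exact HasDerivAt.congr_deriv this (by simp [div_eq_mul_inv])

theorem IsTest.integral_euler {f : E3 → ℝ} (hf : IsTest f) : ∫ x, HypWave.euler f x = -3 * ∫ x, f x :=
  HypWave.integral_euler (hf.1.of_le (by simp)) hf.2

/-- The centrifugal part of the potential after conjugation with the square root of the volume density. -/
def centrifugal (x : E3) : ℝ := 1 / 4 * (1 - (1 + ‖x‖ ^ 2)⁻¹)

theorem contDiff_centrifugal : ContDiff ℝ ∞ centrifugal :=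
  contDiff_const.mul (contDiff_const.sub contDiff_radial_inv)

theorem centrifugal_nonneg (x : E3) : 0 ≤ centrifugal x := by
  have : (1 + ‖x‖ ^ 2)⁻¹ ≤ 1 := inv_le_one_of_one_le₀ (by nlinarith [sq_nonneg ‖x‖])
  unfold centrifugal
  linarith

theorem centrifugal_le (x : E3) : centrifugal x ≤ 1 / 4 := by
  have := inv_pos.2 (one_add_norm_sq_pos x)
  unfold centrifugal
  linarith

theorem euler_centrifugal (x : E3) :
    euler centrifugal x = 1 / 2 * ‖x‖ ^ 2 * ((1 + ‖x‖ ^ 2) ^ 2)⁻¹ := by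
  have h : HasDerivAt (fun s : ℝ => 1 / 4 * (1 - (1 + s)⁻¹)) (1 / 4 * ((1 + ‖x‖ ^ 2) ^ 2)⁻¹) (‖x‖ ^ 2) := by
    have := ((hasDerivAt_one_add_inv (s := ‖x‖ ^ 2) (by positivity)).const_sub 1).const_mul (1 / 4)
    rwa [neg_neg] at this
  exact (euler_radial h).trans (by ring)

/-! ### Weighted integration by parts and a Hardy inequality. -/

section Weighted

variable {f h m : E3 → ℝ}

/-- The operator `x · ∇ + 3/2` is antisymmetric, so only its commutator with `m` survives: integrate
the Euler derivative of `m f²`. -/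
theorem integral_mul_euler (hm : ContDiff ℝ ∞ m) (hf : IsTest f) :
    ∫ x, m x * f x * (euler f x + 3 / 2 * f x) = -(1 / 2) * ∫ x, euler m x * f x ^ 2 := by
  have hmd : ∀ x, DifferentiableAt ℝ m x := fun x => hm.differentiable (by simp) x
  have hff := hf.mul hf
  have h1 := (hff.mul_left hm).integral_euler
  have e : ∀ x, euler (fun x => m x * (f x * f x)) x = euler m x * f x ^ 2 + 2 * (m x * (f x * euler f x)) := by
    intro x
    rw [euler_mul (hmd x) (hff.differentiableAt x),
      euler_mul (hf.differentiableAt x) (hf.differentiableAt x)]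
    ring
  have i1 : Integrable (fun x => m x * (f x * euler f x)) := ((hf.mul hf.euler).mul_left hm).integrable
  have i2 : Integrable (fun x => m x * (f x * f x)) := (hff.mul_left hm).integrable
  have i3 : Integrable (fun x => euler m x * f x ^ 2) := by
    have hme : ContDiff ℝ ∞ (euler m) := (IsTest.contDiff_fderiv hm).clm_apply contDiff_id
    simpa only [sq] using (hff.mul_left hme).integrable
  simp only [e] at h1
  rw [integral_add i3 (i1.const_mul 2), integral_const_mul] at h1
  have e2 : (∫ x, m x * f x * (euler f x + 3 / 2 * f x))
      = (∫ x, m x * (f x * euler f x)) + 3 / 2 * ∫ x, m x * (f x * f x) := by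
    rw [← integral_const_mul, ← integral_add i1 (i2.const_mul _)]
    congr 1; ext x; ring
  rw [e2]
  linarith

theorem integral_euler_mul (hf : IsTest f) (hh : IsTest h) :
    ∫ x, (euler f x + 3 / 2 * f x) * h x = -∫ x, f x * (euler h x + 3 / 2 * h x) := by
  have h1 := (hf.mul hh).integral_euler
  have e : ∀ x, euler (fun x => f x * h x) x = f x * euler h x + h x * euler f x :=
    fun x => euler_mul (hf.differentiableAt x) (hh.differentiableAt x)
  have i1 := (hf.mul hh.euler).integrable
  have i2 := (hh.mul hf.euler).integrable
  have i3 := (hf.mul hh).integrable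
  simp only [e] at h1
  rw [integral_add i1 i2] at h1
  have e1 : (∫ x, (euler f x + 3 / 2 * f x) * h x) = (∫ x, h x * euler f x) + 3 / 2 * ∫ x, f x * h x := by
    rw [← integral_const_mul, ← integral_add i2 (i3.const_mul _)]
    congr 1; ext x; ring
  have e2 : (∫ x, f x * (euler h x + 3 / 2 * h x)) = (∫ x, f x * euler h x) + 3 / 2 * ∫ x, f x * h x := by
    rw [← integral_const_mul, ← integral_add i1 (i3.const_mul _)]
    congr 1; ext x; ring
  linarith

theorem integral_mul_euler_self (hf : IsTest f) :
    ∫ x, f x * euler f x = -(3 / 2) * ∫ x, f x ^ 2 := by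
  have h1 := integral_euler_mul hf hf
  have i1 := (hf.mul hf.euler).integrable
  have i3 := (hf.mul hf).integrable
  have e : (∫ x, (euler f x + 3 / 2 * f x) * f x) = ∫ x, f x * (euler f x + 3 / 2 * f x) := by
    congr 1; ext x; ring
  have e2 : (∫ x, f x * (euler f x + 3 / 2 * f x)) = (∫ x, f x * euler f x) + 3 / 2 * ∫ x, f x ^ 2 := by
    simp only [sq]
    rw [← integral_const_mul, ← integral_add i1 (i3.const_mul _)]
    congr 1; ext x; ring
  linarith

theorem IsTest.integrable_norm_grad_sq (hf : IsTest f) : Integrable (fun x => ‖grad f x‖ ^ 2) :=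
  (memLp_two_iff_integrable_sq_norm hf.continuous_grad.aestronglyMeasurable).1 (hf.memLp_grad 2)

/-- A Hardy type inequality. -/
theorem hardy_centrifugal (hf : IsTest f) :
    1 / 2 * ∫ x, euler centrifugal x * f x ^ 2 ≤ ∫ x, ‖grad f x‖ ^ 2 := by
  -- Complete the square: expand `0 ≤ ∫ ‖∇f + g f x‖²`. With this `g` the resulting lower bound for
  -- `∫ ‖∇f‖²` exceeds the required one by `3/2 ∫ (1 + ‖x‖²)⁻² f²`.
  set g : E3 → ℝ := fun x => 1 / 2 * (1 + ‖x‖ ^ 2)⁻¹ with hg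
  have hgs : ContDiff ℝ ∞ g := contDiff_const.mul contDiff_radial_inv
  have hge : ∀ x, euler g x = -(‖x‖ ^ 2 * ((1 + ‖x‖ ^ 2) ^ 2)⁻¹) := by
    intro x
    have := (hasDerivAt_one_add_inv (s := ‖x‖ ^ 2) (by positivity)).const_mul (1 / 2)
    exact (euler_radial this).trans (by ring)
  have hff := hf.mul hf
  have i0 := hf.integrable_norm_grad_sq
  have i1 : Integrable (fun x => g x * f x * (euler f x + 3 / 2 * f x)) := by
    have := ((hf.mul (hf.euler.add (hf.const_mul (3 / 2)))).mul_left hgs).integrable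
    simpa only [mul_assoc] using this
  have i2 : Integrable (fun x => (g x ^ 2 * ‖x‖ ^ 2) * f x ^ 2) := by
    have := (hff.mul_left ((hgs.pow 2).mul (contDiff_norm_sq ℝ))).integrable
    simpa only [sq (f _)] using this
  have i3 : Integrable (fun x => euler g x * f x ^ 2) := by
    have hme : ContDiff ℝ ∞ (euler g) := (IsTest.contDiff_fderiv hgs).clm_apply contDiff_id
    simpa only [sq] using (hff.mul_left hme).integrable
  have i4 : Integrable (fun x => g x * f x ^ 2) := by
    simpa only [sq] using (hff.mul_left hgs).integrable
  have i5 : Integrable (fun x => euler centrifugal x * f x ^ 2) := by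
    have hme : ContDiff ℝ ∞ (euler centrifugal) :=
      (IsTest.contDiff_fderiv contDiff_centrifugal).clm_apply contDiff_id
    simpa only [sq] using (hff.mul_left hme).integrable
  have key : ∀ x, ‖grad f x + (g x * f x) • x‖ ^ 2
      = ‖grad f x‖ ^ 2 + 2 * (g x * f x * (euler f x + 3 / 2 * f x)) + (g x ^ 2 * ‖x‖ ^ 2) * f x ^ 2
        - 3 * (g x * f x ^ 2) := by
    intro x
    rw [norm_add_sq_real, inner_smul_right, real_inner_comm, ← euler_eq_inner, norm_smul, mul_pow,
      Real.norm_eq_abs, sq_abs]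
    ring
  have h0 : 0 ≤ ∫ x, ‖grad f x + (g x * f x) • x‖ ^ 2 := integral_nonneg fun x => by positivity
  simp only [key] at h0
  have i6 : Integrable (fun x => ‖grad f x‖ ^ 2 + 2 * (g x * f x * (euler f x + 3 / 2 * f x))) :=
    i0.add (i1.const_mul 2)
  have i7 : Integrable (fun x => ‖grad f x‖ ^ 2 + 2 * (g x * f x * (euler f x + 3 / 2 * f x))
      + (g x ^ 2 * ‖x‖ ^ 2) * f x ^ 2) := i6.add i2
  rw [integral_sub i7 (i4.const_mul 3), integral_add i6 i2, integral_add i0 (i1.const_mul 2),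
    integral_const_mul, integral_const_mul, integral_mul_euler hgs hf] at h0
  have h1 : (1 / 2 * ∫ x, euler centrifugal x * f x ^ 2) ≤
      (∫ x, euler g x * f x ^ 2) - (∫ x, (g x ^ 2 * ‖x‖ ^ 2) * f x ^ 2) + 3 * ∫ x, g x * f x ^ 2 := by
    have i8 : Integrable (fun x => euler g x * f x ^ 2 - (g x ^ 2 * ‖x‖ ^ 2) * f x ^ 2) := i3.sub i2
    rw [← integral_sub i3 i2, ← integral_const_mul, ← integral_const_mul,
      ← integral_add i8 (i4.const_mul 3)]
    refine integral_mono (i5.const_mul _) (i8.add (i4.const_mul 3)) fun x => ?_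
    have hp := one_add_norm_sq_pos x
    beta_reduce
    rw [hge x, euler_centrifugal x]
    simp only [hg]
    have : -(‖x‖ ^ 2 * ((1 + ‖x‖ ^ 2) ^ 2)⁻¹) * f x ^ 2 - (1 / 2 * (1 + ‖x‖ ^ 2)⁻¹) ^ 2 * ‖x‖ ^ 2 * f x ^ 2
        + 3 * (1 / 2 * (1 + ‖x‖ ^ 2)⁻¹ * f x ^ 2) - 1 / 2 * (1 / 2 * ‖x‖ ^ 2 * ((1 + ‖x‖ ^ 2) ^ 2)⁻¹ * f x ^ 2)
        = 3 / 2 * ((1 + ‖x‖ ^ 2) ^ 2)⁻¹ * f x ^ 2 := by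
      field_simp
      ring
    have h2 : 0 ≤ 3 / 2 * ((1 + ‖x‖ ^ 2) ^ 2)⁻¹ * f x ^ 2 := by positivity
    linarith
  linarith

end Weighted

/-! ### The unitary dilation group and its difference quotients. -/

section Dilation

variable {F : Type*} [NormedAddCommGroup F] [NormedSpace ℝ F]

/-- The `L²` normalized dilation by `e^h`. -/
def dilate (h : ℝ) (f : E3 → F) (x : E3) : F := Real.exp (3 * h / 2) • f (Real.exp h • x)

theorem IsTest.dilate {f : E3 → ℝ} (hf : IsTest f) (h : ℝ) : IsTest (dilate h f) :=
  (hf.comp_smul (Real.exp_pos h).ne').const_mul _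

theorem fderiv_dilate {f : E3 → ℝ} (hf : IsTest f) (h : ℝ) (x y : E3) :
    fderiv ℝ (dilate h f) x y
      = Real.exp (3 * h / 2) * (Real.exp h * fderiv ℝ f (Real.exp h • x) y) := by
  have h1 : HasFDerivAt (fun x : E3 => Real.exp h • x) (Real.exp h • ContinuousLinearMap.id ℝ E3) x :=
    (hasFDerivAt_id x).const_smul (Real.exp h)
  have h2 := ((hf.differentiableAt (Real.exp h • x)).hasFDerivAt.comp x h1).const_smul (Real.exp (3 * h / 2))
  have h3 : HasFDerivAt (dilate h f) _ x := h2
  rw [h3.fderiv]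
  simp

theorem euler_dilate {f : E3 → ℝ} (hf : IsTest f) (h : ℝ) :
    euler (dilate h f) = dilate h (euler f) := by
  ext x
  simp only [euler, fderiv_dilate hf, dilate, smul_eq_mul, map_smul]

theorem grad_dilate {f : E3 → ℝ} (hf : IsTest f) (h : ℝ) :
    grad (dilate h f) = fun x => Real.exp h • dilate h (grad f) x := by
  ext x i
  simp only [grad, diff, fderiv_dilate hf, dilate, PiLp.smul_apply, smul_eq_mul]
  ring

theorem hasDerivAt_dilate {f : E3 → ℝ} (hf : IsTest f) (h : ℝ) (x : E3) :
    HasDerivAt (fun s => dilate s f x) (dilate h (fun x => euler f x + 3 / 2 * f x) x) h := by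
  have h1 : HasDerivAt (fun s => Real.exp s • x) (Real.exp h • x) h := (Real.hasDerivAt_exp h).smul_const x
  have h2 := (hf.differentiableAt (Real.exp h • x)).hasFDerivAt.comp_hasDerivAt h h1
  have h3 : HasDerivAt (fun s : ℝ => Real.exp (3 * s / 2)) (Real.exp (3 * h / 2) * (3 / 2)) h := by
    have : HasDerivAt (fun s : ℝ => 3 * s / 2) (3 / 2) h := by
      simpa using ((hasDerivAt_id h).const_mul 3).div_const 2
    exact this.exp
  refine HasDerivAt.congr_deriv (h3.smul h2) ?_
  simp only [dilate, euler, smul_eq_mul]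
  ring

/-- Weak differentiability of the dilation group on test functions. -/
theorem hasDerivAt_integral_dilate_mul {f χ : E3 → ℝ} (hf : IsTest f) (hχ : IsTest χ) (h : ℝ) :
    HasDerivAt (fun s => ∫ x, dilate s f x * χ x)
      (∫ x, dilate h (fun x => euler f x + 3 / 2 * f x) x * χ x) h := by
  have hA : IsTest (fun x => euler f x + 3 / 2 * f x) := hf.euler.add (hf.const_mul _)
  obtain ⟨C, hC⟩ := hA.continuous.bounded_above_of_compact_support hA.2
  have hC0 : 0 ≤ C := (norm_nonneg _).trans (hC 0)
  refine (hasDerivAt_integral_of_dominated_loc_of_deriv_le (μ := (volume : Measure E3))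
    (F := fun s x => dilate s f x * χ x)
    (F' := fun s x => dilate s (fun x => euler f x + 3 / 2 * f x) x * χ x) (x₀ := h)
    (s := Metric.ball h 1) (Metric.ball_mem_nhds h one_pos)
    (bound := fun x => Real.exp (3 * (h + 1) / 2) * C * ‖χ x‖) ?_ ?_ ?_ ?_ ?_ ?_).2
  · exact Eventually.of_forall fun s => ((hf.dilate s).mul hχ).continuous.aestronglyMeasurable
  · exact ((hf.dilate h).mul hχ).integrable
  · exact ((hA.dilate h).mul hχ).continuous.aestronglyMeasurable
  · refine Eventually.of_forall fun x s hs => ?_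
    rw [norm_mul]
    refine mul_le_mul_of_nonneg_right ?_ (norm_nonneg _)
    rw [dilate, norm_smul, Real.norm_of_nonneg (Real.exp_pos _).le]
    rw [Metric.mem_ball, Real.dist_eq, abs_lt] at hs
    exact mul_le_mul (Real.exp_le_exp.2 (by linarith [hs.2])) (hC _) (norm_nonneg _) (Real.exp_pos _).le
  · exact hχ.integrable.norm.const_mul _
  · exact Eventually.of_forall fun x s _ => (hasDerivAt_dilate hf s x).mul_const _

theorem tendsto_integral_inner_dilate {f χ : E3 → E3} (hf : Continuous f) (hfs : HasCompactSupport f)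
    (hχ : Continuous χ) (hχs : HasCompactSupport χ) :
    Tendsto (fun s => ∫ x, inner ℝ (dilate s f x) (χ x)) (𝓝 0) (𝓝 (∫ x, inner ℝ (f x) (χ x))) := by
  obtain ⟨C, hC⟩ := hf.bounded_above_of_compact_support hfs
  have hd : ∀ s : ℝ, Continuous (dilate s f) := fun s =>
    (hf.comp (continuous_const_smul (Real.exp s))).const_smul (Real.exp (3 * s / 2))
  refine tendsto_integral_filter_of_dominated_convergence
    (fun x => Real.exp (3 * 1 / 2) * C * ‖χ x‖) ?_ ?_ ?_ ?_
  · exact Eventually.of_forall fun s => ((hd s).inner hχ).aestronglyMeasurable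
  · filter_upwards [Metric.ball_mem_nhds (0 : ℝ) one_pos] with s hs
    refine Eventually.of_forall fun x => (norm_inner_le_norm _ _).trans
      (mul_le_mul_of_nonneg_right ?_ (norm_nonneg _))
    rw [dilate, norm_smul, Real.norm_of_nonneg (Real.exp_pos _).le]
    rw [Metric.mem_ball, Real.dist_eq, abs_lt] at hs
    exact mul_le_mul (Real.exp_le_exp.2 (by linarith [hs.2])) (hC _) (norm_nonneg _) (Real.exp_pos _).le
  · exact (hχ.integrable_of_hasCompactSupport hχs).norm.const_mul _
  · refine Eventually.of_forall fun x => ?_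
    have hc : Continuous (fun s : ℝ => (inner ℝ (dilate s f x) (χ x) : ℝ)) := by
      unfold dilate
      fun_prop
    have := hc.tendsto 0
    simpa [dilate] using this

end Dilation

/-- `L²(ℝ³, dx)` with values in `F`. -/
abbrev L2 (F : Type*) [NormedAddCommGroup F] := Lp F 2 (volume : Measure E3)

section Dilation

variable {F : Type*} [NormedAddCommGroup F] [InnerProductSpace ℝ F]

theorem dilate_congr_ae {f g : E3 → F} (h : f =ᵐ[volume] g) (s : ℝ) : dilate s f =ᵐ[volume] dilate s g := by
  have := (Measure.quasiMeasurePreserving_smul (volume : Measure E3) (Real.exp_pos s).ne').ae_eq_comp h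
  filter_upwards [this] with x hx
  simp only [dilate]
  exact congrArg _ hx

/-- The change of variables has Jacobian `e^(3s)`, which the normalizing factor `e^(3s/2)` splits
evenly between the two functions. This is the unitarity of the group. -/
theorem integral_inner_dilate (f g : E3 → F) (s : ℝ) :
    ∫ x, inner ℝ (dilate s f x) (g x) = ∫ x, inner ℝ (f x) (dilate (-s) g x) := by
  have h := Measure.integral_comp_smul (volume : Measure E3)
    (fun x => (inner ℝ (Real.exp (3 * s / 2) • f x) (g (Real.exp (-s) • x)) : ℝ)) (Real.exp s)
  simp only [smul_smul, ← Real.exp_add, neg_add_cancel, Real.exp_zero, one_smul,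
    finrank_euclideanSpace, Fintype.card_fin] at h
  simp only [dilate]
  rw [h, ← Real.exp_nat_mul, ← Real.exp_neg, abs_of_pos (Real.exp_pos _), smul_eq_mul,
    ← integral_const_mul]
  congr 1
  ext x
  rw [inner_smul_left, inner_smul_right, ← mul_assoc]
  congr 1
  simp only [conj_trivial]
  rw [← Real.exp_add]
  congr 1
  push_cast
  ring

theorem dilate_dilate (f : E3 → F) (s t : ℝ) : dilate s (dilate t f) = dilate (s + t) f := by
  ext x
  simp only [dilate, smul_smul, ← Real.exp_add]
  congr 2 <;> ring_nf

theorem dilate_zero (f : E3 → F) : dilate 0 f = f := by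
  ext x; simp [dilate]

theorem memLp_dilate {f : E3 → F} (hf : MemLp f 2 volume) (s : ℝ) : MemLp (dilate s f) 2 volume := by
  have hm : AEStronglyMeasurable (dilate s f) volume :=
    (hf.aestronglyMeasurable.comp_quasiMeasurePreserving
      (Measure.quasiMeasurePreserving_smul (volume : Measure E3) (Real.exp_pos s).ne')).const_smul _
  rw [memLp_two_iff_integrable_sq_norm hm]
  have h1 := (memLp_two_iff_integrable_sq_norm hf.aestronglyMeasurable).1 hf
  have h2 := (integrable_comp_smul_iff (volume : Measure E3) (fun x => ‖f x‖ ^ 2) (Real.exp_pos s).ne').2 h1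
  refine (h2.const_mul (Real.exp (3 * s / 2) ^ 2)).congr (Eventually.of_forall fun x => ?_)
  simp [dilate, norm_smul, mul_pow]

variable (F) in
/-- The dilation group on `L²` as a family of linear maps. -/
def dilationLM (s : ℝ) : L2 F →ₗ[ℝ] L2 F where
  toFun f := (memLp_dilate (Lp.memLp f) s).toLp
  map_add' f g := by
    rw [← MemLp.toLp_add]
    refine MemLp.toLp_congr _ _ ((dilate_congr_ae (Lp.coeFn_add f g) s).trans ?_)
    exact Eventually.of_forall fun x => by simp [dilate]
  map_smul' c f := by
    rw [RingHom.id_apply, ← MemLp.toLp_const_smul]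
    refine MemLp.toLp_congr _ _ ((dilate_congr_ae (Lp.coeFn_smul c f) s).trans ?_)
    exact Eventually.of_forall fun x => by simp [dilate, smul_comm c]

theorem coeFn_dilationLM (s : ℝ) (f : L2 F) : dilationLM F s f =ᵐ[volume] dilate s f :=
  (memLp_dilate (Lp.memLp f) s).coeFn_toLp

theorem inner_dilationLM (s : ℝ) (f g : L2 F) :
    inner ℝ (dilationLM F s f) g = ∫ x, inner ℝ (dilate s f x) (g x) := by
  rw [L2.inner_def]
  refine integral_congr_ae ?_
  filter_upwards [coeFn_dilationLM s f] with x hx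
  rw [hx]

theorem norm_dilationLM (s : ℝ) (f : L2 F) : ‖dilationLM F s f‖ = ‖f‖ := by
  rw [← sq_eq_sq₀ (norm_nonneg _) (norm_nonneg _), ← real_inner_self_eq_norm_sq,
    ← real_inner_self_eq_norm_sq, inner_dilationLM]
  have e : (∫ x, inner ℝ (dilate s f x) (dilationLM F s f x) : ℝ)
      = ∫ x, inner ℝ (dilate s f x) (dilate s f x) :=
    integral_congr_ae (by filter_upwards [coeFn_dilationLM s f] with x hx; rw [hx])
  rw [e, integral_inner_dilate, dilate_dilate, neg_add_cancel, dilate_zero, L2.inner_def]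

variable (F) in
/-- The unitary dilation group on `L²`. -/
def dilation (s : ℝ) : L2 F →L[ℝ] L2 F :=
  LinearMap.mkContinuous (dilationLM F s) 1 fun f => by rw [norm_dilationLM, one_mul]

theorem coeFn_dilation (s : ℝ) (f : L2 F) : dilation F s f =ᵐ[volume] dilate s f :=
  coeFn_dilationLM s f

theorem norm_dilation (s : ℝ) (f : L2 F) : ‖dilation F s f‖ = ‖f‖ := norm_dilationLM s f

theorem inner_dilation (s : ℝ) (f g : L2 F) :
    inner ℝ (dilation F s f) g = inner ℝ f (dilation F (-s) g) := by
  rw [L2.inner_def, L2.inner_def]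
  refine ((integral_congr_ae ?_).trans (integral_inner_dilate f g s)).trans (integral_congr_ae ?_)
  · filter_upwards [coeFn_dilation s f] with x hx; rw [hx]
  · filter_upwards [coeFn_dilation (-s) g] with x hx; rw [hx]

variable (F) in
/-- Symmetric difference quotients of the dilation group. -/
def dilationQuotient (s : ℝ) : L2 F →L[ℝ] L2 F := (2 * s)⁻¹ • (dilation F s - dilation F (-s))

theorem dilationQuotient_apply (s : ℝ) (f : L2 F) :
    dilationQuotient F s f = (2 * s)⁻¹ • (dilation F s f - dilation F (-s) f) := rfl

/-- The adjoint of the dilation by `s` is the dilation by `-s`, so the symmetric quotient is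
antisymmetric for every `s`, not just in the limit. This makes the kinetic term in the virial
identity vanish exactly. -/
theorem inner_dilationQuotient (s : ℝ) (f g : L2 F) :
    inner ℝ (dilationQuotient F s f) g = -inner ℝ f (dilationQuotient F s g) := by
  simp only [dilationQuotient, FunLike.coe_smul, Pi.smul_apply, FunLike.coe_sub, Pi.sub_apply,
    inner_smul_left, inner_smul_right, inner_sub_left, inner_sub_right, inner_dilation, neg_neg,
    conj_trivial]
  ring

theorem inner_dilationQuotient_self (s : ℝ) (f : L2 F) : inner ℝ f (dilationQuotient F s f) = 0 := by
  have := inner_dilationQuotient s f f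
  rw [real_inner_comm] at this
  linarith

end Dilation

/-! ### Multiplication operators, jets and the energy space. -/

theorem memLp_mul_bounded (m : BoundedContinuousFunction E3 ℝ) {f : E3 → ℝ} (hf : MemLp f 2 volume) :
    MemLp (fun x => m x * f x) 2 volume :=
  hf.of_le_mul (c := ‖m‖) (m.continuous.aestronglyMeasurable.mul hf.aestronglyMeasurable)
    (Eventually.of_forall fun x => by
      rw [norm_mul]
      exact mul_le_mul_of_nonneg_right (m.norm_coe_le_norm x) (norm_nonneg _))

/-- Multiplication by a bounded continuous function, as a linear map. -/
def mulLM (m : BoundedContinuousFunction E3 ℝ) : L2 ℝ →ₗ[ℝ] L2 ℝ where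
  toFun f := (memLp_mul_bounded m (Lp.memLp f)).toLp
  map_add' f g := by
    rw [← MemLp.toLp_add]
    refine MemLp.toLp_congr _ _ ?_
    filter_upwards [Lp.coeFn_add f g] with x hx
    rw [hx, Pi.add_apply, mul_add, Pi.add_apply]
  map_smul' c f := by
    rw [RingHom.id_apply, ← MemLp.toLp_const_smul]
    refine MemLp.toLp_congr _ _ ?_
    filter_upwards [Lp.coeFn_smul c f] with x hx
    rw [hx, Pi.smul_apply, Pi.smul_apply, smul_eq_mul, smul_eq_mul, mul_left_comm]

theorem coeFn_mulLM (m : BoundedContinuousFunction E3 ℝ) (f : L2 ℝ) :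
    mulLM m f =ᵐ[volume] fun x => m x * f x :=
  (memLp_mul_bounded m (Lp.memLp f)).coeFn_toLp

theorem norm_mulLM_le (m : BoundedContinuousFunction E3 ℝ) (f : L2 ℝ) : ‖mulLM m f‖ ≤ ‖m‖ * ‖f‖ := by
  refine Lp.norm_le_mul_norm_of_ae_le_mul ?_
  filter_upwards [coeFn_mulLM m f] with x hx
  rw [hx, norm_mul]
  exact mul_le_mul_of_nonneg_right (m.norm_coe_le_norm x) (norm_nonneg _)

/-- Multiplication by a bounded continuous function on `L²`. -/
def mulL2 (m : BoundedContinuousFunction E3 ℝ) : L2 ℝ →L[ℝ] L2 ℝ :=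
  LinearMap.mkContinuous (mulLM m) ‖m‖ (norm_mulLM_le m)

theorem coeFn_mulL2 (m : BoundedContinuousFunction E3 ℝ) (f : L2 ℝ) :
    mulL2 m f =ᵐ[volume] fun x => m x * f x :=
  coeFn_mulLM m f

/-- Triples `(f, g, e)` with `g = ∇f` and `e = x · ∇f` in mind. -/
abbrev Jet := L2 ℝ × L2 E3 × L2 ℝ

namespace Jet

/-- The value component. -/
def val : Jet →L[ℝ] L2 ℝ := ContinuousLinearMap.fst ℝ _ _

/-- The gradient component. -/
def gradient : Jet →L[ℝ] L2 E3 := (ContinuousLinearMap.fst ℝ _ _).comp (ContinuousLinearMap.snd ℝ _ _)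

/-- The Euler derivative component. -/
def radial : Jet →L[ℝ] L2 ℝ := (ContinuousLinearMap.snd ℝ _ _).comp (ContinuousLinearMap.snd ℝ _ _)

/-- The generator `x · ∇ + 3/2` of the dilation group. -/
def generator : Jet →L[ℝ] L2 ℝ := radial + (3 / 2 : ℝ) • val

theorem norm_val_le (w : Jet) : ‖val w‖ ≤ ‖w‖ := norm_fst_le w

theorem norm_gradient_le (w : Jet) : ‖gradient w‖ ≤ ‖w‖ := (norm_fst_le w.2).trans (norm_snd_le w)

theorem norm_radial_le (w : Jet) : ‖radial w‖ ≤ ‖w‖ := (norm_snd_le w.2).trans (norm_snd_le w)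

theorem generator_apply (w : Jet) : generator w = radial w + (3 / 2 : ℝ) • val w := rfl

theorem norm_generator_le (w : Jet) : ‖generator w‖ ≤ 5 / 2 * ‖w‖ := by
  rw [generator_apply]
  refine (norm_add_le _ _).trans ?_
  rw [norm_smul, Real.norm_of_nonneg (by norm_num)]
  linarith [norm_radial_le w, norm_val_le w]

/-- The Dirichlet form with potential `m`, conjugated to `L²(dx)`. -/
def form (m : BoundedContinuousFunction E3 ℝ) : Jet →L[ℝ] Jet →L[ℝ] ℝ :=
  LinearMap.mkContinuous₂
    (LinearMap.mk₂ ℝ (fun w z => inner ℝ (gradient w) (gradient z) + inner ℝ (radial w) (radial z)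
      + 1 / 2 * (inner ℝ (radial w) (val z) + inner ℝ (val w) (radial z))
      + inner ℝ (mulL2 m (val w)) (val z))
      (fun a b c => by simp only [map_add, inner_add_left]; ring)
      (fun r a b => by simp only [map_smul, inner_smul_left, smul_eq_mul, conj_trivial]; ring)
      (fun a b c => by simp only [map_add, inner_add_right]; ring)
      (fun r a b => by simp only [map_smul, inner_smul_right, smul_eq_mul]; ring))
    (3 + ‖mulL2 m‖) (by
      intro w z
      simp only [LinearMap.mk₂_apply]
      have b : ∀ {F : Type} [NormedAddCommGroup F] [InnerProductSpace ℝ F] (p q : F), ‖p‖ ≤ ‖w‖ → ‖q‖ ≤ ‖z‖ →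
          |inner ℝ p q| ≤ ‖w‖ * ‖z‖ := fun p q hp hq =>
        (abs_real_inner_le_norm p q).trans (mul_le_mul hp hq (norm_nonneg _) (norm_nonneg _))
      have b1 := abs_le.1 (b _ _ (norm_gradient_le w) (norm_gradient_le z))
      have b2 := abs_le.1 (b _ _ (norm_radial_le w) (norm_radial_le z))
      have b3 := abs_le.1 (b _ _ (norm_radial_le w) (norm_val_le z))
      have b4 := abs_le.1 (b _ _ (norm_val_le w) (norm_radial_le z))
      have b5 := abs_le.1 ((abs_real_inner_le_norm (mulL2 m (val w)) (val z)).trans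
        (mul_le_mul ((mulL2 m).le_opNorm_of_le (norm_val_le w)) (norm_val_le z) (norm_nonneg _) (by positivity)))
      rw [Real.norm_eq_abs, abs_le]
      constructor <;> linarith)

theorem form_apply (m : BoundedContinuousFunction E3 ℝ) (w z : Jet) :
    form m w z = inner ℝ (gradient w) (gradient z) + inner ℝ (radial w) (radial z)
      + 1 / 2 * (inner ℝ (radial w) (val z) + inner ℝ (val w) (radial z))
      + inner ℝ (mulL2 m (val w)) (val z) := rfl

theorem _root_.HypWave.inner_mulL2 (m : BoundedContinuousFunction E3 ℝ) (f g : L2 ℝ) :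
    inner ℝ (mulL2 m f) g = ∫ x, m x * f x * g x := by
  rw [L2.inner_def]
  refine integral_congr_ae ?_
  filter_upwards [coeFn_mulL2 m f] with x hx
  rw [hx]
  simp [mul_comm]

theorem form_symm (m : BoundedContinuousFunction E3 ℝ) (w z : Jet) : form m w z = form m z w := by
  have : inner ℝ (mulL2 m (val w)) (val z) = inner ℝ (mulL2 m (val z)) (val w) := by
    rw [inner_mulL2, inner_mulL2]
    congr 1; ext x; ring
  have c1 := real_inner_comm (gradient z) (gradient w)
  have c2 := real_inner_comm (radial z) (radial w)
  have c3 := real_inner_comm (val z) (radial w)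
  have c4 := real_inner_comm (radial z) (val w)
  rw [form_apply, form_apply]
  linarith

/-- The jet of a test function. -/
def IsJet (w : Jet) (ψ : E3 → ℝ) : Prop :=
  val w =ᵐ[volume] ψ ∧ gradient w =ᵐ[volume] grad ψ ∧ radial w =ᵐ[volume] euler ψ

theorem exists_isJet {ψ : E3 → ℝ} (h : IsTest ψ) : ∃ w, IsJet w ψ :=
  ⟨((h.memLp 2).toLp, (h.memLp_grad 2).toLp, (h.euler.memLp 2).toLp),
    (h.memLp 2).coeFn_toLp, (h.memLp_grad 2).coeFn_toLp, (h.euler.memLp 2).coeFn_toLp⟩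

theorem grad_zero' : grad (fun _ => 0) = fun _ => 0 := by
  ext x i; simp [grad, diff]

theorem euler_add {f h : E3 → ℝ} {x : E3} (hf : DifferentiableAt ℝ f x) (hh : DifferentiableAt ℝ h x) :
    euler (fun y => f y + h y) x = euler f x + euler h x := by
  simp [euler, fderiv_fun_add hf hh]

theorem euler_const_mul (c : ℝ) (f : E3 → ℝ) (x : E3) (hf : DifferentiableAt ℝ f x) :
    euler (fun y => c * f y) x = c * euler f x := by
  simp [euler, fderiv_const_mul hf]

/-- The jets of test functions. -/
def testJets : Submodule ℝ Jet where
  carrier := {w | ∃ ψ, IsTest ψ ∧ IsJet w ψ}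
  add_mem' := by
    rintro w z ⟨ψ, hψ, h1, h2, h3⟩ ⟨χ, hχ, k1, k2, k3⟩
    refine ⟨_, hψ.add hχ, ?_, ?_, ?_⟩
    · rw [map_add]
      filter_upwards [Lp.coeFn_add (val w) (val z), h1, k1] with x a b c
      rw [a, Pi.add_apply, b, c]
    · rw [map_add]
      filter_upwards [Lp.coeFn_add (gradient w) (gradient z), h2, k2] with x a b c
      rw [a, Pi.add_apply, b, c, grad_add (hψ.differentiableAt x) (hχ.differentiableAt x)]
    · rw [map_add]
      filter_upwards [Lp.coeFn_add (radial w) (radial z), h3, k3] with x a b c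
      rw [a, Pi.add_apply, b, c, euler_add (hψ.differentiableAt x) (hχ.differentiableAt x)]
  zero_mem' := by
    refine ⟨_, IsTest.zero, ?_, ?_, ?_⟩
    · rw [map_zero]; exact Lp.coeFn_zero _ _ _
    · rw [map_zero, grad_zero']; exact Lp.coeFn_zero _ _ _
    · rw [map_zero]
      filter_upwards [Lp.coeFn_zero ℝ 2 (volume : Measure E3)] with x hx
      rw [hx]; simp [euler]
  smul_mem' := by
    rintro c w ⟨ψ, hψ, h1, h2, h3⟩
    refine ⟨_, hψ.const_mul c, ?_, ?_, ?_⟩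
    · rw [map_smul]
      filter_upwards [Lp.coeFn_smul c (val w), h1] with x a b
      rw [a, Pi.smul_apply, b, smul_eq_mul]
    · rw [map_smul]
      filter_upwards [Lp.coeFn_smul c (gradient w), h2] with x a b
      rw [a, Pi.smul_apply, b, grad_const_smul c ψ x (hψ.differentiableAt x)]
    · rw [map_smul]
      filter_upwards [Lp.coeFn_smul c (radial w), h3] with x a b
      rw [a, Pi.smul_apply, b, smul_eq_mul, euler_const_mul c ψ x (hψ.differentiableAt x)]

/-- The energy space: the closure of the jets of test functions. -/
def energySpace : Submodule ℝ Jet := testJets.topologicalClosure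

theorem testJets_le : testJets ≤ energySpace := testJets.le_topologicalClosure

/-- Closed properties pass from test functions to the energy space. -/
theorem energySpace_induction {p : Jet → Prop} (hp : IsClosed {w | p w})
    (h : ∀ ψ w, IsTest ψ → IsJet w ψ → p w) : ∀ w ∈ energySpace, p w := by
  have : closure (testJets : Set Jet) ⊆ {w | p w} :=
    closure_minimal (fun w ⟨ψ, h1, h2⟩ => h ψ w h1 h2) hp
  exact fun w hw => this hw

theorem IsJet.generator {w : Jet} {ψ : E3 → ℝ} (h : IsJet w ψ) :
    Jet.generator w =ᵐ[volume] fun x => euler ψ x + 3 / 2 * ψ x := by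
  rw [generator_apply]
  filter_upwards [Lp.coeFn_add (radial w) ((3 / 2 : ℝ) • val w), Lp.coeFn_smul (3 / 2 : ℝ) (val w), h.1, h.2.2]
    with x a b c d
  rw [a, Pi.add_apply, b, Pi.smul_apply, c, d, smul_eq_mul]

theorem _root_.HypWave.inner_eq_integral {f g : L2 ℝ} {φ ψ : E3 → ℝ} (hf : f =ᵐ[volume] φ) (hg : g =ᵐ[volume] ψ) :
    inner ℝ f g = ∫ x, φ x * ψ x := by
  rw [L2.inner_def]
  refine integral_congr_ae ?_
  filter_upwards [hf, hg] with x a b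
  rw [a, b]; simp [mul_comm]

theorem _root_.HypWave.norm_sq_eq_integral {F : Type*} [NormedAddCommGroup F] [InnerProductSpace ℝ F]
    {f : L2 F} {φ : E3 → F} (hf : f =ᵐ[volume] φ) : ‖f‖ ^ 2 = ∫ x, ‖φ x‖ ^ 2 := by
  rw [← real_inner_self_eq_norm_sq, L2.inner_def]
  refine integral_congr_ae ?_
  filter_upwards [hf] with x a
  rw [a, real_inner_self_eq_norm_sq]

/-- Antisymmetry of `x · ∇ + 3/2` on test functions, extended by continuity to the closure. -/
theorem inner_val_radial {w : Jet} (hw : w ∈ energySpace) :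
    inner ℝ (val w) (radial w) = -(3 / 2) * ‖val w‖ ^ 2 := by
  refine energySpace_induction (p := fun w => inner ℝ (val w) (radial w) = -(3 / 2) * ‖val w‖ ^ 2)
    ?_ (fun ψ w hψ h => ?_) w hw
  · exact isClosed_eq (val.continuous.inner radial.continuous)
      (continuous_const.mul (val.continuous.norm.pow 2))
  · rw [inner_eq_integral h.1 h.2.2, norm_sq_eq_integral h.1, integral_mul_euler_self hψ]
    simp

/-- By `inner_val_radial` the left side is `‖radial w‖² - 9/4 ‖val w‖²`, while the radial and cross
terms of the form give `‖radial w‖² - 3/2 ‖val w‖²`; the other terms are nonnegative. This lets the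
energy bound the boundary terms. -/
theorem norm_generator_sq_le {m : BoundedContinuousFunction E3 ℝ} (hm : ∀ x, 0 ≤ m x) {w : Jet}
    (hw : w ∈ energySpace) : ‖generator w‖ ^ 2 ≤ form m w w := by
  have h1 := inner_val_radial hw
  have h2 : 0 ≤ inner ℝ (mulL2 m (val w)) (val w) := by
    rw [inner_mulL2]
    exact integral_nonneg fun x => by
      have := mul_nonneg (hm x) (mul_self_nonneg (val w x))
      simpa [mul_assoc] using this
  have c := real_inner_comm (val w) (radial w)
  have g : ‖generator w‖ ^ 2 = ‖radial w‖ ^ 2 + 3 * inner ℝ (radial w) (val w) + 9 / 4 * ‖val w‖ ^ 2 := by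
    rw [generator_apply, norm_add_sq_real, inner_smul_right, norm_smul, mul_pow,
      Real.norm_of_nonneg (by norm_num : (0 : ℝ) ≤ 3 / 2)]
    ring
  have g1 := real_inner_self_eq_norm_sq (gradient w)
  have g2 := real_inner_self_eq_norm_sq (radial w)
  rw [form_apply]
  linarith [sq_nonneg ‖gradient w‖, sq_nonneg ‖val w‖]

/-- Positivity of the commutator of the Dirichlet form with dilations. -/
theorem commutator_nonneg {V : E3 → ℝ} {m : BoundedContinuousFunction E3 ℝ} (hV : ContDiff ℝ ∞ V)
    (hm : ∀ x, m x = centrifugal x + V x) (hVe : ∀ x, euler V x ≤ 0) {w : Jet} (hw : w ∈ energySpace) :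
    0 ≤ ‖gradient w‖ ^ 2 + inner ℝ (mulL2 m (val w)) (generator w) := by
  refine energySpace_induction (p := fun w => 0 ≤ ‖gradient w‖ ^ 2 + inner ℝ (mulL2 m (val w)) (generator w))
    ?_ (fun ψ w hψ h => ?_) w hw
  · exact isClosed_le continuous_const ((gradient.continuous.norm.pow 2).add
      (((mulL2 m).continuous.comp val.continuous).inner generator.continuous))
  · have e : inner ℝ (mulL2 m (val w)) (generator w)
        = ∫ x, (centrifugal x + V x) * ψ x * (euler ψ x + 3 / 2 * ψ x) := by
      rw [inner_mulL2]
      refine integral_congr_ae ?_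
      filter_upwards [h.1, h.generator] with x a b
      rw [a, b, hm]
    have hcV : ContDiff ℝ ∞ (fun x => centrifugal x + V x) := contDiff_centrifugal.add hV
    have ee : ∀ x, euler (fun x => centrifugal x + V x) x = euler centrifugal x + euler V x := fun x =>
      euler_add (contDiff_centrifugal.differentiable (by simp) x) (hV.differentiable (by simp) x)
    have is : ∀ {q : E3 → ℝ}, ContDiff ℝ ∞ q → Integrable (fun x => euler q x * ψ x ^ 2) := fun hq => by
      have hme : ContDiff ℝ ∞ (euler _) := (IsTest.contDiff_fderiv hq).clm_apply contDiff_id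
      simpa only [sq] using ((hψ.mul hψ).mul_left hme).integrable
    have hle : (∫ x, euler (fun x => centrifugal x + V x) x * ψ x ^ 2) ≤ ∫ x, euler centrifugal x * ψ x ^ 2 :=
      integral_mono (is hcV) (is contDiff_centrifugal) fun x => by
        have := mul_nonneg (sub_nonneg.2 (hVe x)) (sq_nonneg (ψ x))
        simp only [ee]
        nlinarith
    -- The commutator is now `∫ ‖∇ψ‖² - ½ ∫ (x · ∇(centrifugal + V)) ψ²`. The contribution of `V`
    -- has the right sign, and the Hardy inequality covers the other.
    rw [e, integral_mul_euler hcV hψ, norm_sq_eq_integral h.2.1]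
    linarith [hardy_centrifugal hψ]

end Jet

/-! ### Dilation quotients on the energy space and the Morawetz inequality. -/

/-- Closed properties pass from test functions to `L²`. -/
theorem L2_induction {p : L2 ℝ → Prop} (hp : IsClosed {y | p y})
    (h : ∀ (χ : E3 → ℝ) (y : L2 ℝ), IsTest χ → y =ᵐ[volume] χ → p y) (y : L2 ℝ) : p y := by
  have hd := Lp.dense_hasCompactSupport_contDiff (E := E3) (F := ℝ) (μ := volume) (p := 2) (by simp)
  have : closure {f : L2 ℝ | ∃ g : E3 → ℝ, f =ᵐ[volume] g ∧ HasCompactSupport g ∧ ContDiff ℝ ∞ g} ⊆ {y | p y} :=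
    closure_minimal (fun y ⟨χ, h1, h2, h3⟩ => h χ y ⟨h3, h2⟩ h1) hp
  exact this (hd y)

/-- The uniform bound is required only on the subspace `S`, which suffices because the approximation
errors lie in `S`. For dilation quotients such a bound holds on the energy space but not on all
jets. -/
theorem tendsto_zero_of_mem_closure {α E F : Type*} [NormedAddCommGroup E] [NormedSpace ℝ E]
    [NormedAddCommGroup F] [NormedSpace ℝ F] {l : Filter α} {T : α → E →L[ℝ] F} {S : Submodule ℝ E}
    {D : Set E} {C : ℝ} (hDS : D ⊆ S) (hT : ∀ᶠ a in l, ∀ x ∈ S, ‖T a x‖ ≤ C * ‖x‖)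
    (hD : ∀ z ∈ D, Tendsto (fun a => T a z) l (𝓝 0)) {x : E} (hx : x ∈ S) (hxD : x ∈ closure D) :
    Tendsto (fun a => T a x) l (𝓝 0) := by
  rw [Metric.tendsto_nhds]
  intro ε hε
  obtain ⟨z, hz, hxz⟩ := Metric.mem_closure_iff.1 hxD (ε / (2 * (|C| + 1))) (by positivity)
  filter_upwards [hT, (Metric.tendsto_nhds.1 (hD z hz)) (ε / 2) (by positivity)] with a h1 h2
  rw [dist_zero_right] at h2 ⊢
  rw [dist_eq_norm, lt_div_iff₀ (by positivity)] at hxz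
  have h3 := h1 _ (S.sub_mem hx (hDS hz))
  have h4 : C * ‖x - z‖ ≤ (|C| + 1) * ‖x - z‖ :=
    mul_le_mul_of_nonneg_right (by linarith [le_abs_self C]) (norm_nonneg _)
  have h5 : ‖T a x‖ ≤ ‖T a (x - z)‖ + ‖T a z‖ := by
    simpa using norm_add_le (T a x - T a z) (T a z)
  linarith

namespace Jet

/-- Dilations act on jets. -/
def jetDilation (s : ℝ) : Jet →L[ℝ] Jet :=
  (dilation ℝ s).prodMap ((Real.exp s • dilation E3 s).prodMap (dilation ℝ s))

theorem val_jetDilation (s : ℝ) (w : Jet) : val (jetDilation s w) = dilation ℝ s (val w) := rfl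

theorem gradient_jetDilation (s : ℝ) (w : Jet) :
    gradient (jetDilation s w) = Real.exp s • dilation E3 s (gradient w) := rfl

theorem radial_jetDilation (s : ℝ) (w : Jet) : radial (jetDilation s w) = dilation ℝ s (radial w) := rfl

theorem IsJet.dilation {w : Jet} {ψ : E3 → ℝ} (h : IsJet w ψ) (hψ : IsTest ψ) (s : ℝ) :
    IsJet (jetDilation s w) (dilate s ψ) := by
  refine ⟨?_, ?_, ?_⟩
  · rw [val_jetDilation]
    exact (coeFn_dilation s _).trans (dilate_congr_ae h.1 s)
  · rw [gradient_jetDilation, grad_dilate hψ]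
    filter_upwards [Lp.coeFn_smul (Real.exp s) (HypWave.dilation E3 s (gradient w)),
      (coeFn_dilation s (gradient w)).trans (dilate_congr_ae h.2.1 s)] with x a b
    rw [a, Pi.smul_apply, b]
  · rw [radial_jetDilation, euler_dilate hψ]
    exact (coeFn_dilation s _).trans (dilate_congr_ae h.2.2 s)

theorem jetDilation_mem (s : ℝ) {w : Jet} (hw : w ∈ energySpace) : jetDilation s w ∈ energySpace := by
  have : Set.MapsTo (jetDilation s) (testJets : Set Jet) (testJets : Set Jet) :=
    fun w ⟨ψ, h1, h2⟩ => ⟨_, h1.dilate s, h2.dilation h1 s⟩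
  exact this.closure (jetDilation s).continuous hw

/-- Symmetric difference quotients of dilations on jets. -/
def jetQuotient (s : ℝ) : Jet →L[ℝ] Jet := (2 * s)⁻¹ • (jetDilation s - jetDilation (-s))

theorem jetQuotient_mem (s : ℝ) {w : Jet} (hw : w ∈ energySpace) : jetQuotient s w ∈ energySpace :=
  energySpace.smul_mem _ (energySpace.sub_mem (jetDilation_mem s hw) (jetDilation_mem (-s) hw))

theorem val_jetQuotient (s : ℝ) (w : Jet) : val (jetQuotient s w) = dilationQuotient ℝ s (val w) := rfl

theorem radial_jetQuotient (s : ℝ) (w : Jet) : radial (jetQuotient s w) = dilationQuotient ℝ s (radial w) := rfl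

theorem gradient_jetQuotient (s : ℝ) (w : Jet) : gradient (jetQuotient s w)
    = (2 * s)⁻¹ • (Real.exp s • dilation E3 s (gradient w) - Real.exp (-s) • dilation E3 (-s) (gradient w)) := rfl

attribute [local irreducible] val gradient radial generator dilation dilationQuotient mulL2 jetDilation
  jetQuotient

theorem inner_dilation_eq_integral {w : Jet} {ψ χ : E3 → ℝ} {y : L2 ℝ} (h : IsJet w ψ) (hy : y =ᵐ[volume] χ)
    (s : ℝ) : inner ℝ (dilation ℝ s (val w)) y = ∫ x, dilate s ψ x * χ x :=
  inner_eq_integral ((coeFn_dilation s _).trans (dilate_congr_ae h.1 s)) hy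

theorem hasDerivAt_inner_dilation {w : Jet} {ψ χ : E3 → ℝ} {y : L2 ℝ} (hψ : IsTest ψ) (h : IsJet w ψ)
    (hχ : IsTest χ) (hy : y =ᵐ[volume] χ) (s : ℝ) :
    HasDerivAt (fun s => inner ℝ (dilation ℝ s (val w)) y) (inner ℝ (dilation ℝ s (generator w)) y) s := by
  have e : inner ℝ (dilation ℝ s (generator w)) y = ∫ x, dilate s (fun x => euler ψ x + 3 / 2 * ψ x) x * χ x :=
    inner_eq_integral ((coeFn_dilation s _).trans (dilate_congr_ae h.generator s)) hy
  rw [e]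
  simp only [inner_dilation_eq_integral h hy]
  exact hasDerivAt_integral_dilate_mul hψ hχ s

theorem dilation_zero_apply {F : Type*} [NormedAddCommGroup F] [InnerProductSpace ℝ F] (f : L2 F) :
    dilation F 0 f = f := by
  refine Lp.ext ?_
  have := coeFn_dilation 0 f
  rwa [dilate_zero] at this

/-- Against a fixed test function `y`, the pairing with the dilated `val w` has derivative at most
`‖generator w‖ ‖y‖`, since dilations are isometric. The mean value inequality extends by density to
all `y`, in particular to the difference itself, and then to the closure of the test jets. -/
theorem norm_dilation_sub_le {w : Jet} (hw : w ∈ energySpace) (s : ℝ) :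
    ‖dilation ℝ s (val w) - val w‖ ≤ |s| * ‖generator w‖ := by
  refine energySpace_induction (p := fun w => ‖dilation ℝ s (val w) - val w‖ ≤ |s| * ‖generator w‖)
    ?_ (fun ψ w hψ h => ?_) w hw
  · exact isClosed_le (((dilation ℝ s).continuous.comp val.continuous).sub val.continuous).norm
      (continuous_const.mul generator.continuous.norm)
  have key : ∀ y : L2 ℝ, inner ℝ (dilation ℝ s (val w) - val w) y ≤ |s| * ‖generator w‖ * ‖y‖ := by
    refine L2_induction (isClosed_le (continuous_const.inner continuous_id)
      (continuous_const.mul continuous_norm)) fun χ y hχ hy => ?_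
    have := Convex.norm_image_sub_le_of_norm_hasDerivWithin_le (s := Set.univ) (x := 0) (y := s)
      (C := ‖generator w‖ * ‖y‖) (fun t _ => (hasDerivAt_inner_dilation hψ h hχ hy t).hasDerivWithinAt)
      (fun t _ => (norm_inner_le_norm _ _).trans (by rw [norm_dilation])) convex_univ trivial trivial
    rw [dilation_zero_apply, ← inner_sub_left, sub_zero, Real.norm_eq_abs, Real.norm_eq_abs] at this
    linarith [le_abs_self (inner ℝ (dilation ℝ s (val w) - val w) y)]
  have h1 := key (dilation ℝ s (val w) - val w)
  rw [real_inner_self_eq_norm_mul_norm] at h1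
  rcases (norm_nonneg (dilation ℝ s (val w) - val w)).eq_or_lt with h0 | h0
  · rw [← h0]; positivity
  · exact le_of_mul_le_mul_right h1 h0

theorem norm_dilationQuotient_le {w : Jet} (hw : w ∈ energySpace) {s : ℝ} (hs : s ≠ 0) :
    ‖dilationQuotient ℝ s (val w)‖ ≤ ‖generator w‖ := by
  have h1 := norm_dilation_sub_le hw s
  have h2 := norm_dilation_sub_le hw (-s)
  rw [abs_neg] at h2
  have e : dilationQuotient ℝ s (val w)
      = (2 * s)⁻¹ • ((dilation ℝ s (val w) - val w) - (dilation ℝ (-s) (val w) - val w)) := by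
    rw [sub_sub_sub_cancel_right, dilationQuotient_apply]
  have hs' : 0 < |s| := abs_pos.2 hs
  rw [e, norm_smul, norm_inv, norm_mul, Real.norm_eq_abs s, Real.norm_of_nonneg (by norm_num : (0 : ℝ) ≤ 2),
    inv_mul_le_iff₀ (by positivity)]
  exact (norm_sub_le _ _).trans (by linarith)

theorem norm_defect_le {w : Jet} (hw : w ∈ energySpace) {s : ℝ} (hs : s ≠ 0) :
    ‖dilationQuotient ℝ s (val w) - generator w‖ ≤ 5 * ‖w‖ := by
  have h1 := norm_dilationQuotient_le hw hs
  have h2 := norm_generator_le w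
  have h3 : ‖dilationQuotient ℝ s (val w) - generator w‖
      ≤ ‖dilationQuotient ℝ s (val w)‖ + ‖generator w‖ := norm_sub_le _ _
  linarith

/-- For a test function `y` this is the derivative at `0` of the pairing, the symmetric quotient
being the mean of a forward and a backward one. Boundedness of the quotients extends it to all `y`.
-/
theorem tendsto_inner_defect {z : Jet} (hz : z ∈ testJets) (y : L2 ℝ) :
    Tendsto (fun s => innerSL ℝ (dilationQuotient ℝ s (val z) - generator z) y) (𝓝[≠] 0) (𝓝 (0 : ℝ)) := by
  obtain ⟨ψ, hψ, hz⟩ := hz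
  have hzE : z ∈ energySpace := testJets_le ⟨ψ, hψ, hz⟩
  refine tendsto_zero_of_mem_closure (S := ⊤) (C := 2 * ‖generator z‖)
    (D := {f : L2 ℝ | ∃ g : E3 → ℝ, f =ᵐ[volume] g ∧ HasCompactSupport g ∧ ContDiff ℝ ∞ g})
    (fun _ _ => trivial) ?_ ?_ trivial (Lp.dense_hasCompactSupport_contDiff (by simp) y)
  · filter_upwards [self_mem_nhdsWithin] with s hs a _
    refine (norm_inner_le_norm (dilationQuotient ℝ s (val z) - generator z) a).trans
      (mul_le_mul_of_nonneg_right ?_ (norm_nonneg a))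
    exact (norm_sub_le _ _).trans (by linarith [norm_dilationQuotient_le hzE hs])
  · rintro y ⟨χ, hy, h1, h2⟩
    have hd := hasDerivAt_inner_dilation hψ hz ⟨h2, h1⟩ hy 0
    rw [dilation_zero_apply] at hd
    have hd' : HasDerivAt (fun s => inner ℝ (dilation ℝ (-s) (val z)) y) (-inner ℝ (generator z) y) 0 := by
      have : HasDerivAt (fun s => inner ℝ (dilation ℝ s (val z)) y) (inner ℝ (generator z) y) (0 - 0) := by
        rwa [sub_zero]
      simpa using this.comp_const_sub 0 0
    have ht := (hd.sub hd').tendsto_slope_zero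
    simp only [Pi.sub_apply, zero_add, neg_zero, sub_self, sub_zero, sub_neg_eq_add] at ht
    have ht2 := (ht.const_mul (1 / 2)).sub_const (inner ℝ (generator z) y)
    have e0 : 1 / 2 * (inner ℝ (generator z) y + inner ℝ (generator z) y) - inner ℝ (generator z) y = 0 := by ring
    rw [e0] at ht2
    refine ht2.congr fun s => ?_
    have e1 := dilationQuotient_apply s (val z)
    rw [innerSL_apply_apply, inner_sub_left, e1, inner_smul_left, inner_sub_left, conj_trivial, smul_eq_mul, mul_inv]
    ring

/-- Weak convergence to the generator, from test jets by the uniform bound `norm_defect_le`. Nothing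
stronger is needed in the virial identity. -/
theorem tendsto_inner_dilationQuotient {w : Jet} (hw : w ∈ energySpace) (y : L2 ℝ) :
    Tendsto (fun s => inner ℝ y (dilationQuotient ℝ s (val w))) (𝓝[≠] 0) (𝓝 (inner ℝ y (generator w))) := by
  have hne : ∀ᶠ s : ℝ in 𝓝[≠] 0, s ≠ 0 := self_mem_nhdsWithin
  have main := tendsto_zero_of_mem_closure (l := 𝓝[≠] (0 : ℝ)) (S := energySpace) (D := (testJets : Set Jet))
    (C := ‖y‖ * 5) (T := fun s => (innerSL ℝ y).comp ((dilationQuotient ℝ s).comp val - generator))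
    testJets_le ?_ (fun z hz => (tendsto_inner_defect hz y).congr fun s =>
      real_inner_comm y (dilationQuotient ℝ s (val z) - generator z)) hw hw
  · have := main.add_const (inner ℝ y (generator w))
    rw [zero_add] at this
    refine this.congr fun s => ?_
    change inner ℝ y (dilationQuotient ℝ s (val w) - generator w) + _ = _
    rw [inner_sub_right]; ring
  · filter_upwards [hne] with s hs w hw
    have h := norm_defect_le hw hs
    calc _ ≤ ‖y‖ * ‖dilationQuotient ℝ s (val w) - generator w‖ :=
          norm_inner_le_norm y (dilationQuotient ℝ s (val w) - generator w)
      _ ≤ ‖y‖ * (5 * ‖w‖) := mul_le_mul_of_nonneg_left h (norm_nonneg y)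
      _ = ‖y‖ * 5 * ‖w‖ := by ring

/-- For isometries `‖D g - g‖² = 2 ‖g‖² - 2 ⟪D g, g⟫`, so weak continuity at test functions is
already strong; the bound `2` passes it to the closure. -/
theorem tendsto_dilation_gradient {w : Jet} (hw : w ∈ energySpace) :
    Tendsto (fun s => dilation E3 s (gradient w)) (𝓝 0) (𝓝 (gradient w)) := by
  have main := tendsto_zero_of_mem_closure (l := 𝓝 (0 : ℝ)) (S := energySpace) (D := (testJets : Set Jet))
    (C := 2) (T := fun s => (dilation E3 s).comp gradient - gradient) testJets_le ?_ ?_ hw hw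
  · have := main.add_const (gradient w)
    rw [zero_add] at this
    exact this.congr fun s => sub_add_cancel _ _
  · refine Eventually.of_forall fun s w _ => ?_
    refine (norm_sub_le (dilation E3 s (gradient w)) (gradient w)).trans ?_
    rw [norm_dilation]
    linarith [norm_gradient_le w]
  · rintro z ⟨ψ, hψ, hz⟩
    have ht := tendsto_integral_inner_dilate hψ.continuous_grad hψ.hasCompactSupport_grad
      hψ.continuous_grad hψ.hasCompactSupport_grad
    have e1 : ∀ s, inner ℝ (dilation E3 s (gradient z)) (gradient z)
        = ∫ x, inner ℝ (dilate s (grad ψ) x) (grad ψ x) := by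
      intro s
      rw [L2.inner_def]
      refine integral_congr_ae ?_
      filter_upwards [(coeFn_dilation s _).trans (dilate_congr_ae hz.2.1 s), hz.2.1] with x a b
      rw [a, b]
    have e2 : (∫ x, inner ℝ (grad ψ x) (grad ψ x)) = ‖gradient z‖ ^ 2 := by
      rw [norm_sq_eq_integral hz.2.1]
      simp only [real_inner_self_eq_norm_sq]
    simp only [← e1, e2] at ht
    have hsq : Tendsto (fun s => ‖dilation E3 s (gradient z) - gradient z‖ ^ 2) (𝓝 0) (𝓝 0) := by
      have h2 := (tendsto_const_nhds (x := 2 * ‖gradient z‖ ^ 2)).sub (ht.const_mul 2)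
      rw [sub_self] at h2
      refine h2.congr fun s => ?_
      rw [norm_sub_sq_real, norm_dilation]; ring
    rw [tendsto_zero_iff_norm_tendsto_zero]
    have := hsq.sqrt
    simpa [Real.sqrt_sq (norm_nonneg _)] using this

/-- Dilations commute with `x · ∇`, so antisymmetry removes the square of the radial part and makes
the two cross terms cancel. The gradient scales by `e^s`, and the factors `e^(±s)` combine to `sinh
s`. -/
theorem form_jetQuotient (m : BoundedContinuousFunction E3 ℝ) (s : ℝ) (w : Jet) :
    form m w (jetQuotient s w)
      = (Real.sinh s / s) * inner ℝ (gradient w) (dilation E3 s (gradient w))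
        + inner ℝ (mulL2 m (val w)) (dilationQuotient ℝ s (val w)) := by
  have h1 := inner_dilation s (gradient w) (gradient w)
  have h2 := real_inner_comm (dilation E3 s (gradient w)) (gradient w)
  have h3 := inner_dilationQuotient_self s (radial w)
  have h4 := inner_dilationQuotient s (radial w) (val w)
  have h5 := real_inner_comm (dilationQuotient ℝ s (radial w)) (val w)
  have h6 : inner ℝ (gradient w) (gradient (jetQuotient s w))
      = (Real.sinh s / s) * inner ℝ (gradient w) (dilation E3 s (gradient w)) := by
    rw [gradient_jetQuotient, inner_smul_right, inner_sub_right, inner_smul_right, inner_smul_right,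
      ← h1, h2, Real.sinh_eq]
    ring
  have h7 : inner ℝ (radial w) (radial (jetQuotient s w)) = inner ℝ (radial w) (dilationQuotient ℝ s (radial w)) :=
    congrArg (fun z => inner ℝ (radial w) z) (radial_jetQuotient s w)
  have h8 : inner ℝ (radial w) (val (jetQuotient s w)) = inner ℝ (radial w) (dilationQuotient ℝ s (val w)) :=
    congrArg (fun z => inner ℝ (radial w) z) (val_jetQuotient s w)
  have h9 : inner ℝ (val w) (radial (jetQuotient s w)) = inner ℝ (val w) (dilationQuotient ℝ s (radial w)) :=
    congrArg (fun z => inner ℝ (val w) z) (radial_jetQuotient s w)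
  have h10 : inner ℝ (mulL2 m (val w)) (val (jetQuotient s w))
      = inner ℝ (mulL2 m (val w)) (dilationQuotient ℝ s (val w)) :=
    congrArg (fun z => inner ℝ (mulL2 m (val w)) z) (val_jetQuotient s w)
  have h11 := form_apply m w (jetQuotient s w)
  linarith

theorem tendsto_sinh_div : Tendsto (fun s : ℝ => Real.sinh s / s) (𝓝[≠] 0) (𝓝 1) := by
  have := (Real.hasDerivAt_sinh 0).tendsto_slope_zero
  simp only [zero_add, Real.sinh_zero, sub_zero, Real.cosh_zero, smul_eq_mul] at this
  exact this.congr fun s => by rw [div_eq_inv_mul]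

theorem tendsto_form_jetQuotient (m : BoundedContinuousFunction E3 ℝ) {w : Jet} (hw : w ∈ energySpace) :
    Tendsto (fun s => form m w (jetQuotient s w)) (𝓝[≠] 0)
      (𝓝 (‖gradient w‖ ^ 2 + inner ℝ (mulL2 m (val w)) (generator w))) := by
  simp only [form_jetQuotient]
  refine Tendsto.add ?_ (tendsto_inner_dilationQuotient hw _)
  have h1 : Tendsto (fun s => (inner ℝ (gradient w) (dilation E3 s (gradient w)) : ℝ)) (𝓝[≠] 0)
      (𝓝 (inner ℝ (gradient w) (gradient w))) :=
    (tendsto_const_nhds (x := gradient w)).inner (𝕜 := ℝ)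
      ((tendsto_dilation_gradient hw).mono_left nhdsWithin_le_nhds)
  have := tendsto_sinh_div.mul h1
  rwa [one_mul, real_inner_self_eq_norm_sq] at this

/-- The Morawetz inequality for abstract forces. -/
theorem morawetz {V : E3 → ℝ} {m : BoundedContinuousFunction E3 ℝ} (hV : ContDiff ℝ ∞ V)
    (hm : ∀ x, m x = centrifugal x + V x) (hV0 : ∀ x, 0 ≤ V x) (hVe : ∀ x, euler V x ≤ 0)
    {J : Set ℝ} {U : ℝ → Jet} {v N : ℝ → L2 ℝ}
    (h : WeakEvolution val (form m) (energySpace : Set Jet) J U v N)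
    {a b : ℝ} (ha : a ∈ J) (hb : b ∈ J) (hab : a ≤ b) :
    ∫ τ in a..b, inner ℝ (N τ) (generator (U τ))
      ≤ 1 / 2 * (‖v a‖ ^ 2 + form m (U a) (U a)) + 1 / 2 * (‖v b‖ ^ 2 + form m (U b) (U b)) := by
  have hJ := h.Icc_subset ha hb
  set s : ℕ → ℝ := fun n => 1 / ((n : ℝ) + 1) with hs
  have hsl : Tendsto s atTop (𝓝[≠] 0) :=
    tendsto_nhdsWithin_iff.2 ⟨tendsto_one_div_add_atTop_nhds_zero_nat,
      Eventually.of_forall fun n => (by positivity : (0 : ℝ) < s n).ne'⟩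
  have hs0 : ∀ n, s n ≠ 0 := fun n => (by positivity : (0 : ℝ) < s n).ne'
  obtain ⟨R, hR⟩ := (tendsto_sinh_div.comp hsl).norm.bddAbove_range
  have hR' : ∀ n, |Real.sinh (s n) / s n| ≤ R := fun n => hR ⟨n, rfl⟩
  have hR0 : 0 ≤ R := (abs_nonneg _).trans (hR' 0)
  have vir := h.virial (B := fun n => jetQuotient (s n)) (B' := fun n => dilationQuotient ℝ (s n))
    (A := generator) (P := fun w => ‖gradient w‖ ^ 2 + inner ℝ (mulL2 m (val w)) (generator w))
    -- The first entry bounds the quotients of `val` through the generator, the second bounds the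
    -- form; `R` bounds `sinh s / s` along the sequence.
    (C := max (5 / 2) (R + ‖mulL2 m‖ * (5 / 2)))
    (fun n x hx => jetQuotient_mem _ hx) (fun n x => val_jetQuotient _ _)
    (fun n x => inner_dilationQuotient_self _ _) ?_
    (fun x hx y => (tendsto_inner_dilationQuotient hx y).comp hsl) ?_
    (fun x hx => (tendsto_form_jetQuotient m hx).comp hsl) ha hb hab
  · have cU := h.continuous_state.mono hJ
    have i1 : IntervalIntegrable (fun τ => ‖gradient (U τ)‖ ^ 2
        + inner ℝ (mulL2 m (val (U τ))) (generator (U τ))) volume a b := by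
      apply ContinuousOn.intervalIntegrable
      rw [Set.uIcc_of_le hab]
      have : Continuous (fun w : Jet => ‖gradient w‖ ^ 2 + (inner ℝ (mulL2 m (val w)) (generator w) : ℝ)) :=
        (gradient.continuous.norm.pow 2).add
          (((mulL2 m).continuous.comp val.continuous).inner generator.continuous)
      exact this.comp_continuousOn cU
    have i2 : IntervalIntegrable (fun τ => inner ℝ (N τ) (generator (U τ))) volume a b :=
      (h.integrable_force a ha b hb).inner_continuousOn hab (generator.continuous.comp_continuousOn cU)
    rw [intervalIntegral.integral_add i1 i2] at vir
    have p1 : 0 ≤ ∫ τ in a..b, (‖gradient (U τ)‖ ^ 2 + inner ℝ (mulL2 m (val (U τ))) (generator (U τ))) :=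
      intervalIntegral.integral_nonneg hab fun τ hτ => commutator_nonneg hV hm hVe (h.mem τ (hJ hτ))
    -- Boundary terms: `|⟪v, A U⟫| ≤ ½ (‖v‖² + ‖A U‖²)`, and the form dominates `‖A U‖²`.
    have bd : ∀ t ∈ J, |inner ℝ (v t) (generator (U t))| ≤ 1 / 2 * (‖v t‖ ^ 2 + form m (U t) (U t)) := by
      intro t ht
      have b1 := abs_real_inner_le_norm (v t) (generator (U t))
      have b2 := norm_generator_sq_le (m := m)
        (fun x => by rw [hm]; exact add_nonneg (centrifugal_nonneg x) (hV0 x)) (h.mem t ht)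
      nlinarith [sq_nonneg (‖v t‖ - ‖generator (U t)‖)]
    have b1 := (abs_le.1 (bd a ha)).2
    have b2 := (abs_le.1 (bd b hb)).1
    linarith
  · intro n x hx
    refine (norm_dilationQuotient_le hx (hs0 n)).trans ((norm_generator_le x).trans ?_)
    exact mul_le_mul_of_nonneg_right (le_max_left _ _) (norm_nonneg _)
  · intro n x hx
    have q1 : |inner ℝ (gradient x) (dilation E3 (s n) (gradient x))| ≤ ‖x‖ * ‖x‖ :=
      (abs_real_inner_le_norm _ _).trans (by
        rw [norm_dilation]
        exact mul_le_mul (norm_gradient_le x) (norm_gradient_le x) (norm_nonneg _) (norm_nonneg _))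
    have q2 : |inner ℝ (mulL2 m (val x)) (dilationQuotient ℝ (s n) (val x))|
        ≤ (‖mulL2 m‖ * ‖x‖) * (5 / 2 * ‖x‖) :=
      (abs_real_inner_le_norm _ _).trans (mul_le_mul ((mulL2 m).le_opNorm_of_le (norm_val_le x))
        ((norm_dilationQuotient_le hx (hs0 n)).trans (norm_generator_le x)) (norm_nonneg _) (by positivity))
    rw [form_jetQuotient]
    refine (abs_add_le _ _).trans ?_
    rw [abs_mul]
    have q3 := mul_le_mul (hR' n) q1 (abs_nonneg _) hR0
    have q4 : (R + ‖mulL2 m‖ * (5 / 2)) * ‖x‖ ^ 2 ≤ max (5 / 2) (R + ‖mulL2 m‖ * (5 / 2)) * ‖x‖ ^ 2 :=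
      mul_le_mul_of_nonneg_right (le_max_right _ _) (sq_nonneg _)
    nlinarith

end Jet

/-! ### Truncation of the quintic power and its convex primitive. -/

section Truncation

/-- Truncation of a real number to `[-k, k]`. -/
def trunc (k z : ℝ) : ℝ := max (-k) (min z k)

/-- The truncated quintic nonlinearity. -/
def truncPow (k z : ℝ) : ℝ := trunc k z ^ 5

/-- The primitive of `truncPow`. -/
def truncPrim (k z : ℝ) : ℝ := trunc k z ^ 6 / 6 + trunc k z ^ 5 * (z - trunc k z)

variable {k : ℝ}

theorem continuous_trunc (k : ℝ) : Continuous (trunc k) := by unfold trunc; fun_prop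

theorem continuous_truncPow (k : ℝ) : Continuous (truncPow k) := (continuous_trunc k).pow 5

theorem continuous_truncPrim (k : ℝ) : Continuous (truncPrim k) := by
  have := continuous_trunc k
  unfold truncPrim
  fun_prop

theorem trunc_eq_self {z : ℝ} (h : |z| ≤ k) : trunc k z = z := by
  rw [abs_le] at h
  rw [trunc, min_eq_left h.2, max_eq_right h.1]

theorem abs_trunc_le (hk : 0 ≤ k) (z : ℝ) : |trunc k z| ≤ k := by
  rw [abs_le, trunc]
  exact ⟨le_max_left _ _, max_le (by linarith) (min_le_right _ _)⟩

theorem trunc_cases (hk : 0 ≤ k) (z : ℝ) :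
    trunc k z = z ∨ (trunc k z = k ∧ k ≤ z) ∨ (trunc k z = -k ∧ z ≤ -k) := by
  rcases le_total z k with h | h
  · rcases le_total (-k) z with h' | h'
    · left; rw [trunc, min_eq_left h, max_eq_right h']
    · right; right; exact ⟨by rw [trunc, min_eq_left h, max_eq_left h'], h'⟩
  · right; left; exact ⟨by rw [trunc, min_eq_right h, max_eq_right (by linarith)], h⟩

theorem abs_trunc_le_abs (hk : 0 ≤ k) (z : ℝ) : |trunc k z| ≤ |z| := by
  rcases trunc_cases hk z with h | ⟨h, h'⟩ | ⟨h, h'⟩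
  · rw [h]
  · rw [h, abs_of_nonneg hk, abs_of_nonneg (hk.trans h')]; exact h'
  · rw [h, abs_neg, abs_of_nonneg hk, abs_of_nonpos (by linarith)]; linarith

theorem abs_trunc_sub_le (k y z : ℝ) : |trunc k y - trunc k z| ≤ |y - z| := by
  refine (abs_max_sub_max_le_max _ _ _ _).trans ?_
  rw [sub_self, abs_zero]
  refine max_le (abs_nonneg _) ((abs_min_sub_min_le_max _ _ _ _).trans ?_)
  rw [sub_self, abs_zero]
  exact max_le le_rfl (abs_nonneg _)

/-- Convexity of `y⁶ / 6` with explicit remainder: `(y - z)²` times a quartic form that is a sum of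
squares. -/
theorem pow_six_tangent (y z : ℝ) : z ^ 6 / 6 + z ^ 5 * (y - z) ≤ y ^ 6 / 6 := by
  have : y ^ 6 / 6 - (z ^ 6 / 6 + z ^ 5 * (y - z))
      = 1 / 6 * ((y - z) ^ 2 * ((y ^ 2 + y * z + 1 / 2 * z ^ 2) ^ 2 + (y * z + 3 / 2 * z ^ 2) ^ 2 + 5 / 2 * z ^ 4)) := by
    ring
  have h : 0 ≤ 1 / 6 * ((y - z) ^ 2 * ((y ^ 2 + y * z + 1 / 2 * z ^ 2) ^ 2 + (y * z + 3 / 2 * z ^ 2) ^ 2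
      + 5 / 2 * z ^ 4)) := by positivity
  linarith

/-- Convexity of `truncPrim`. At the truncated values it is the tangent inequality for `y⁶ / 6`;
what remains is nonnegative because the excess `y - trunc k y` has the sign that monotonicity of the
fifth power requires. The sign, Lipschitz and derivative properties of `truncPrim` follow from this
inequality. -/
theorem truncPow_tangent (hk : 0 ≤ k) (y z : ℝ) :
    truncPow k z * (y - z) ≤ truncPrim k y - truncPrim k z := by
  have h1 := pow_six_tangent (trunc k y) (trunc k z)
  have h2 : 0 ≤ (trunc k y ^ 5 - trunc k z ^ 5) * (y - trunc k y) := by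
    have hz := abs_le.1 (abs_trunc_le hk z)
    have hodd : Odd 5 := by decide
    rcases trunc_cases hk y with h | ⟨h, h'⟩ | ⟨h, h'⟩
    · rw [h]; simp
    · exact mul_nonneg (sub_nonneg.2 (hodd.strictMono_pow.monotone (by rw [h]; exact hz.2)))
        (by rw [h]; linarith)
    · exact mul_nonneg_of_nonpos_of_nonpos (sub_nonpos.2 (hodd.strictMono_pow.monotone (by rw [h]; exact hz.1)))
        (by rw [h]; linarith)
  simp only [truncPow, truncPrim]
  linarith

theorem truncPow_zero (hk : 0 ≤ k) : truncPow k 0 = 0 := by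
  rw [truncPow, trunc_eq_self (by simpa using hk)]; norm_num

theorem truncPrim_zero (hk : 0 ≤ k) : truncPrim k 0 = 0 := by
  rw [truncPrim, trunc_eq_self (by simpa using hk)]; norm_num

theorem truncPrim_nonneg (hk : 0 ≤ k) (z : ℝ) : 0 ≤ truncPrim k z := by
  have := truncPow_tangent hk z 0
  rw [truncPow_zero hk, truncPrim_zero hk] at this
  linarith

theorem truncPrim_le (k z : ℝ) : truncPrim k z ≤ z ^ 6 / 6 := pow_six_tangent z (trunc k z)

theorem abs_truncPow_le_pow (hk : 0 ≤ k) (z : ℝ) : |truncPow k z| ≤ |z| ^ 5 := by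
  rw [truncPow, abs_pow]
  exact pow_le_pow_left₀ (abs_nonneg _) (abs_trunc_le_abs hk z) 5

theorem abs_truncPow_sub_le (hk : 0 ≤ k) (y z : ℝ) :
    |truncPow k y - truncPow k z| ≤ 5 * k ^ 4 * |y - z| := by
  have h : ∀ a b : ℝ, |a| ≤ k → |b| ≤ k → |a ^ 5 - b ^ 5| ≤ 5 * k ^ 4 * |a - b| := by
    intro a b ha hb
    have e : a ^ 5 - b ^ 5 = (a ^ 4 + a ^ 3 * b + a ^ 2 * b ^ 2 + a * b ^ 3 + b ^ 4) * (a - b) := by ring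
    rw [e, abs_mul]
    refine mul_le_mul_of_nonneg_right ?_ (abs_nonneg _)
    have m : ∀ i j : ℕ, i + j = 4 → |a ^ i * b ^ j| ≤ k ^ 4 := fun i j hij => by
      rw [abs_mul, abs_pow, abs_pow, ← hij, pow_add]
      exact mul_le_mul (pow_le_pow_left₀ (abs_nonneg _) ha i) (pow_le_pow_left₀ (abs_nonneg _) hb j)
        (by positivity) (by positivity)
    have m0 := abs_le.1 (m 4 0 rfl)
    have m1 := abs_le.1 (m 3 1 rfl)
    have m2 := abs_le.1 (m 2 2 rfl)
    have m3 := abs_le.1 (m 1 3 rfl)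
    have m4 := abs_le.1 (m 0 4 rfl)
    simp only [pow_zero, mul_one, one_mul, pow_one] at m0 m1 m2 m3 m4
    rw [abs_le]
    constructor <;> linarith
  exact (h _ _ (abs_trunc_le hk y) (abs_trunc_le hk z)).trans
    (mul_le_mul_of_nonneg_left (abs_trunc_sub_le k y z) (by positivity))

theorem abs_truncPow_le (hk : 0 ≤ k) (z : ℝ) : |truncPow k z| ≤ 5 * k ^ 4 * |z| := by
  simpa [truncPow_zero hk] using abs_truncPow_sub_le hk z 0

theorem abs_truncPrim_sub_le (hk : 0 ≤ k) (y z : ℝ) :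
    |truncPrim k y - truncPrim k z| ≤ 5 * k ^ 4 * ((|y| + |z|) * |y - z|) := by
  have h1 := truncPow_tangent hk y z
  have h2 := truncPow_tangent hk z y
  have b1 : |truncPow k z * (y - z)| ≤ 5 * k ^ 4 * (|z| * |y - z|) := by
    rw [abs_mul, ← mul_assoc]; exact mul_le_mul_of_nonneg_right (abs_truncPow_le hk z) (abs_nonneg _)
  have b2 : |truncPow k y * (z - y)| ≤ 5 * k ^ 4 * (|y| * |y - z|) := by
    rw [abs_mul, ← mul_assoc, abs_sub_comm z y]
    exact mul_le_mul_of_nonneg_right (abs_truncPow_le hk y) (abs_nonneg _)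
  have c1 := abs_le.1 b1
  have c2 := abs_le.1 b2
  have p1 : 0 ≤ 5 * k ^ 4 * (|z| * |y - z|) := by positivity
  have p2 : 0 ≤ 5 * k ^ 4 * (|y| * |y - z|) := by positivity
  rw [abs_le]
  constructor <;> linarith

/-- The tangents at `z` and at `y` trap the remainder between `0` and `(truncPow k y - truncPow k z)
(y - z)`, which is quadratic by the Lipschitz bound. The corners `±k` need no separate treatment. -/
theorem hasDerivAt_truncPrim (hk : 0 ≤ k) (z : ℝ) : HasDerivAt (truncPrim k) (truncPow k z) z := by
  rw [hasDerivAt_iff_isLittleO]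
  have hO : (fun y => truncPrim k y - truncPrim k z - (y - z) • truncPow k z) =O[𝓝 z] fun y => (y - z) ^ 2 := by
    refine Asymptotics.IsBigO.of_bound (5 * k ^ 4) (Eventually.of_forall fun y => ?_)
    have h1 := truncPow_tangent hk y z
    have h2 := truncPow_tangent hk z y
    have h3 := abs_truncPow_sub_le hk y z
    rw [smul_eq_mul, Real.norm_eq_abs, Real.norm_eq_abs, abs_of_nonneg (by linarith), abs_of_nonneg (sq_nonneg _),
      ← sq_abs (y - z)]
    have h4 : (truncPow k y - truncPow k z) * (y - z) ≤ 5 * k ^ 4 * |y - z| * |y - z| :=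
      (le_abs_self _).trans (by rw [abs_mul]; exact mul_le_mul_of_nonneg_right h3 (abs_nonneg _))
    linarith
  refine hO.trans_isLittleO ?_
  have : Tendsto (fun y : ℝ => y - z) (𝓝 z) (𝓝 0) := by
    have := (by fun_prop : Continuous fun y : ℝ => y - z).tendsto z
    rwa [sub_self] at this
  simpa only [sq, mul_one] using
    ((Asymptotics.isLittleO_one_iff ℝ).2 this).mul_isBigO (Asymptotics.isBigO_refl (fun y : ℝ => y - z) (𝓝 z)) |>.congr (fun _ => rfl) (fun _ => one_mul _)

theorem contDiff_truncPrim (hk : 0 ≤ k) : ContDiff ℝ 1 (truncPrim k) := by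
  rw [contDiff_one_iff_deriv]
  refine ⟨fun z => (hasDerivAt_truncPrim hk z).differentiableAt, ?_⟩
  have : deriv (truncPrim k) = truncPow k := funext fun z => (hasDerivAt_truncPrim hk z).deriv
  rw [this]
  exact continuous_truncPow k

theorem eventually_trunc (z : ℝ) : ∀ᶠ n : ℕ in atTop, trunc n z = z := by
  filter_upwards [eventually_ge_atTop ⌈|z|⌉₊] with n hn
  exact trunc_eq_self ((Nat.le_ceil _).trans (by exact_mod_cast hn))

theorem tendsto_truncPow (z : ℝ) : Tendsto (fun n : ℕ => truncPow n z) atTop (𝓝 (z ^ 5)) :=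
  tendsto_const_nhds.congr' (by filter_upwards [eventually_trunc z] with n hn; rw [truncPow, hn])

theorem tendsto_truncPrim (z : ℝ) : Tendsto (fun n : ℕ => truncPrim n z) atTop (𝓝 (z ^ 6 / 6)) :=
  tendsto_const_nhds.congr' (by
    filter_upwards [eventually_trunc z] with n hn; rw [truncPrim, hn]; ring)

end Truncation

/-! ### Chain rule for convex functionals along differentiable curves. -/

section ConvexChainRule

variable {H : Type*} [NormedAddCommGroup H] [InnerProductSpace ℝ H] [CompleteSpace H]

/-- Chain rule for a convex function with continuous gradient `n`. -/
theorem convex_sub_eq_integral {G : H → ℝ} {n : H → H} {a b : ℝ} (hab : a ≤ b) {w v : ℝ → H}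
    (hn : Continuous n) (hG : ∀ f g, inner ℝ (n f) (g - f) ≤ G g - G f)
    (hw : ContinuousOn w (Set.Icc a b)) (hv : ContinuousOn v (Set.Icc a b))
    (hwv : ∀ s ∈ Set.Icc a b, ∀ t ∈ Set.Icc a b, w t - w s = ∫ τ in s..t, v τ) :
    G (w b) - G (w a) = ∫ τ in a..b, inner ℝ (n (w τ)) (v τ) := by
  have hnw : ContinuousOn (fun τ => n (w τ)) (Set.Icc a b) := hn.comp_continuousOn hw
  have hI : ∀ {s t}, s ∈ Set.Icc a b → t ∈ Set.Icc a b →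
      IntervalIntegrable (fun τ => inner ℝ (n (w τ)) (v τ)) volume s t := fun hs ht =>
    ((hnw.inner hv).mono (Set.uIcc_subset_Icc hs ht)).intervalIntegrable
  have hvI : ∀ {s t}, s ∈ Set.Icc a b → t ∈ Set.Icc a b → IntervalIntegrable v volume s t := fun hs ht =>
    (hv.mono (Set.uIcc_subset_Icc hs ht)).intervalIntegrable
  have ha := Set.left_mem_Icc.2 hab
  have main := eq_of_increments_small (e := fun t => G (w t) - ∫ τ in a..t, inner ℝ (n (w τ)) (v τ))
    (G := fun t => ∫ τ in a..t, ‖v τ‖) hab ?_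
  · simp only [intervalIntegral.integral_same, sub_zero] at main
    linarith
  intro ε hε
  have hu := isCompact_Icc.uniformContinuousOn_of_continuous hnw
  rw [Metric.uniformContinuousOn_iff] at hu
  obtain ⟨δ, hδ, hd⟩ := hu ε hε
  refine ⟨δ, hδ, fun s t has hst htb hts => ?_⟩
  have hs : s ∈ Set.Icc a b := ⟨has, hst.trans htb⟩
  have ht : t ∈ Set.Icc a b := ⟨has.trans hst, htb⟩
  have e1 := intervalIntegral.integral_interval_sub_left (hI ha ht) (hI ha hs)
  have e2 := intervalIntegral.integral_interval_sub_left (hvI ha ht).norm (hvI ha hs).norm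
  have bound : ∀ r ∈ Set.Icc a b, (∀ τ ∈ Set.Ioc s t, dist r τ < δ) →
      |inner ℝ (n (w r)) (w t - w s) - ∫ τ in s..t, inner ℝ (n (w τ)) (v τ)| ≤ ε * ∫ τ in s..t, ‖v τ‖ := by
    intro r hr hrd
    have i1 : IntervalIntegrable (fun τ => inner ℝ (n (w r)) (v τ)) volume s t :=
      ⟨(innerSL ℝ (n (w r))).integrable_comp (hvI hs ht).1, (innerSL ℝ (n (w r))).integrable_comp (hvI hs ht).2⟩
    have e3 : inner ℝ (n (w r)) (w t - w s) = ∫ τ in s..t, inner ℝ (n (w r)) (v τ) := by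
      rw [hwv s hs t ht]
      exact ((innerSL ℝ (n (w r))).intervalIntegral_comp_comm (hvI hs ht)).symm
    rw [e3, ← intervalIntegral.integral_sub i1 (hI hs ht), ← intervalIntegral.integral_const_mul,
      ← Real.norm_eq_abs]
    refine intervalIntegral.norm_integral_le_of_norm_le hst ?_ ((hvI hs ht).norm.const_mul ε)
    refine Eventually.of_forall fun τ hτ => ?_
    rw [← inner_sub_left]
    refine (norm_inner_le_norm _ _).trans (mul_le_mul_of_nonneg_right ?_ (norm_nonneg _))
    rw [← dist_eq_norm]
    exact (hd r hr τ ⟨has.trans hτ.1.le, hτ.2.trans htb⟩ (hrd τ hτ)).le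
  have b1 := abs_le.1 (bound s hs fun τ hτ => by
    rw [Real.dist_eq, abs_sub_comm, abs_of_pos (by linarith [hτ.1])]; linarith [hτ.2])
  have b2 := abs_le.1 (bound t ht fun τ hτ => by
    rw [Real.dist_eq, abs_of_nonneg (by linarith [hτ.2])]; linarith [hτ.1])
  -- The tangents at the two ends bound the increment of `G` from below and from above, and both
  -- bounds are close to the integral.
  have g1 := hG (w s) (w t)
  have g2 := hG (w t) (w s)
  rw [← neg_sub (w t) (w s), inner_neg_right] at g2
  rw [e2, abs_le]
  constructor <;> linarith [b1.1, b1.2, b2.1, b2.2]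

end ConvexChainRule

/-! ### The square root of the density and functionals of quadratic growth. -/

/-- The square root of the hyperbolic volume density. -/
def rootDensity (x : E3) : ℝ := (1 + ‖x‖ ^ 2) ^ (-(1 / 4) : ℝ)

theorem rootDensity_pos (x : E3) : 0 < rootDensity x := Real.rpow_pos_of_pos (one_add_norm_sq_pos x) _

theorem contDiff_rootDensity : ContDiff ℝ ∞ rootDensity :=
  (contDiff_const.add (contDiff_norm_sq ℝ)).rpow_const_of_ne fun x => (one_add_norm_sq_pos x).ne'

theorem contDiff_rootDensity_inv : ContDiff ℝ ∞ (fun x => (rootDensity x)⁻¹) :=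
  contDiff_rootDensity.inv fun x => (rootDensity_pos x).ne'

theorem rootDensity_pow_four (x : E3) : rootDensity x ^ 4 = (1 + ‖x‖ ^ 2)⁻¹ := by
  rw [rootDensity, ← Real.rpow_natCast, ← Real.rpow_mul (one_add_norm_sq_pos x).le, ← Real.rpow_neg_one]
  norm_num

theorem rootDensity_sq (x : E3) : rootDensity x ^ 2 = Real.sqrt ((1 + ‖x‖ ^ 2)⁻¹) := by
  rw [← rootDensity_pow_four, show rootDensity x ^ 4 = (rootDensity x ^ 2) ^ 2 by ring,
    Real.sqrt_sq (by positivity)]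

theorem hasFDerivAt_rootDensity (x : E3) :
    HasFDerivAt rootDensity ((-(1 / 2) * (1 + ‖x‖ ^ 2)⁻¹ * rootDensity x) • innerSL ℝ x) x := by
  have h1 := one_add_norm_sq_pos x
  have h2 : HasFDerivAt (fun y : E3 => 1 + ‖y‖ ^ 2) (2 • innerSL ℝ x) x :=
    (hasStrictFDerivAt_norm_sq x).hasFDerivAt.const_add 1
  have h3 := h2.rpow_const (p := -(1 / 4)) (Or.inl h1.ne')
  refine h3.congr_fderiv ?_
  ext y
  rw [Real.rpow_sub_one h1.ne']
  simp [rootDensity]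
  ring

theorem euler_rootDensity (x : E3) :
    euler rootDensity x = -(1 / 2) * (‖x‖ ^ 2 * (1 + ‖x‖ ^ 2)⁻¹) * rootDensity x := by
  rw [euler, (hasFDerivAt_rootDensity x).fderiv]
  simp
  ring

theorem grad_rootDensity (x : E3) :
    grad rootDensity x = (-(1 / 2) * (1 + ‖x‖ ^ 2)⁻¹ * rootDensity x) • x := by
  ext i
  simp only [grad, diff, (hasFDerivAt_rootDensity x).fderiv]
  simp [EuclideanSpace.inner_single_right]

section Functional

/-- Functionals of quadratic growth are continuous on `L²`. -/
theorem continuous_integral_of_quadratic {d : E3 → ℝ → ℝ} {C : ℝ}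
    (hm : ∀ f : L2 ℝ, AEStronglyMeasurable (fun x => d x (f x)) volume) (h0 : ∀ x, d x 0 = 0)
    (hd : ∀ x y z, |d x y - d x z| ≤ C * ((|y| + |z|) * |y - z|)) :
    (∀ f : L2 ℝ, Integrable (fun x => d x (f x))) ∧ Continuous (fun f : L2 ℝ => ∫ x, d x (f x)) := by
  have hi : ∀ f : L2 ℝ, Integrable (fun x => d x (f x)) := by
    intro f
    have h2 := (memLp_two_iff_integrable_sq (Lp.aestronglyMeasurable f)).1 (Lp.memLp f)
    refine (h2.const_mul C).mono' (hm f) (Eventually.of_forall fun x => ?_)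
    have := hd x (f x) 0
    rw [h0] at this
    simp only [sub_zero, abs_zero, add_zero] at this
    rw [← sq, sq_abs] at this
    exact this
  refine ⟨hi, ?_⟩
  have key : ∀ f g : L2 ℝ, |(∫ x, d x (f x)) - ∫ x, d x (g x)| ≤ |C| * ((‖f‖ + ‖g‖) * ‖f - g‖) := by
    intro f g
    rw [← integral_sub (hi f) (hi g)]
    have e : ∀ᵐ x, |d x (f x) - d x (g x)| ≤ |C| * ((|f| + |g| : L2 ℝ) x * (|f - g| : L2 ℝ) x) := by
      filter_upwards [Lp.coeFn_add |f| |g|, Lp.coeFn_abs f, Lp.coeFn_abs g, Lp.coeFn_abs (f - g), Lp.coeFn_sub f g]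
        with x a1 a2 a3 a4 a5
      rw [a1, Pi.add_apply, a2, a3, a4, a5, Pi.sub_apply]
      exact (hd x _ _).trans (mul_le_mul_of_nonneg_right (le_abs_self C) (by positivity))
    have i1 : Integrable (fun x => (|f| + |g| : L2 ℝ) x * (|f - g| : L2 ℝ) x) :=
      (Lp.memLp _).integrable_mul (Lp.memLp _)
    calc |∫ x, (d x (f x) - d x (g x))| ≤ ∫ x, |d x (f x) - d x (g x)| := abs_integral_le_integral_abs
      _ ≤ ∫ x, |C| * ((|f| + |g| : L2 ℝ) x * (|f - g| : L2 ℝ) x) :=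
          integral_mono_ae ((hi f).sub (hi g)).abs (i1.const_mul _) e
      _ = |C| * inner ℝ (|f| + |g|) |f - g| := by
          rw [integral_const_mul, inner_eq_integral Filter.EventuallyEq.rfl Filter.EventuallyEq.rfl]
      _ ≤ |C| * ((‖f‖ + ‖g‖) * ‖f - g‖) := by
          refine mul_le_mul_of_nonneg_left ((real_inner_le_norm _ _).trans ?_) (abs_nonneg _)
          rw [norm_abs_eq_norm]
          refine mul_le_mul_of_nonneg_right ((norm_add_le _ _).trans ?_) (norm_nonneg _)
          rw [norm_abs_eq_norm, norm_abs_eq_norm]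
  rw [continuous_iff_continuousAt]
  intro g
  rw [ContinuousAt, tendsto_iff_norm_sub_tendsto_zero]
  refine squeeze_zero (fun _ => norm_nonneg _) (fun f => key f g) ?_
  have : Continuous (fun f : L2 ℝ => |C| * ((‖f‖ + ‖g‖) * ‖f - g‖)) := by fun_prop
  have := this.tendsto g
  simpa using this

end Functional

/-! ### The truncated nonlinearity on `L²` and its virial identity. -/

section Nemytskii

/-- The truncated nonlinearity conjugated to `L²(dx)`. -/
def nem (n : ℕ) (x : E3) (y : ℝ) : ℝ := rootDensity x * truncPow n ((rootDensity x)⁻¹ * y)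

/-- The truncated potential energy density conjugated to `L²(dx)`. -/
def nemPrim (n : ℕ) (x : E3) (y : ℝ) : ℝ := rootDensity x ^ 2 * truncPrim n ((rootDensity x)⁻¹ * y)

theorem nem_zero (n : ℕ) (x : E3) : nem n x 0 = 0 := by
  rw [nem, mul_zero, truncPow_zero n.cast_nonneg, mul_zero]

theorem nemPrim_zero (n : ℕ) (x : E3) : nemPrim n x 0 = 0 := by
  rw [nemPrim, mul_zero, truncPrim_zero n.cast_nonneg, mul_zero]

theorem continuous_nem (n : ℕ) : Continuous (Function.uncurry (nem n)) := by
  have h1 := contDiff_rootDensity.continuous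
  have h2 := contDiff_rootDensity_inv.continuous
  have h3 := continuous_truncPow n
  exact (h1.comp continuous_fst).mul (h3.comp ((h2.comp continuous_fst).mul continuous_snd))

theorem aestronglyMeasurable_nem (n : ℕ) {f : E3 → ℝ} (hf : AEStronglyMeasurable f volume) :
    AEStronglyMeasurable (fun x => nem n x (f x)) volume :=
  contDiff_rootDensity.continuous.aestronglyMeasurable.mul ((continuous_truncPow n).comp_aestronglyMeasurable
    (contDiff_rootDensity_inv.continuous.aestronglyMeasurable.mul hf))

theorem aestronglyMeasurable_nemPrim (n : ℕ) {f : E3 → ℝ} (hf : AEStronglyMeasurable f volume) :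
    AEStronglyMeasurable (fun x => nemPrim n x (f x)) volume :=
  (contDiff_rootDensity.continuous.pow 2).aestronglyMeasurable.mul
    ((continuous_truncPrim n).comp_aestronglyMeasurable
      (contDiff_rootDensity_inv.continuous.aestronglyMeasurable.mul hf))

theorem abs_nem_sub_le (n : ℕ) (x : E3) (y z : ℝ) : |nem n x y - nem n x z| ≤ 5 * (n : ℝ) ^ 4 * |y - z| := by
  have hp := rootDensity_pos x
  rw [nem, nem, ← mul_sub, abs_mul, abs_of_pos hp]
  refine (mul_le_mul_of_nonneg_left (abs_truncPow_sub_le n.cast_nonneg _ _) hp.le).trans (le_of_eq ?_)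
  rw [← mul_sub, abs_mul, abs_of_pos (inv_pos.2 hp)]
  field_simp

theorem abs_nem_le (n : ℕ) (x : E3) (y : ℝ) : |nem n x y| ≤ 5 * (n : ℝ) ^ 4 * |y| := by
  simpa [nem_zero] using abs_nem_sub_le n x y 0

theorem abs_nemPrim_sub_le (n : ℕ) (x : E3) (y z : ℝ) :
    |nemPrim n x y - nemPrim n x z| ≤ 5 * (n : ℝ) ^ 4 * ((|y| + |z|) * |y - z|) := by
  have hp := rootDensity_pos x
  rw [nemPrim, nemPrim, ← mul_sub, abs_mul, abs_of_pos (pow_pos hp 2)]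
  refine (mul_le_mul_of_nonneg_left (abs_truncPrim_sub_le n.cast_nonneg _ _) (by positivity)).trans (le_of_eq ?_)
  rw [← mul_sub, abs_mul, abs_mul, abs_mul, abs_of_pos (inv_pos.2 hp)]
  field_simp

theorem nem_tangent (n : ℕ) (x : E3) (y z : ℝ) : nem n x z * (y - z) ≤ nemPrim n x y - nemPrim n x z := by
  have hp := rootDensity_pos x
  have h := truncPow_tangent (k := n) n.cast_nonneg ((rootDensity x)⁻¹ * y) ((rootDensity x)⁻¹ * z)
  have h2 := mul_le_mul_of_nonneg_left h (sq_nonneg (rootDensity x))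
  rw [nem, nemPrim, nemPrim]
  refine le_trans (le_of_eq ?_) (h2.trans (le_of_eq (mul_sub _ _ _)))
  field_simp

theorem memLp_nem (n : ℕ) {f : E3 → ℝ} (hf : MemLp f 2 volume) : MemLp (fun x => nem n x (f x)) 2 volume :=
  hf.of_le_mul (c := 5 * (n : ℝ) ^ 4) (aestronglyMeasurable_nem n hf.aestronglyMeasurable)
    (Eventually.of_forall fun x => abs_nem_le n x (f x))

/-- The truncated nonlinearity as an operator on `L²`. -/
def nemL2 (n : ℕ) (f : L2 ℝ) : L2 ℝ := (memLp_nem n (Lp.memLp f)).toLp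

theorem coeFn_nemL2 (n : ℕ) (f : L2 ℝ) : nemL2 n f =ᵐ[volume] fun x => nem n x (f x) := MemLp.coeFn_toLp _

theorem continuous_nemL2 (n : ℕ) : Continuous (nemL2 n) := by
  have key : ∀ f g : L2 ℝ, ‖nemL2 n f - nemL2 n g‖ ≤ 5 * (n : ℝ) ^ 4 * ‖f - g‖ := by
    intro f g
    refine Lp.norm_le_mul_norm_of_ae_le_mul ?_
    filter_upwards [Lp.coeFn_sub (nemL2 n f) (nemL2 n g), Lp.coeFn_sub f g, coeFn_nemL2 n f, coeFn_nemL2 n g]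
      with x a b c d
    rw [a, b, Pi.sub_apply, Pi.sub_apply, c, d]
    exact abs_nem_sub_le n x _ _
  rw [continuous_iff_continuousAt]
  intro g
  rw [ContinuousAt, tendsto_iff_norm_sub_tendsto_zero]
  refine squeeze_zero (fun _ => norm_nonneg _) (fun f => key f g) ?_
  have : Continuous (fun f : L2 ℝ => 5 * (n : ℝ) ^ 4 * ‖f - g‖) := by fun_prop
  have := this.tendsto g
  simpa using this

theorem integrable_nemPrim (n : ℕ) (f : L2 ℝ) : Integrable (fun x => nemPrim n x (f x)) :=
  (continuous_integral_of_quadratic (fun f => aestronglyMeasurable_nemPrim n (Lp.aestronglyMeasurable f))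
    (nemPrim_zero n) (abs_nemPrim_sub_le n)).1 f

theorem inner_nemL2_le (n : ℕ) (f g : L2 ℝ) :
    inner ℝ (nemL2 n f) (g - f) ≤ (∫ x, nemPrim n x (g x)) - ∫ x, nemPrim n x (f x) := by
  rw [inner_eq_integral (coeFn_nemL2 n f) (Lp.coeFn_sub g f), ← integral_sub (integrable_nemPrim n g) (integrable_nemPrim n f)]
  refine integral_mono ?_ ((integrable_nemPrim n g).sub (integrable_nemPrim n f)) fun x => nem_tangent n x _ _
  exact (memLp_nem n (Lp.memLp f)).integrable_mul ((Lp.memLp g).sub (Lp.memLp f))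

/-- Half of the divergence of the Euler field with respect to the hyperbolic volume. -/
def halfDiv (x : E3) : ℝ := 1 + 1 / 2 * (1 + ‖x‖ ^ 2)⁻¹

theorem continuous_halfDiv : Continuous halfDiv :=
  continuous_const.add (continuous_const.mul contDiff_radial_inv.continuous)

theorem one_le_halfDiv (x : E3) : 1 ≤ halfDiv x := by
  have := inv_pos.2 (one_add_norm_sq_pos x)
  unfold halfDiv; linarith

theorem halfDiv_le (x : E3) : halfDiv x ≤ 2 := by
  have : (1 + ‖x‖ ^ 2)⁻¹ ≤ 1 := inv_le_one_of_one_le₀ (by nlinarith [sq_nonneg ‖x‖])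
  unfold halfDiv; linarith

/-- The density of `⟪N(f), A f⟫` for the truncated nonlinearity. -/
def virialDensity (n : ℕ) (x : E3) (y : ℝ) : ℝ := halfDiv x * (nem n x y * y - 2 * nemPrim n x y)

theorem abs_virialDensity_sub_le (n : ℕ) (x : E3) (y z : ℝ) :
    |virialDensity n x y - virialDensity n x z| ≤ 30 * (n : ℝ) ^ 4 * ((|y| + |z|) * |y - z|) := by
  have e : virialDensity n x y - virialDensity n x z
      = halfDiv x * ((nem n x y * (y - z) + (nem n x y - nem n x z) * z) - 2 * (nemPrim n x y - nemPrim n x z)) := by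
    simp only [virialDensity]; ring
  have b1 : |nem n x y * (y - z)| ≤ 5 * (n : ℝ) ^ 4 * (|y| * |y - z|) := by
    rw [abs_mul, ← mul_assoc]; exact mul_le_mul_of_nonneg_right (abs_nem_le n x y) (abs_nonneg _)
  have b2 : |(nem n x y - nem n x z) * z| ≤ 5 * (n : ℝ) ^ 4 * (|z| * |y - z|) := by
    rw [abs_mul, mul_comm |z|, ← mul_assoc]
    exact mul_le_mul_of_nonneg_right (abs_nem_sub_le n x y z) (abs_nonneg _)
  have b3 := abs_le.1 (abs_nemPrim_sub_le n x y z)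
  have c1 := abs_le.1 b1
  have c2 := abs_le.1 b2
  have p : 0 ≤ 5 * (n : ℝ) ^ 4 * ((|y| + |z|) * |y - z|) := by positivity
  have b4 : |(nem n x y * (y - z) + (nem n x y - nem n x z) * z) - 2 * (nemPrim n x y - nemPrim n x z)|
      ≤ 15 * (n : ℝ) ^ 4 * ((|y| + |z|) * |y - z|) := by
    rw [abs_le]
    constructor <;> linarith [c1.1, c1.2, c2.1, c2.2, b3.1, b3.2]
  have hq := one_le_halfDiv x
  rw [e, abs_mul, abs_of_pos (by linarith)]
  refine (mul_le_mul (halfDiv_le x) b4 (abs_nonneg _) (by norm_num)).trans (le_of_eq (by ring))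

theorem aestronglyMeasurable_virialDensity (n : ℕ) {f : E3 → ℝ} (hf : AEStronglyMeasurable f volume) :
    AEStronglyMeasurable (fun x => virialDensity n x (f x)) volume :=
  continuous_halfDiv.aestronglyMeasurable.mul (((aestronglyMeasurable_nem n hf).mul hf).sub
    ((aestronglyMeasurable_nemPrim n hf).const_mul 2))

/-- Integration by parts for the truncated nonlinearity on test functions. -/
theorem integral_nem_mul_euler (n : ℕ) {ψ : E3 → ℝ} (hψ : IsTest ψ) :
    ∫ x, nem n x (ψ x) * (euler ψ x + 3 / 2 * ψ x) = ∫ x, virialDensity n x (ψ x) := by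
  have hk : (0 : ℝ) ≤ n := n.cast_nonneg
  set κ := rootDensity with hκ
  set φ : E3 → ℝ := fun x => (κ x)⁻¹ * ψ x with hφ
  have tφ : IsTest φ := hψ.mul_left contDiff_rootDensity_inv
  have hκd : ∀ x, DifferentiableAt ℝ κ x := fun x => (hasFDerivAt_rootDensity x).differentiableAt
  have ck := contDiff_rootDensity.continuous
  have eψ : ψ = fun x => κ x * φ x := by
    ext x
    simp only [hφ]
    rw [← mul_assoc, mul_inv_cancel₀ (rootDensity_pos x).ne', one_mul]
  have eEψ : ∀ x, euler ψ x = κ x * euler φ x + φ x * euler κ x := fun x => by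
    conv_lhs => rw [eψ]
    exact euler_mul (hκd x) (tφ.differentiableAt x)
  have hcomp : ContDiff ℝ 1 (fun x => truncPrim n (φ x)) :=
    (contDiff_truncPrim hk).comp (tφ.1.of_le (by simp))
  have hsupp : HasCompactSupport (fun x => truncPrim n (φ x)) := tφ.2.comp_left (truncPrim_zero hk)
  have hκ2 : ContDiff ℝ 1 (fun x => κ x * κ x) :=
    (contDiff_rootDensity.mul contDiff_rootDensity).of_le (by simp)
  -- The divergence theorem is applied to `κ² truncPrim n (φ)`, where `φ = κ⁻¹ ψ` undoes the
  -- conjugation. Differentiating `κ²` turns the divergence `3` into `3 - ‖x‖² / (1 + ‖x‖²) = 2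
  -- halfDiv`.
  have hint := integral_euler (hκ2.mul hcomp) hsupp.mul_left
  have eE : ∀ x, euler (fun x => κ x * κ x * truncPrim n (φ x)) x
      = κ x ^ 2 * (truncPow n (φ x) * euler φ x) + truncPrim n (φ x) * (2 * κ x * euler κ x) := by
    intro x
    have hκκ : DifferentiableAt ℝ (fun x => κ x * κ x) x := (hκd x).mul (hκd x)
    rw [euler_mul hκκ (hcomp.differentiable (by simp) x), euler_mul (hκd x) (hκd x)]
    have : euler (fun x => truncPrim n (φ x)) x = truncPow n (φ x) * euler φ x := by
      have h := (hasDerivAt_truncPrim hk (φ x)).comp_hasFDerivAt x (tφ.differentiableAt x).hasFDerivAt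
      have h2 : HasFDerivAt (fun x => truncPrim n (φ x)) (truncPow n (φ x) • fderiv ℝ φ x) x := h
      rw [euler, h2.fderiv]
      simp [euler]
    rw [this]
    ring
  have cφ := tφ.continuous
  have c1 := continuous_truncPow n
  have c2 := continuous_truncPrim n
  have i1 : Integrable (fun x => κ x ^ 2 * (truncPow n (φ x) * euler φ x)) := by
    refine Continuous.integrable_of_hasCompactSupport ?_ (tφ.euler.2.mul_left.mul_left)
    exact (ck.pow 2).mul ((c1.comp cφ).mul tφ.euler.continuous)
  have i2 : Integrable (fun x => (-(‖x‖ ^ 2 * (1 + ‖x‖ ^ 2)⁻¹)) * (κ x ^ 2 * truncPrim n (φ x))) := by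
    refine Continuous.integrable_of_hasCompactSupport ?_ (hsupp.mul_left.mul_left)
    exact ((continuous_norm.pow 2).mul contDiff_radial_inv.continuous).neg.mul ((ck.pow 2).mul (c2.comp cφ))
  have i3 : Integrable (fun x => κ x ^ 2 * truncPrim n (φ x)) := by
    refine Continuous.integrable_of_hasCompactSupport ?_ hsupp.mul_left
    exact (ck.pow 2).mul (c2.comp cφ)
  have i4 : Integrable (fun x => halfDiv x * (nem n x (ψ x) * ψ x)) := by
    refine Continuous.integrable_of_hasCompactSupport ?_ (hψ.2.mul_left.mul_left)
    exact continuous_halfDiv.mul (((continuous_nem n).comp (continuous_id.prodMk hψ.continuous)).mul hψ.continuous)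
  have e1 : ∀ x, nem n x (ψ x) * (euler ψ x + 3 / 2 * ψ x)
      = κ x ^ 2 * (truncPow n (φ x) * euler φ x) + halfDiv x * (nem n x (ψ x) * ψ x) := by
    intro x
    have e0 : ψ x = κ x * φ x := congrFun eψ x
    have e2 : nem n x (ψ x) = κ x * truncPow n (φ x) := rfl
    have hp := (one_add_norm_sq_pos x).ne'
    have e3 : ‖x‖ ^ 2 * (1 + ‖x‖ ^ 2)⁻¹ = 1 - (1 + ‖x‖ ^ 2)⁻¹ := by field_simp; ring
    rw [e2, eEψ, euler_rootDensity, e0, e3, halfDiv]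
    ring
  have e4 : ∀ x, virialDensity n x (ψ x)
      = halfDiv x * (nem n x (ψ x) * ψ x) + (-3 * (κ x ^ 2 * truncPrim n (φ x))
        - (-(‖x‖ ^ 2 * (1 + ‖x‖ ^ 2)⁻¹)) * (κ x ^ 2 * truncPrim n (φ x))) := by
    intro x
    have e2 : nemPrim n x (ψ x) = κ x ^ 2 * truncPrim n (φ x) := rfl
    have hp := (one_add_norm_sq_pos x).ne'
    have e3 : ‖x‖ ^ 2 * (1 + ‖x‖ ^ 2)⁻¹ = 1 - (1 + ‖x‖ ^ 2)⁻¹ := by field_simp; ring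
    rw [virialDensity, e2, e3, halfDiv]
    ring
  have e5 : ∀ x, κ x ^ 2 * (truncPow n (φ x) * euler φ x) + truncPrim n (φ x) * (2 * κ x * euler κ x)
      = κ x ^ 2 * (truncPow n (φ x) * euler φ x)
        + (-(‖x‖ ^ 2 * (1 + ‖x‖ ^ 2)⁻¹)) * (κ x ^ 2 * truncPrim n (φ x)) := by
    intro x
    rw [euler_rootDensity]; ring
  simp only [eE, e5] at hint
  rw [integral_add i1 i2] at hint
  simp only [e1, e4]
  have i5 : Integrable (fun x => -3 * (κ x ^ 2 * truncPrim n (φ x))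
        - (-(‖x‖ ^ 2 * (1 + ‖x‖ ^ 2)⁻¹)) * (κ x ^ 2 * truncPrim n (φ x))) := (i3.const_mul _).sub i2
  rw [integral_add i1 i4, integral_add i4 i5, integral_sub (i3.const_mul _) i2, integral_const_mul]
  have e6 : (∫ x, κ x * κ x * truncPrim n (φ x)) = ∫ x, κ x ^ 2 * truncPrim n (φ x) := by
    simp only [sq]
  rw [e6] at hint
  linarith

/-- Truncation makes both sides continuous in the jet, so the identity for test functions passes to
the closure. -/
theorem inner_nemL2_generator (n : ℕ) {w : Jet} (hw : w ∈ Jet.energySpace) :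
    inner ℝ (nemL2 n (Jet.val w)) (Jet.generator w) = ∫ x, virialDensity n x (Jet.val w x) := by
  refine Jet.energySpace_induction
    (p := fun w => inner ℝ (nemL2 n (Jet.val w)) (Jet.generator w) = ∫ x, virialDensity n x (Jet.val w x))
    ?_ (fun ψ w hψ h => ?_) w hw
  · refine isClosed_eq (((continuous_nemL2 n).comp Jet.val.continuous).inner Jet.generator.continuous) ?_
    exact (continuous_integral_of_quadratic
      (fun f => aestronglyMeasurable_virialDensity n (Lp.aestronglyMeasurable f))
      (fun x => by simp [virialDensity, nemPrim_zero]) (abs_virialDensity_sub_le n)).2.comp Jet.val.continuous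
  · have h1 : nemL2 n (Jet.val w) =ᵐ[volume] fun x => nem n x (ψ x) := by
      filter_upwards [coeFn_nemL2 n (Jet.val w), h.1] with x a b
      rw [a, b]
    rw [inner_eq_integral h1 h.generator, integral_nem_mul_euler n hψ]
    refine integral_congr_ae ?_
    filter_upwards [h.1] with x a
    rw [a]

end Nemytskii

/-! ### Removing the truncation. -/

section Quintic

/-- The quintic nonlinearity conjugated to `L²(dx)`. -/
def quintic (x : E3) (y : ℝ) : ℝ := rootDensity x * ((rootDensity x)⁻¹ * y) ^ 5

/-- The density of the sixth power of the `L⁶` norm conjugated to `L²(dx)`. -/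
def sextic (x : E3) (y : ℝ) : ℝ := rootDensity x ^ 2 * ((rootDensity x)⁻¹ * y) ^ 6

theorem sextic_nonneg (x : E3) (y : ℝ) : 0 ≤ sextic x y :=
  mul_nonneg (sq_nonneg _) (Even.pow_nonneg (by decide) _)

theorem quintic_mul_self (x : E3) (y : ℝ) : quintic x y * y = sextic x y := by
  have := (rootDensity_pos x).ne'
  unfold quintic sextic
  field_simp

theorem abs_nem_le_quintic (n : ℕ) (x : E3) (y : ℝ) : |nem n x y| ≤ |quintic x y| := by
  rw [nem, quintic, abs_mul, abs_mul, abs_pow]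
  exact mul_le_mul_of_nonneg_left (abs_truncPow_le_pow n.cast_nonneg _) (abs_nonneg _)

theorem nemPrim_le_sextic (n : ℕ) (x : E3) (y : ℝ) : nemPrim n x y ≤ 1 / 6 * sextic x y := by
  have := mul_le_mul_of_nonneg_left (truncPrim_le n ((rootDensity x)⁻¹ * y)) (sq_nonneg (rootDensity x))
  rw [nemPrim, sextic]
  linarith

theorem nemPrim_nonneg (n : ℕ) (x : E3) (y : ℝ) : 0 ≤ nemPrim n x y :=
  mul_nonneg (sq_nonneg _) (truncPrim_nonneg n.cast_nonneg _)

theorem tendsto_nem (x : E3) (y : ℝ) : Tendsto (fun n => nem n x y) atTop (𝓝 (quintic x y)) :=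
  (tendsto_truncPow _).const_mul _

theorem tendsto_nemPrim (x : E3) (y : ℝ) : Tendsto (fun n => nemPrim n x y) atTop (𝓝 (1 / 6 * sextic x y)) := by
  have := (tendsto_truncPrim ((rootDensity x)⁻¹ * y)).const_mul (rootDensity x ^ 2)
  have e : rootDensity x ^ 2 * (((rootDensity x)⁻¹ * y) ^ 6 / 6) = 1 / 6 * sextic x y := by rw [sextic]; ring
  rw [e] at this
  exact this

theorem aestronglyMeasurable_sextic {f : E3 → ℝ} (hf : AEStronglyMeasurable f volume) :
    AEStronglyMeasurable (fun x => sextic x (f x)) volume :=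
  (contDiff_rootDensity.continuous.pow 2).aestronglyMeasurable.mul
    ((contDiff_rootDensity_inv.continuous.aestronglyMeasurable.mul hf).pow 6)

theorem aestronglyMeasurable_quintic {f : E3 → ℝ} (hf : AEStronglyMeasurable f volume) :
    AEStronglyMeasurable (fun x => quintic x (f x)) volume :=
  contDiff_rootDensity.continuous.aestronglyMeasurable.mul
    ((contDiff_rootDensity_inv.continuous.aestronglyMeasurable.mul hf).pow 5)

open Classical in
/-- The quintic nonlinearity on `L²`, with value `0` where it leaves `L²`. -/
def quinticL2 (f : L2 ℝ) : L2 ℝ :=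
  if h : MemLp (fun x => quintic x (f x)) 2 (volume : Measure E3) then h.toLp else 0

variable {f : L2 ℝ}

theorem coeFn_quinticL2 (h : MemLp (fun x => quintic x (f x)) 2 (volume : Measure E3)) :
    quinticL2 f =ᵐ[volume] fun x => quintic x (f x) := by
  rw [quinticL2, dif_pos h]
  exact h.coeFn_toLp

theorem norm_nemL2_le (h : MemLp (fun x => quintic x (f x)) 2 (volume : Measure E3)) (n : ℕ) :
    ‖nemL2 n f‖ ≤ ‖quinticL2 f‖ := by
  refine Lp.norm_le_norm_of_ae_le ?_
  filter_upwards [coeFn_nemL2 n f, coeFn_quinticL2 h] with x a b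
  rw [a, b]
  exact abs_nem_le_quintic n x _

theorem tendsto_nemL2 (h : MemLp (fun x => quintic x (f x)) 2 (volume : Measure E3)) :
    Tendsto (fun n => nemL2 n f) atTop (𝓝 (quinticL2 f)) := by
  rw [tendsto_iff_norm_sub_tendsto_zero]
  have e : ∀ n, ‖nemL2 n f - quinticL2 f‖ ^ 2 = ∫ x, (nem n x (f x) - quintic x (f x)) ^ 2 := by
    intro n
    have : (nemL2 n f - quinticL2 f : L2 ℝ) =ᵐ[volume] fun x => nem n x (f x) - quintic x (f x) := by
      filter_upwards [Lp.coeFn_sub (nemL2 n f) (quinticL2 f), coeFn_nemL2 n f, coeFn_quinticL2 h] with x a b c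
      rw [a, Pi.sub_apply, b, c]
    rw [norm_sq_eq_integral this]
    simp only [Real.norm_eq_abs, sq_abs]
  have hq := (memLp_two_iff_integrable_sq h.aestronglyMeasurable).1 h
  have h2 : Tendsto (fun n : ℕ => ∫ x, (nem n x (f x) - quintic x (f x)) ^ 2) atTop (𝓝 (∫ x : E3, (0 : ℝ))) := by
    refine tendsto_integral_of_dominated_convergence (fun x => 4 * quintic x (f x) ^ 2) (fun n => ?_)
      (hq.const_mul 4) (fun n => Eventually.of_forall fun x => ?_) (Eventually.of_forall fun x => ?_)
    · exact ((aestronglyMeasurable_nem n (Lp.aestronglyMeasurable f)).sub h.aestronglyMeasurable).pow 2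
    · have hx := abs_nem_le_quintic n x (f x)
      rw [Real.norm_eq_abs, abs_of_nonneg (sq_nonneg _), ← sq_abs, ← sq_abs (quintic x (f x))]
      have := abs_sub (nem n x (f x)) (quintic x (f x))
      calc |nem n x (f x) - quintic x (f x)| ^ 2 ≤ (2 * |quintic x (f x)|) ^ 2 :=
            pow_le_pow_left₀ (abs_nonneg _) (by linarith) 2
        _ = 4 * |quintic x (f x)| ^ 2 := by ring
    · have := ((tendsto_nem x (f x)).sub_const (quintic x (f x))).pow 2
      simpa using this
  simp only [← e, integral_zero] at h2
  have h3 := (Real.continuous_sqrt.tendsto 0).comp h2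
  simpa [Function.comp_def, Real.sqrt_sq (norm_nonneg _)] using h3

/-- The density is the product of the `L²` functions `quintic x (f x)` and `f`, so finite potential
energy follows without a Sobolev inequality. -/
theorem integrable_sextic (h : MemLp (fun x => quintic x (f x)) 2 (volume : Measure E3)) :
    Integrable (fun x => sextic x (f x)) := by
  have := h.integrable_mul (Lp.memLp f)
  exact this.congr (Eventually.of_forall fun x => quintic_mul_self x (f x))

theorem tendsto_integral_nemPrim (h : Integrable (fun x => sextic x (f x))) :
    Tendsto (fun n => ∫ x, nemPrim n x (f x)) atTop (𝓝 (1 / 6 * ∫ x, sextic x (f x))) := by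
  rw [← integral_const_mul]
  refine tendsto_integral_of_dominated_convergence (fun x => 1 / 6 * sextic x (f x))
    (fun n => aestronglyMeasurable_nemPrim n (Lp.aestronglyMeasurable f)) (h.const_mul _)
    (fun n => Eventually.of_forall fun x => ?_) (Eventually.of_forall fun x => tendsto_nemPrim x (f x))
  rw [Real.norm_of_nonneg (nemPrim_nonneg n x _)]
  exact nemPrim_le_sextic n x _

/-- Fatou's lemma along the truncations. It applies at every time, including those where the quintic
term may leave `L²`. -/
theorem integrable_sextic_of_bounded {c : ℝ} (h : ∀ n, ∫ x, nemPrim n x (f x) ≤ c) :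
    Integrable (fun x => sextic x (f x)) := by
  have hm := aestronglyMeasurable_sextic (Lp.aestronglyMeasurable f)
  have h6 : Integrable (fun x => 1 / 6 * sextic x (f x)) := by
    refine ⟨hm.const_mul _, ?_⟩
    rw [hasFiniteIntegral_iff_ofReal (Eventually.of_forall fun x =>
      mul_nonneg (by norm_num) (sextic_nonneg x (f x)))]
    have e : ∀ x, ENNReal.ofReal (1 / 6 * sextic x (f x))
        = liminf (fun n => ENNReal.ofReal (nemPrim n x (f x))) atTop := fun x =>
      (((ENNReal.continuous_ofReal.tendsto _).comp (tendsto_nemPrim x (f x))).liminf_eq).symm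
    simp only [e]
    refine (lintegral_liminf_le' fun n =>
      (aestronglyMeasurable_nemPrim n (Lp.aestronglyMeasurable f)).aemeasurable.ennreal_ofReal).trans_lt ?_
    have hb : ∀ n, ∫⁻ x, ENNReal.ofReal (nemPrim n x (f x)) ≤ ENNReal.ofReal c := fun n => by
      rw [← ofReal_integral_eq_lintegral_ofReal (integrable_nemPrim n f)
        (Eventually.of_forall fun x => nemPrim_nonneg n x (f x))]
      exact ENNReal.ofReal_le_ofReal (h n)
    refine lt_of_le_of_lt (liminf_le_of_frequently_le' (Eventually.of_forall hb).frequently) ENNReal.ofReal_lt_top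
  exact (h6.const_mul 6).congr (Eventually.of_forall fun x => by ring)

/-- The nonlinearity controls the `L⁶` norm in the virial identity. -/
theorem integral_sextic_le {w : Jet} (hw : w ∈ Jet.energySpace)
    (h : MemLp (fun x => quintic x (Jet.val w x)) 2 (volume : Measure E3)) :
    2 / 3 * (∫ x, sextic x (Jet.val w x)) ≤ inner ℝ (quinticL2 (Jet.val w)) (Jet.generator w) := by
  have hs := integrable_sextic h
  have hiv : ∀ n, Integrable (fun x => virialDensity n x (Jet.val w x)) := fun n =>
    (continuous_integral_of_quadratic
      (fun f => aestronglyMeasurable_virialDensity n (Lp.aestronglyMeasurable f))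
      (fun x => by rw [virialDensity, nem_zero, nemPrim_zero]; ring) (abs_virialDensity_sub_le n)).1 _
  have l1 : Tendsto (fun n => inner ℝ (nemL2 n (Jet.val w)) (Jet.generator w)) atTop
      (𝓝 (inner ℝ (quinticL2 (Jet.val w)) (Jet.generator w))) := (tendsto_nemL2 h).inner tendsto_const_nhds
  simp only [inner_nemL2_generator _ hw] at l1
  -- In the limit `nem · y - 2 nemPrim` becomes `(1 - 2/6) sextic`, whence the factor `2/3`; the
  -- weight `halfDiv` is at least `1`.
  have l2 : Tendsto (fun n => ∫ x, virialDensity n x (Jet.val w x)) atTop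
      (𝓝 (∫ x, halfDiv x * (2 / 3 * sextic x (Jet.val w x)))) := by
    refine tendsto_integral_of_dominated_convergence (fun x => 4 * sextic x (Jet.val w x))
      (fun n => (hiv n).aestronglyMeasurable) (hs.const_mul _)
      (fun n => Eventually.of_forall fun x => ?_) (Eventually.of_forall fun x => ?_)
    · set y := Jet.val w x
      have a0 : |nem n x y * y| ≤ sextic x y := by
        rw [← abs_of_nonneg (sextic_nonneg x y), ← quintic_mul_self, abs_mul, abs_mul]
        exact mul_le_mul_of_nonneg_right (abs_nem_le_quintic n x y) (abs_nonneg _)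
      have a1 := abs_le.1 a0
      have a2 := nemPrim_le_sextic n x y
      have a3 := nemPrim_nonneg n x y
      have a4 : |nem n x y * y - 2 * nemPrim n x y| ≤ 2 * sextic x y := by
        rw [abs_le]; constructor <;> linarith [a1.1, a1.2, sextic_nonneg x y]
      rw [virialDensity, Real.norm_eq_abs, abs_mul, abs_of_pos (by linarith [one_le_halfDiv x])]
      refine (mul_le_mul (halfDiv_le x) a4 (abs_nonneg _) (by norm_num)).trans (le_of_eq (by ring))
    · have t := (((tendsto_nem x (Jet.val w x)).mul_const (Jet.val w x)).sub
        ((tendsto_nemPrim x (Jet.val w x)).const_mul 2)).const_mul (halfDiv x)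
      rw [quintic_mul_self] at t
      refine Tendsto.congr (fun n => rfl) (t.trans (le_of_eq ?_))
      congr 1; ring
  rw [tendsto_nhds_unique l1 l2, ← integral_const_mul]
  refine integral_mono_of_nonneg (Eventually.of_forall fun x => mul_nonneg (by norm_num) (sextic_nonneg x _)) ?_
    (Eventually.of_forall fun x => ?_)
  · refine (hs.const_mul (2 * (2 / 3))).mono' (continuous_halfDiv.aestronglyMeasurable.mul
      (hs.aestronglyMeasurable.const_mul _)) (Eventually.of_forall fun x => ?_)
    have p : 0 ≤ 2 / 3 * sextic x (Jet.val w x) := mul_nonneg (by norm_num) (sextic_nonneg x _)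
    rw [Real.norm_of_nonneg (mul_nonneg (by linarith [one_le_halfDiv x]) p)]
    nlinarith [halfDiv_le x]
  · exact le_mul_of_one_le_left (mul_nonneg (by norm_num) (sextic_nonneg x _)) (one_le_halfDiv x)

end Quintic

/-! ### Energy conservation and the spacetime bound for the quintic evolution. -/

section DefocusingEvolution

variable {m : BoundedContinuousFunction E3 ℝ} {J : Set ℝ} {U : ℝ → Jet} {v : ℝ → L2 ℝ}

/-- The energy of a state, conjugated to `L²(dx)`. -/
def jetEnergy (m : BoundedContinuousFunction E3 ℝ) (w : Jet) (y : L2 ℝ) : ℝ :=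
  1 / 2 * (‖y‖ ^ 2 + Jet.form m w w) + 1 / 6 * ∫ x, sextic x (Jet.val w x)

/-- A weak evolution driven by the quintic nonlinearity. -/
structure DefocusingEvolution (m : BoundedContinuousFunction E3 ℝ) (J : Set ℝ) (U : ℝ → Jet)
    (v : ℝ → L2 ℝ) : Prop where
  weak : WeakEvolution Jet.val (Jet.form m) (Jet.energySpace : Set Jet) J U v
    fun τ => quinticL2 (Jet.val (U τ))
  memLp : ∀ᵐ τ ∂volume.restrict J, MemLp (fun x => quintic x (Jet.val (U τ) x)) 2 (volume : Measure E3)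

namespace DefocusingEvolution

theorem ae_memLp (h : DefocusingEvolution m J U v) {a b : ℝ} (ha : a ∈ J) (hb : b ∈ J) :
    ∀ᵐ τ ∂volume.restrict (Set.Icc a b), MemLp (fun x => quintic x (Jet.val (U τ) x)) 2 (volume : Measure E3) :=
  ae_restrict_of_ae_restrict_of_subset (h.weak.Icc_subset ha hb) h.memLp

theorem continuousOn_val (h : DefocusingEvolution m J U v) {a b : ℝ} (ha : a ∈ J) (hb : b ∈ J) :
    ContinuousOn (fun τ => Jet.val (U τ)) (Set.Icc a b) :=
  Jet.val.continuous.comp_continuousOn (h.weak.continuous_state.mono (h.weak.Icc_subset ha hb))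

/-- The truncated potential energy is convex on `L²` with continuous gradient `nemL2 n`, so it can
be differentiated along a curve whose velocity is merely in `L²`. -/
theorem integral_nemPrim_sub (h : DefocusingEvolution m J U v) {a b : ℝ} (ha : a ∈ J) (hb : b ∈ J)
    (hab : a ≤ b) (n : ℕ) :
    (∫ x, nemPrim n x (Jet.val (U b) x)) - ∫ x, nemPrim n x (Jet.val (U a) x)
      = ∫ τ in a..b, inner ℝ (nemL2 n (Jet.val (U τ))) (v τ) := by
  have hJ := h.weak.Icc_subset ha hb
  have cv := h.weak.continuous_velocity.mono hJ
  have := convex_sub_eq_integral (G := fun f : L2 ℝ => ∫ x, nemPrim n x (f x)) hab (continuous_nemL2 n)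
      (inner_nemL2_le n) (h.continuousOn_val ha hb) cv fun s hs t ht => h.weak.state s (hJ hs) t (hJ ht)
  exact this

/-- Dominated convergence with majorant `‖v‖ ‖quinticL2‖`, integrable in time. Boundedness of the
sequence propagates finite potential energy, and its limit gives energy conservation. -/
theorem tendsto_integral_nemPrim_sub (h : DefocusingEvolution m J U v) {a b : ℝ} (ha : a ∈ J) (hb : b ∈ J)
    (hab : a ≤ b) :
    Tendsto (fun n => (∫ x, nemPrim n x (Jet.val (U b) x)) - ∫ x, nemPrim n x (Jet.val (U a) x)) atTop
      (𝓝 (∫ τ in a..b, inner ℝ (quinticL2 (Jet.val (U τ))) (v τ))) := by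
  have cU := h.continuousOn_val ha hb
  have cv := h.weak.continuous_velocity.mono (h.weak.Icc_subset ha hb)
  refine Tendsto.congr (fun n => (h.integral_nemPrim_sub ha hb hab n).symm) ?_
  have hg : ∀ᵐ τ : ℝ, τ ∈ Set.uIoc a b →
      MemLp (fun x => quintic x (Jet.val (U τ) x)) 2 (volume : Measure E3) := by
    rw [Set.uIoc_of_le hab]
    have := (ae_restrict_iff' measurableSet_Icc).1 (h.ae_memLp ha hb)
    filter_upwards [this] with τ hτ h' using hτ (Set.Ioc_subset_Icc_self h')
  have hI : IntervalIntegrable (fun τ => ‖v τ‖ * ‖quinticL2 (Jet.val (U τ))‖) volume a b :=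
    (h.weak.integrable_force a ha b hb).norm.continuousOn_mul (by rw [Set.uIcc_of_le hab]; exact cv.norm)
  refine intervalIntegral.tendsto_integral_filter_of_dominated_convergence
    (fun τ => ‖v τ‖ * ‖quinticL2 (Jet.val (U τ))‖) (Eventually.of_forall fun n => ?_)
    (Eventually.of_forall fun n => ?_) hI ?_
  · rw [Set.uIoc_of_le hab]
    exact ((((continuous_nemL2 n).comp_continuousOn cU).inner cv).mono
      Set.Ioc_subset_Icc_self).aestronglyMeasurable measurableSet_Ioc
  · filter_upwards [hg] with τ hτ h'
    refine (norm_inner_le_norm _ _).trans ((mul_le_mul_of_nonneg_right (norm_nemL2_le (hτ h') n)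
      (norm_nonneg _)).trans (le_of_eq (mul_comm _ _)))
  · filter_upwards [hg] with τ hτ h'
    exact (tendsto_nemL2 (hτ h')).inner tendsto_const_nhds

theorem integrable_sextic_of_bounded_sub {s t : ℝ} {c : ℝ}
    (hs : Integrable (fun x => sextic x (Jet.val (U s) x)))
    (hc : ∀ n, (∫ x, nemPrim n x (Jet.val (U t) x)) - ∫ x, nemPrim n x (Jet.val (U s) x) ≤ c) :
    Integrable (fun x => sextic x (Jet.val (U t) x)) := by
  refine integrable_sextic_of_bounded (c := c + ∫ x, 1 / 6 * sextic x (Jet.val (U s) x)) fun n => ?_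
  have := integral_mono (integrable_nemPrim n (Jet.val (U s))) (hs.const_mul (1 / 6))
    fun x => nemPrim_le_sextic n x _
  linarith [hc n]

/-- Finite potential energy propagates. -/
theorem integrable_sextic_of_integrable (h : DefocusingEvolution m J U v) {s t : ℝ} (hs : s ∈ J) (ht : t ∈ J)
    (hi : Integrable (fun x => sextic x (Jet.val (U s) x))) :
    Integrable (fun x => sextic x (Jet.val (U t) x)) := by
  rcases le_total s t with hst | hst
  -- A convergent sequence is bounded, so the truncated energies at time `t` are bounded uniformly
  -- in `n`, and Fatou applies.
  · obtain ⟨c, hc⟩ := (h.tendsto_integral_nemPrim_sub hs ht hst).bddAbove_range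
    exact integrable_sextic_of_bounded_sub hi fun n => hc ⟨n, rfl⟩
  · obtain ⟨c, hc⟩ := (h.tendsto_integral_nemPrim_sub ht hs hst).bddBelow_range
    refine integrable_sextic_of_bounded_sub (c := -c) hi fun n => ?_
    have : c ≤ _ := hc ⟨n, rfl⟩
    linarith

/-- Conservation of energy. -/
theorem jetEnergy_eq (h : DefocusingEvolution m J U v) {a b : ℝ} (ha : a ∈ J) (hb : b ∈ J) (hab : a ≤ b)
    (hi : Integrable (fun x => sextic x (Jet.val (U a) x))) :
    jetEnergy m (U b) (v b) = jetEnergy m (U a) (v a) := by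
  have h1 := h.weak.energy (Jet.form_symm m) (fun x hx y hy => sub_mem hx hy) ha hb hab
  have hi' := h.integrable_sextic_of_integrable ha hb hi
  have h2 := tendsto_nhds_unique (h.tendsto_integral_nemPrim_sub ha hb hab)
    ((tendsto_integral_nemPrim hi').sub (tendsto_integral_nemPrim hi))
  rw [h2] at h1
  rw [jetEnergy, jetEnergy]
  linarith

/-- Almost every time has its quintic term in `L²`, and an interval of positive length contains such
a time. Propagation then gives finite potential energy at all times. -/
theorem exists_integrable_sextic (h : DefocusingEvolution m J U v) {a b : ℝ} (ha : a ∈ J) (hb : b ∈ J) (hab : a < b) :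
    ∃ s ∈ J, Integrable (fun x => sextic x (Jet.val (U s) x)) := by
  have h0 : volume (Set.Icc a b) ≠ 0 := by simp [hab]
  have : NeBot (ae (volume.restrict (Set.Icc a b))) := by
    rw [ae_neBot]; intro h'; exact h0 (Measure.restrict_eq_zero.1 h')
  obtain ⟨s, hs, hs'⟩ := ((h.ae_memLp ha hb).and (ae_restrict_mem measurableSet_Icc)).exists
  exact ⟨s, h.weak.Icc_subset ha hb hs', integrable_sextic hs⟩

/-- The spacetime bound of Morawetz type. -/
theorem lintegral_sextic_le (h : DefocusingEvolution m J U v) {V : E3 → ℝ} (hV : ContDiff ℝ ∞ V)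
    (hm : ∀ x, m x = centrifugal x + V x) (hV0 : ∀ x, 0 ≤ V x) (hVe : ∀ x, euler V x ≤ 0)
    {a b t : ℝ} (ha : a ∈ J) (hb : b ∈ J) (ht : t ∈ J) (hab : a < b) :
    ∫⁻ τ in Set.Icc a b, ENNReal.ofReal (∫ x, sextic x (Jet.val (U τ) x))
      ≤ ENNReal.ofReal (3 * jetEnergy m (U t) (v t)) := by
  have hJ := h.weak.Icc_subset ha hb
  obtain ⟨s, hs, hsi⟩ := h.exists_integrable_sextic ha hb hab
  have hi : ∀ t ∈ J, Integrable (fun x => sextic x (Jet.val (U t) x)) := fun t ht =>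
    h.integrable_sextic_of_integrable hs ht hsi
  have hE : ∀ s ∈ J, jetEnergy m (U s) (v s) = jetEnergy m (U t) (v t) := fun s hs => by
    rcases le_total s t with h' | h'
    · exact (h.jetEnergy_eq hs ht h' (hi s hs)).symm
    · exact h.jetEnergy_eq ht hs h' (hi t ht)
  have hk : ∀ s ∈ J, 1 / 2 * (‖v s‖ ^ 2 + Jet.form m (U s) (U s)) ≤ jetEnergy m (U t) (v t) := fun s hs => by
    have : 0 ≤ ∫ x, sextic x (Jet.val (U s) x) := integral_nonneg fun x => sextic_nonneg x _
    rw [← hE s hs, jetEnergy]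
    linarith
  have hmor := Jet.morawetz hV hm hV0 hVe h.weak ha hb hab.le
  have hle : ∀ᵐ τ ∂volume.restrict (Set.Icc a b), (∫ x, sextic x (Jet.val (U τ) x))
      ≤ 3 / 2 * inner ℝ (quinticL2 (Jet.val (U τ))) (Jet.generator (U τ)) := by
    filter_upwards [h.ae_memLp ha hb, ae_restrict_mem measurableSet_Icc] with τ hτ hτ'
    linarith [integral_sextic_le (h.weak.mem τ (hJ hτ')) hτ]
  have cA : ContinuousOn (fun τ => Jet.generator (U τ)) (Set.Icc a b) :=
    Jet.generator.continuous.comp_continuousOn (h.weak.continuous_state.mono hJ)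
  have hI : IntegrableOn (fun τ => 3 / 2 * inner ℝ (quinticL2 (Jet.val (U τ))) (Jet.generator (U τ))) (Set.Icc a b) := by
    rw [integrableOn_Icc_iff_integrableOn_Ioc]
    exact ((intervalIntegrable_iff_integrableOn_Ioc_of_le hab.le).1
      ((h.weak.integrable_force a ha b hb).inner_continuousOn hab.le cA)).const_mul _
  refine (lintegral_mono_ae (hle.mono fun τ hτ => ENNReal.ofReal_le_ofReal hτ)).trans ?_
  rw [← ofReal_integral_eq_lintegral_ofReal hI
    (hle.mono fun τ hτ => (integral_nonneg fun x => sextic_nonneg x _).trans hτ)]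
  refine ENNReal.ofReal_le_ofReal ?_
  rw [integral_const_mul, integral_Icc_eq_integral_Ioc, ← intervalIntegral.integral_of_le hab.le]
  -- The Morawetz integral is at most the sum of the quadratic energies at `a` and `b`, hence at
  -- most `2 E`; the factor `3/2` makes this `3 E`.
  linarith [hk a ha, hk b hb]

end DefocusingEvolution

end DefocusingEvolution

/-! ### From the hyperbolic volume to Lebesgue measure. -/

section Volume

theorem vol_eq : vol = (volume : Measure E3).withDensity fun x => ENNReal.ofReal (rootDensity x ^ 2) := by
  simp only [vol, det_metric, rootDensity_sq]

theorem measurable_density : Measurable fun x : E3 => ENNReal.ofReal (rootDensity x ^ 2) :=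
  (contDiff_rootDensity.continuous.pow 2).measurable.ennreal_ofReal

theorem absolutelyContinuous_vol : (volume : Measure E3) ≪ vol := by
  rw [vol_eq]
  refine withDensity_absolutelyContinuous' measurable_density.aemeasurable (Eventually.of_forall fun x => ?_)
  exact (ENNReal.ofReal_pos.2 (pow_pos (rootDensity_pos x) 2)).ne'

instance : SFinite vol := by
  rw [vol_eq]; infer_instance

theorem integral_vol (f : E3 → ℝ) : ∫ x, f x ∂vol = ∫ x, rootDensity x ^ 2 * f x := by
  rw [vol_eq, integral_withDensity_eq_integral_toReal_smul measurable_density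
    (Eventually.of_forall fun x => ENNReal.ofReal_lt_top)]
  refine integral_congr_ae (Eventually.of_forall fun x => ?_)
  simp only [smul_eq_mul]
  rw [ENNReal.toReal_ofReal (sq_nonneg _)]

theorem lintegral_vol (f : E3 → ℝ≥0∞) :
    ∫⁻ x, f x ∂vol = ∫⁻ x, ENNReal.ofReal (rootDensity x ^ 2) * f x := by
  rw [vol_eq, lintegral_withDensity_eq_lintegral_mul_non_measurable _ measurable_density
    (Eventually.of_forall fun x => ENNReal.ofReal_lt_top)]
  rfl

theorem eLpNorm_pow_eq_lintegral {α E : Type*} [MeasurableSpace α] {μ : Measure α} [NormedAddCommGroup E]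
    (f : α → E) {n : ℕ} (hn : n ≠ 0) : eLpNorm f n μ ^ n = ∫⁻ x, ‖f x‖ₑ ^ n ∂μ := by
  have := eLpNorm_nnreal_pow_eq_lintegral (f := f) (μ := μ) (p := (n : NNReal)) (by exact_mod_cast hn)
  simpa using this

end Volume

/-! ### Conjugation of differentials and of the Dirichlet form. -/

section Conjugation

theorem cometric_eq (x : E3) (p q : Fin 3 → ℝ) :
    cometric x p q = inner ℝ (WithLp.toLp 2 p : E3) (WithLp.toLp 2 q)
      + inner ℝ x (WithLp.toLp 2 p) * inner ℝ x (WithLp.toLp 2 q) := by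
  simp only [cometric, inv_metric_apply, Fin.sum_univ_three, PiLp.inner_apply]
  simp
  ring

/-- The Euclidean gradient of `κ f` at a point where `f` has value `a` and differential `ξ`, with `κ` the
square root of the volume density. -/
def conjGrad (x : E3) (a : ℝ) (ξ : Fin 3 → ℝ) : E3 :=
  rootDensity x • ((WithLp.toLp 2 ξ : E3) - (1 / 2 * (1 + ‖x‖ ^ 2)⁻¹ * a) • x)

theorem conjGrad_add (x : E3) (a b : ℝ) (ξ η : Fin 3 → ℝ) :
    conjGrad x (a + b) (ξ + η) = conjGrad x a ξ + conjGrad x b η := by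
  simp only [conjGrad, WithLp.toLp_add, mul_add, add_smul, smul_add, smul_sub]
  abel

theorem conjGrad_sub (x : E3) (a b : ℝ) (ξ η : Fin 3 → ℝ) :
    conjGrad x (a - b) (ξ - η) = conjGrad x a ξ - conjGrad x b η := by
  simp only [conjGrad, WithLp.toLp_sub, mul_sub, sub_smul, smul_sub]
  abel

theorem grad_rootDensity_mul {φ : E3 → ℝ} (hφ : IsTest φ) (x : E3) :
    grad (fun y => rootDensity y * φ y) x = conjGrad x (φ x) (diff φ x) := by
  rw [grad_mul (hasFDerivAt_rootDensity x).differentiableAt (hφ.differentiableAt x), grad_rootDensity, conjGrad,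
    smul_sub, smul_smul, smul_smul, grad]
  rw [sub_eq_add_neg, ← neg_smul]
  congr 2
  ring

/-- Insert `κ ξ = conjGrad + (½ (1 + ‖x‖²)⁻¹ κ a) x` into `cometric_eq` and expand. The cross terms
are deliberately not integrated by parts: the identity is then pointwise and applies to weak
differentials. -/
theorem conj_form (x : E3) (a b : ℝ) (ξ η : Fin 3 → ℝ) :
    rootDensity x ^ 2 * cometric x ξ η = inner ℝ (conjGrad x a ξ) (conjGrad x b η)
      + inner ℝ x (conjGrad x a ξ) * inner ℝ x (conjGrad x b η)
      + 1 / 2 * (inner ℝ x (conjGrad x a ξ) * (rootDensity x * b) + rootDensity x * a * inner ℝ x (conjGrad x b η))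
      + centrifugal x * (rootDensity x * a) * (rootDensity x * b) := by
  have hp := (one_add_norm_sq_pos x).ne'
  have c := real_inner_comm x (WithLp.toLp 2 ξ : E3)
  simp only [cometric_eq, conjGrad, inner_smul_left, inner_smul_right, inner_sub_left, inner_sub_right,
    conj_trivial, real_inner_self_eq_norm_sq, centrifugal, c]
  field_simp
  ring

/-- With `X` the radial component and `A = κ a`, the term `a²` completes the cross term: `X² + X A +
A² = ½ (X² + A²) + ½ (X + A)²`. Hence the `H¹` norm controls all three components of the jet. -/
theorem conj_form_lower (x : E3) (a : ℝ) (ξ : Fin 3 → ℝ) :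
    ‖conjGrad x a ξ‖ ^ 2 + 1 / 2 * ((inner ℝ x (conjGrad x a ξ)) ^ 2 + (rootDensity x * a) ^ 2)
      ≤ rootDensity x ^ 2 * (a ^ 2 + cometric x ξ ξ) := by
  rw [mul_add (rootDensity x ^ 2), conj_form x a a ξ ξ, real_inner_self_eq_norm_sq]
  nlinarith [sq_nonneg (inner ℝ x (conjGrad x a ξ) + rootDensity x * a), mul_nonneg (centrifugal_nonneg x)
    (sq_nonneg (rootDensity x * a))]

theorem aestronglyMeasurable_conjGrad {f : E3 → ℝ} {p : E3 → Fin 3 → ℝ} (hf : AEStronglyMeasurable f volume)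
    (hp : AEStronglyMeasurable p volume) : AEStronglyMeasurable (fun x => conjGrad x (f x) (p x)) volume := by
  refine contDiff_rootDensity.continuous.aestronglyMeasurable.smul (AEStronglyMeasurable.sub ?_ ?_)
  · exact (PiLp.continuous_toLp 2 _).comp_aestronglyMeasurable hp
  · exact (AEStronglyMeasurable.mul
      (continuous_const.mul contDiff_radial_inv.continuous).aestronglyMeasurable hf).smul aestronglyMeasurable_id

end Conjugation

namespace Jet

/-- `w` is the jet of `κ f` for a function `f` with differential `p`. -/
def IsConj (w : Jet) (f : E3 → ℝ) (p : E3 → Fin 3 → ℝ) : Prop :=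
  val w =ᵐ[volume] (fun x => rootDensity x * f x) ∧ gradient w =ᵐ[volume] (fun x => conjGrad x (f x) (p x))
    ∧ radial w =ᵐ[volume] fun x => inner ℝ x (conjGrad x (f x) (p x))

theorem IsJet.isConj {w : Jet} {φ : E3 → ℝ} (hφ : IsTest φ) (h : IsJet w (fun x => rootDensity x * φ x)) :
    IsConj w φ (diff φ) := by
  refine ⟨h.1, h.2.1.trans (Eventually.of_forall fun x => grad_rootDensity_mul hφ x),
    h.2.2.trans (Eventually.of_forall fun x => ?_)⟩
  simp only []
  rw [euler_eq_inner, grad_rootDensity_mul hφ]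

theorem IsConj.add {w z : Jet} {f h : E3 → ℝ} {p q : E3 → Fin 3 → ℝ} (hw : IsConj w f p) (hz : IsConj z h q) :
    IsConj (w + z) (fun x => f x + h x) (fun x => p x + q x) := by
  refine ⟨?_, ?_, ?_⟩
  · rw [map_add]
    filter_upwards [Lp.coeFn_add (val w) (val z), hw.1, hz.1] with x a b c
    rw [a, Pi.add_apply, b, c, mul_add]
  · rw [map_add]
    filter_upwards [Lp.coeFn_add (gradient w) (gradient z), hw.2.1, hz.2.1] with x a b c
    rw [a, Pi.add_apply, b, c, conjGrad_add]
  · rw [map_add]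
    filter_upwards [Lp.coeFn_add (radial w) (radial z), hw.2.2, hz.2.2] with x a b c
    rw [a, Pi.add_apply, b, c, conjGrad_add, inner_add_right]

theorem IsConj.sub {w z : Jet} {f h : E3 → ℝ} {p q : E3 → Fin 3 → ℝ} (hw : IsConj w f p) (hz : IsConj z h q) :
    IsConj (w - z) (fun x => f x - h x) (fun x => p x - q x) := by
  refine ⟨?_, ?_, ?_⟩
  · rw [map_sub]
    filter_upwards [Lp.coeFn_sub (val w) (val z), hw.1, hz.1] with x a b c
    rw [a, Pi.sub_apply, b, c, mul_sub]
  · rw [map_sub]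
    filter_upwards [Lp.coeFn_sub (gradient w) (gradient z), hw.2.1, hz.2.1] with x a b c
    rw [a, Pi.sub_apply, b, c, conjGrad_sub]
  · rw [map_sub]
    filter_upwards [Lp.coeFn_sub (radial w) (radial z), hw.2.2, hz.2.2] with x a b c
    rw [a, Pi.sub_apply, b, c, conjGrad_sub, inner_sub_right]

end Jet

/-! ### Functions of class `H¹` as elements of the energy space. -/

section H1

/-- The squared `H¹` norm. -/
def h1Sq (f : E3 → ℝ) (p : E3 → Fin 3 → ℝ) : ℝ≥0∞ :=
  ∫⁻ x, ENNReal.ofReal (f x ^ 2 + cometric x (p x) (p x)) ∂vol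

theorem lintegral_le_h1Sq {F : Type*} [NormedAddCommGroup F] {f : E3 → ℝ} {p : E3 → Fin 3 → ℝ} {g : E3 → F}
    (h : ∀ x, ‖g x‖ ^ 2 ≤ 2 * (rootDensity x ^ 2 * (f x ^ 2 + cometric x (p x) (p x)))) :
    ∫⁻ x, ENNReal.ofReal (‖g x‖ ^ 2) ≤ 2 * h1Sq f p := by
  rw [h1Sq, lintegral_vol, ← lintegral_const_mul' _ _ (by simp)]
  refine lintegral_mono fun x => ?_
  rw [← ENNReal.ofReal_mul (sq_nonneg _)]
  rw [show (2 : ℝ≥0∞) = ENNReal.ofReal 2 by simp, ← ENNReal.ofReal_mul (by norm_num)]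
  exact ENNReal.ofReal_le_ofReal (h x)

theorem memLp_of_lintegral_sq {F : Type*} [NormedAddCommGroup F] {g : E3 → F}
    (hg : AEStronglyMeasurable g volume) (h : ∫⁻ x, ENNReal.ofReal (‖g x‖ ^ 2) < ⊤) : MemLp g 2 volume := by
  rw [memLp_two_iff_integrable_sq_norm hg]
  refine ⟨hg.norm.pow 2, ?_⟩
  rw [hasFiniteIntegral_iff_ofReal (Eventually.of_forall fun x => by positivity)]
  exact h

theorem ofReal_norm_sq {F : Type*} [NormedAddCommGroup F] [InnerProductSpace ℝ F] {y : L2 F} {g : E3 → F}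
    (h : y =ᵐ[volume] g) : ENNReal.ofReal (‖y‖ ^ 2) = ∫⁻ x, ENNReal.ofReal (‖g x‖ ^ 2) := by
  have hg := (memLp_congr_ae h).1 (Lp.memLp y)
  rw [norm_sq_eq_integral h, ofReal_integral_eq_lintegral_ofReal
    ((memLp_two_iff_integrable_sq_norm hg.aestronglyMeasurable).1 hg) (Eventually.of_forall fun x => by positivity)]

variable {f : E3 → ℝ} {p : E3 → Fin 3 → ℝ}

theorem norm_val_sq_le_density (x : E3) :
    ‖rootDensity x * f x‖ ^ 2 ≤ 2 * (rootDensity x ^ 2 * (f x ^ 2 + cometric x (p x) (p x))) := by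
  have := conj_form_lower x (f x) (p x)
  rw [Real.norm_eq_abs, sq_abs]
  nlinarith [sq_nonneg ‖conjGrad x (f x) (p x)‖, sq_nonneg (inner ℝ x (conjGrad x (f x) (p x)))]

theorem norm_gradient_sq_le_density (x : E3) :
    ‖conjGrad x (f x) (p x)‖ ^ 2 ≤ 2 * (rootDensity x ^ 2 * (f x ^ 2 + cometric x (p x) (p x))) := by
  have := conj_form_lower x (f x) (p x)
  nlinarith [sq_nonneg ‖conjGrad x (f x) (p x)‖, sq_nonneg (inner ℝ x (conjGrad x (f x) (p x))),
    sq_nonneg (rootDensity x * f x)]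

theorem norm_radial_sq_le_density (x : E3) :
    ‖inner ℝ x (conjGrad x (f x) (p x))‖ ^ 2
      ≤ 2 * (rootDensity x ^ 2 * (f x ^ 2 + cometric x (p x) (p x))) := by
  have := conj_form_lower x (f x) (p x)
  rw [Real.norm_eq_abs, sq_abs]
  nlinarith [sq_nonneg ‖conjGrad x (f x) (p x)‖, sq_nonneg (rootDensity x * f x)]

theorem exists_isConj_of_h1Sq (hf : AEStronglyMeasurable f volume) (hp : AEStronglyMeasurable p volume)
    (h : h1Sq f p < ⊤) : ∃ w, Jet.IsConj w f p := by
  have ht : 2 * h1Sq f p < ⊤ := ENNReal.mul_lt_top (by simp) h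
  have mc := aestronglyMeasurable_conjGrad hf hp
  have m1 := memLp_of_lintegral_sq (contDiff_rootDensity.continuous.aestronglyMeasurable.mul hf)
    ((lintegral_le_h1Sq norm_val_sq_le_density).trans_lt ht)
  have m2 := memLp_of_lintegral_sq mc ((lintegral_le_h1Sq norm_gradient_sq_le_density).trans_lt ht)
  have m3 := memLp_of_lintegral_sq (aestronglyMeasurable_id.inner mc)
    ((lintegral_le_h1Sq norm_radial_sq_le_density).trans_lt ht)
  exact ⟨(m1.toLp, m2.toLp, m3.toLp), m1.coeFn_toLp, m2.coeFn_toLp, m3.coeFn_toLp⟩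

theorem Jet.IsConj.norm_sq_le {w : Jet} (h : Jet.IsConj w f p) : ENNReal.ofReal (‖w‖ ^ 2) ≤ 2 * h1Sq f p := by
  have e1 := (ofReal_norm_sq h.1).le.trans (lintegral_le_h1Sq (norm_val_sq_le_density (p := p)))
  have e2 := (ofReal_norm_sq h.2.1).le.trans (lintegral_le_h1Sq norm_gradient_sq_le_density)
  have e3 := (ofReal_norm_sq h.2.2).le.trans (lintegral_le_h1Sq norm_radial_sq_le_density)
  have hn : ‖w‖ = max ‖Jet.val w‖ (max ‖Jet.gradient w‖ ‖Jet.radial w‖) := rfl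
  rcases max_choice ‖Jet.val w‖ (max ‖Jet.gradient w‖ ‖Jet.radial w‖) with h1 | h1
  · rw [hn, h1]; exact e1
  · rw [hn, h1]
    rcases max_choice ‖Jet.gradient w‖ ‖Jet.radial w‖ with h2 | h2
    · rw [h2]; exact e2
    · rw [h2]; exact e3

theorem Jet.IsConj.norm_sub_sq_le {w z : Jet} {h : E3 → ℝ} {q : E3 → Fin 3 → ℝ} (hw : Jet.IsConj w f p)
    (hz : Jet.IsConj z h q) : ENNReal.ofReal (‖w - z‖ ^ 2) ≤ 2 * h1DistSq f p h q :=
  (hw.sub hz).norm_sq_le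

theorem exists_test_jet {φ : E3 → ℝ} (hφ : IsTest φ) : ∃ z ∈ Jet.testJets, Jet.IsConj z φ (diff φ) := by
  have hκ := hφ.mul_left contDiff_rootDensity
  obtain ⟨z, hz⟩ := Jet.exists_isJet hκ
  exact ⟨z, ⟨_, hκ, hz⟩, hz.isConj hφ⟩

theorem continuous_diff {φ : E3 → ℝ} (hφ : IsTest φ) : Continuous (diff φ) :=
  continuous_pi fun _ => (hφ.fderiv_apply _).continuous

/-- Functions of class `H¹(ℍ³)` have jets in the energy space. -/
theorem IsH1.exists_isConj (h : IsH1 f p) : ∃ w ∈ Jet.energySpace, Jet.IsConj w f p := by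
  have mf : AEStronglyMeasurable f volume := h.meas.mono_ac absolutelyContinuous_vol
  have mp : AEStronglyMeasurable p volume := h.meas_diff.mono_ac absolutelyContinuous_vol
  obtain ⟨φ, hφ, h1⟩ := h.approx 1 one_pos
  obtain ⟨z, hz, hzc⟩ := exists_test_jet hφ
  -- A single approximation at finite distance shows that `f - φ` has finite `H¹` norm and therefore
  -- a jet `y`; adding the jet of `φ` gives that of `f`.
  obtain ⟨y, hy⟩ := exists_isConj_of_h1Sq (mf.sub hφ.continuous.aestronglyMeasurable)
    (mp.sub (continuous_diff hφ).aestronglyMeasurable) (h1.trans_le le_top)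
  have hw : Jet.IsConj (y + z) f p := by
    have := hy.add hzc
    simpa using this
  refine ⟨y + z, ?_, hw⟩
  have hc : y + z ∈ closure (Jet.testJets : Set Jet) := by
    rw [Metric.mem_closure_iff]
    intro ε hε
    obtain ⟨χ, hχ, h2⟩ := h.approx (ENNReal.ofReal (ε ^ 2 / 2)) (ENNReal.ofReal_pos.2 (by positivity))
    obtain ⟨z', hz', hzc'⟩ := exists_test_jet hχ
    refine ⟨z', hz', ?_⟩
    have h3 := hw.norm_sub_sq_le hzc'
    have h4 : ENNReal.ofReal (‖y + z - z'‖ ^ 2) < ENNReal.ofReal (ε ^ 2) := by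
      refine h3.trans_lt ?_
      have : ENNReal.ofReal (ε ^ 2) = 2 * ENNReal.ofReal (ε ^ 2 / 2) := by
        rw [show (2 : ℝ≥0∞) = ENNReal.ofReal 2 by simp, ← ENNReal.ofReal_mul (by norm_num)]
        congr 1; ring
      rw [this]
      exact (ENNReal.mul_lt_mul_iff_right (by simp) (by simp)).2 h2
    rw [dist_eq_norm]
    exact lt_of_pow_lt_pow_left₀ 2 hε.le (ENNReal.ofReal_lt_ofReal_iff_of_nonneg (by positivity) |>.1 h4)
  exact hc

end H1

/-! ### Hyperbolic integrals as pairings of jets. -/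

section Pairings

attribute [local irreducible] Jet.val Jet.gradient Jet.radial Jet.form

theorem inner_eq_integral_vol {y z : L2 ℝ} {f h : E3 → ℝ} (hy : y =ᵐ[volume] fun x => rootDensity x * f x)
    (hz : z =ᵐ[volume] fun x => rootDensity x * h x) : ∫ x, f x * h x ∂vol = inner ℝ y z := by
  rw [integral_vol, inner_eq_integral hy hz]
  congr 1; ext x; ring

variable {w z : Jet} {f h : E3 → ℝ} {p q : E3 → Fin 3 → ℝ} {m : BoundedContinuousFunction E3 ℝ} {V : E3 → ℝ}

theorem Jet.IsConj.density_ae_eq (hm : ∀ x, m x = centrifugal x + V x) (hw : Jet.IsConj w f p) (hz : Jet.IsConj z h q) :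
    (fun x => inner ℝ (gradient w x) (gradient z x) + radial w x * radial z x
        + 1 / 2 * (radial w x * val z x + val w x * radial z x) + m x * val w x * val z x)
      =ᵐ[volume] fun x => rootDensity x ^ 2 * (cometric x (p x) (q x) + V x * f x * h x) := by
  filter_upwards [hw.1, hw.2.1, hw.2.2, hz.1, hz.2.1, hz.2.2] with x a b c d e g
  have := conj_form x (f x) (h x) (p x) (q x)
  rw [a, b, c, d, e, g, hm]
  linarith

theorem integrable_density (m : BoundedContinuousFunction E3 ℝ) (w z : Jet) :
    Integrable (fun x => inner ℝ (Jet.gradient w x) (Jet.gradient z x)) ∧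
    Integrable (fun x => Jet.radial w x * Jet.radial z x) ∧
    Integrable (fun x => 1 / 2 * (Jet.radial w x * Jet.val z x + Jet.val w x * Jet.radial z x)) ∧
    Integrable (fun x => m x * Jet.val w x * Jet.val z x) := by
  refine ⟨L2.integrable_inner _ _, (Lp.memLp _).integrable_mul (Lp.memLp _),
    Integrable.const_mul (Integrable.add ((Lp.memLp _).integrable_mul (Lp.memLp _))
      ((Lp.memLp _).integrable_mul (Lp.memLp _))) _, ?_⟩
  exact (memLp_mul_bounded m (Lp.memLp _)).integrable_mul (Lp.memLp _)

theorem integrable_form_density (hm : ∀ x, m x = centrifugal x + V x) (hw : Jet.IsConj w f p) (hz : Jet.IsConj z h q) :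
    Integrable (fun x => rootDensity x ^ 2 * (cometric x (p x) (q x) + V x * f x * h x)) := by
  obtain ⟨i1, i2, i3, i4⟩ := integrable_density m w z
  exact (((i1.add i2).add i3).add i4).congr (hw.density_ae_eq hm hz)

theorem inner_eq_integral_coe (y z : L2 ℝ) : inner ℝ y z = ∫ x, y x * z x :=
  inner_eq_integral (EventuallyEq.refl _ (y : E3 → ℝ)) (EventuallyEq.refl _ (z : E3 → ℝ))

theorem integral_add_add_add {A B C D : E3 → ℝ} (iA : Integrable A) (iB : Integrable B) (iC : Integrable C)
    (iD : Integrable D) :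
    ∫ x, (A x + B x + C x + D x) = (∫ x, A x) + (∫ x, B x) + (∫ x, C x) + ∫ x, D x := by
  have iAB : Integrable (fun x => A x + B x) := iA.add iB
  have iABC : Integrable (fun x => A x + B x + C x) := iAB.add iC
  rw [integral_add iABC iD, integral_add iAB iC, integral_add iA iB]

theorem integral_cross_terms (w z : Jet) :
    ∫ x, 1 / 2 * (Jet.radial w x * Jet.val z x + Jet.val w x * Jet.radial z x)
      = 1 / 2 * (inner ℝ (Jet.radial w) (Jet.val z) + inner ℝ (Jet.val w) (Jet.radial z)) := by
  have j1 : Integrable (fun x => Jet.radial w x * Jet.val z x) := (Lp.memLp _).integrable_mul (Lp.memLp _)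
  have j2 : Integrable (fun x => Jet.val w x * Jet.radial z x) := (Lp.memLp _).integrable_mul (Lp.memLp _)
  have e1 := inner_eq_integral_coe (Jet.radial w) (Jet.val z)
  have e2 := inner_eq_integral_coe (Jet.val w) (Jet.radial z)
  rw [integral_const_mul, integral_add j1 j2, ← e1, ← e2]

theorem form_eq_integral_density (m : BoundedContinuousFunction E3 ℝ) (w z : Jet) :
    Jet.form m w z = ∫ x, (inner ℝ (Jet.gradient w x) (Jet.gradient z x) + Jet.radial w x * Jet.radial z x
        + 1 / 2 * (Jet.radial w x * Jet.val z x + Jet.val w x * Jet.radial z x) + m x * Jet.val w x * Jet.val z x) := by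
  obtain ⟨i1, i2, i3, i4⟩ := integrable_density m w z
  refine Eq.trans ?_ (integral_add_add_add i1 i2 i3 i4).symm
  have e1 : inner ℝ (Jet.gradient w) (Jet.gradient z) = ∫ x, inner ℝ (Jet.gradient w x) (Jet.gradient z x) :=
    L2.inner_def _ _
  have e2 := inner_eq_integral_coe (Jet.radial w) (Jet.radial z)
  have e3 := inner_mulL2 m (Jet.val w) (Jet.val z)
  have e4 := integral_cross_terms w z
  have e5 := Jet.form_apply m w z
  linarith

theorem form_eq_integral (hm : ∀ x, m x = centrifugal x + V x) (hw : Jet.IsConj w f p) (hz : Jet.IsConj z h q) :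
    Jet.form m w z = ∫ x, rootDensity x ^ 2 * (cometric x (p x) (q x) + V x * f x * h x) :=
  (form_eq_integral_density m w z).trans (integral_congr_ae (hw.density_ae_eq hm hz))

theorem quintic_rootDensity_mul (x : E3) (a : ℝ) : quintic x (rootDensity x * a) = rootDensity x * a ^ 5 := by
  rw [quintic, ← mul_assoc, inv_mul_cancel₀ (rootDensity_pos x).ne', one_mul]

theorem sextic_rootDensity_mul (x : E3) (a : ℝ) : sextic x (rootDensity x * a) = rootDensity x ^ 2 * a ^ 6 := by
  rw [sextic, ← mul_assoc, inv_mul_cancel₀ (rootDensity_pos x).ne', one_mul]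

theorem quintic_ae_eq (hw : Jet.IsConj w f p) :
    (fun x => quintic x (Jet.val w x)) =ᵐ[volume] fun x => rootDensity x * f x ^ 5 := by
  filter_upwards [hw.1] with x a
  rw [a, quintic_rootDensity_mul]

theorem integral_sextic_eq (hw : Jet.IsConj w f p) : ∫ x, sextic x (Jet.val w x) = ∫ x, |f x| ^ 6 ∂vol := by
  rw [integral_vol]
  refine integral_congr_ae ?_
  filter_upwards [hw.1] with x a
  rw [a, sextic_rootDensity_mul, Even.pow_abs (by decide)]

theorem weak_equation_rhs (hm : ∀ x, m x = centrifugal x + V x) (hw : Jet.IsConj w f p) (hz : Jet.IsConj z h q)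
    (hN : MemLp (fun x => quintic x (Jet.val w x)) 2 (volume : Measure E3)) :
    ∫ x, (cometric x (p x) (q x) + V x * f x * h x + |f x| ^ 4 * f x * h x) ∂vol
      = Jet.form m w z + inner ℝ (quinticL2 (Jet.val w)) (Jet.val z) := by
  have e : (fun x => quinticL2 (Jet.val w) x * Jet.val z x)
      =ᵐ[volume] fun x => rootDensity x ^ 2 * (|f x| ^ 4 * f x * h x) := by
    filter_upwards [coeFn_quinticL2 hN, quintic_ae_eq hw, hz.1] with x a b c
    rw [a, b, c, Even.pow_abs (by decide)]
    ring
  have i1 := integrable_form_density hm hw hz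
  have i2 : Integrable (fun x => quinticL2 (Jet.val w) x * Jet.val z x) := (Lp.memLp _).integrable_mul (Lp.memLp _)
  rw [form_eq_integral hm hw hz,
    inner_eq_integral_coe,
    integral_congr_ae e, ← integral_add i1 (i2.congr e), integral_vol]
  congr 1; ext x; ring

theorem energy_eq_jetEnergy (hm : ∀ x, m x = centrifugal x + V x) (hw : Jet.IsConj w f p) {g : E3 → ℝ} {y : L2 ℝ}
    (hy : y =ᵐ[volume] fun x => rootDensity x * g x) : energy V f p g = jetEnergy m w y := by
  have e : (fun x => y x * y x) =ᵐ[volume] fun x => rootDensity x ^ 2 * g x ^ 2 := by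
    filter_upwards [hy] with x a
    rw [a]; ring
  have i1 := integrable_form_density hm hw hw
  have i2 : Integrable (fun x => y x * y x) := (Lp.memLp _).integrable_mul (Lp.memLp _)
  rw [energy, jetEnergy, integral_sextic_eq hw, form_eq_integral hm hw hw, ← real_inner_self_eq_norm_sq,
    inner_eq_integral_coe, integral_congr_ae e,
    ← integral_add (i2.congr e) i1, integral_vol]
  congr 3
  ext x; ring

/-- The `L¹⁰` norm controls the nonlinearity. -/
theorem eLpNorm_quintic (hw : Jet.IsConj w f p) :
    eLpNorm (fun x => quintic x (Jet.val w x)) 2 volume = eLpNorm f 10 vol ^ 5 := by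
  have h1 := eLpNorm_pow_eq_lintegral (μ := (volume : Measure E3)) (fun x => rootDensity x * f x ^ 5) (n := 2) (by simp)
  have h2 := eLpNorm_pow_eq_lintegral (μ := vol) f (n := 10) (by simp)
  rw [lintegral_vol] at h2
  rw [eLpNorm_congr_ae (quintic_ae_eq hw)]
  have e : ∀ x, ‖rootDensity x * f x ^ 5‖ₑ ^ 2 = ENNReal.ofReal (rootDensity x ^ 2) * ‖f x‖ₑ ^ 10 := fun x => by
    rw [enorm_mul, enorm_pow, mul_pow, ← pow_mul, Real.enorm_of_nonneg (rootDensity_pos x).le,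
      ← ENNReal.ofReal_pow (rootDensity_pos x).le]
  simp only [e] at h1
  rw [← h2] at h1
  have h3 : eLpNorm (fun x => rootDensity x * f x ^ 5) 2 volume ^ 2 = (eLpNorm f 10 vol ^ 5) ^ 2 := by
    rw [← pow_mul]; exact_mod_cast h1
  exact (ENNReal.pow_right_strictMono (n := 2) (by simp)).injective h3

theorem eLpNorm_rootDensity_mul (g : E3 → ℝ) :
    eLpNorm (fun x => rootDensity x * g x) 2 volume = eLpNorm g 2 vol := by
  have h1 := eLpNorm_pow_eq_lintegral (μ := (volume : Measure E3)) (fun x => rootDensity x * g x) (n := 2) (by simp)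
  have h2 := eLpNorm_pow_eq_lintegral (μ := vol) g (n := 2) (by simp)
  rw [lintegral_vol] at h2
  have e : ∀ x, ‖rootDensity x * g x‖ₑ ^ 2 = ENNReal.ofReal (rootDensity x ^ 2) * ‖g x‖ₑ ^ 2 := fun x => by
    rw [enorm_mul, mul_pow, Real.enorm_of_nonneg (rootDensity_pos x).le,
      ← ENNReal.ofReal_pow (rootDensity_pos x).le]
  simp only [e] at h1
  rw [← h2] at h1
  exact (ENNReal.pow_right_strictMono (n := 2) (by simp)).injective (by exact_mod_cast h1)

theorem memLp_rootDensity_mul {g : E3 → ℝ} (hg : MemLp g 2 vol) :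
    MemLp (fun x => rootDensity x * g x) 2 (volume : Measure E3) :=
  ⟨contDiff_rootDensity.continuous.aestronglyMeasurable.mul
    (hg.aestronglyMeasurable.mono_ac absolutelyContinuous_vol), by rw [eLpNorm_rootDensity_mul]; exact hg.2⟩

theorem memLp_quintic (hw : Jet.IsConj w f p) (h : eLpNorm f 10 vol < ⊤) :
    MemLp (fun x => quintic x (Jet.val w x)) 2 (volume : Measure E3) :=
  ⟨aestronglyMeasurable_quintic (Lp.aestronglyMeasurable _), by
    rw [eLpNorm_quintic hw]; exact ENNReal.pow_lt_top h⟩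

theorem enorm_quinticL2_le (hw : Jet.IsConj w f p) : ‖quinticL2 (Jet.val w)‖ₑ ≤ eLpNorm f 10 vol ^ 5 := by
  rw [← eLpNorm_quintic hw]
  by_cases h : MemLp (fun x => quintic x (Jet.val w x)) 2 (volume : Measure E3)
  · rw [Lp.enorm_def, eLpNorm_congr_ae (coeFn_quinticL2 h)]
  · rw [quinticL2, dif_neg h, enorm_zero]; exact zero_le

end Pairings

/-! ### Integrating derivatives on order connected sets. -/

section RealLine

variable {J : Set ℝ}

/-- `F` is differentiable everywhere, but its derivative is identified with `g` only almost
everywhere, as for the weak equation, where the quintic term is known to be in `L²` only at almost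
every time. Integrability of the derivative suffices for the fundamental theorem. -/
theorem sub_eq_integral_of_hasDerivWithinAt (hJ : J.OrdConnected) {F F' g : ℝ → ℝ}
    (hF : ∀ t ∈ J, HasDerivWithinAt F (F' t) J t) {s t : ℝ} (hs : s ∈ J) (ht : t ∈ J)
    (hg : IntervalIntegrable g volume s t) (he : ∀ᵐ τ ∂volume.restrict (Set.uIcc s t), F' τ = g τ) :
    F t - F s = ∫ τ in s..t, g τ := by
  have hst : Set.uIcc s t ⊆ J := hJ.uIcc_subset hs ht
  have he' : ∀ᵐ τ ∂volume.restrict (Set.uIoc s t), g τ = F' τ :=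
    (ae_restrict_of_ae_restrict_of_subset Set.uIoc_subset_uIcc he).mono fun τ h => h.symm
  have hF' : IntervalIntegrable F' volume s t := hg.congr_ae he'
  rw [intervalIntegral.integral_congr_ae_restrict he', intervalIntegral.integral_eq_sub_of_hasDeriv_right
    (fun τ hτ => (hF τ (hst hτ)).continuousWithinAt.mono hst) (fun τ hτ => ?_) hF']
  have hn : J ∈ 𝓝 τ := mem_of_superset (Icc_mem_nhds hτ.1 hτ.2) hst
  exact ((hF τ (mem_of_mem_nhds hn)).hasDerivAt hn).hasDerivWithinAt

/-- Order connected sets are exhausted by compact intervals. -/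
theorem exists_iUnion_Icc_eq (hJ : J.OrdConnected) (hne : J.Nonempty) :
    ∃ a b : ℕ → ℝ, (∀ n, a n ∈ J) ∧ (∀ n, b n ∈ J) ∧ Monotone (fun n => Set.Icc (a n) (b n)) ∧
      ⋃ n, Set.Icc (a n) (b n) = J := by
  have : Nonempty J := hne.to_subtype
  have := hJ
  obtain ⟨y, hy, hyt⟩ := exists_seq_monotone_tendsto_atTop_atTop J
  obtain ⟨x, hx, hxt⟩ := exists_seq_antitone_tendsto_atTop_atBot J
  refine ⟨fun n => x n, fun n => y n, fun n => (x n).2, fun n => (y n).2,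
    fun m n h => Set.Icc_subset_Icc (hx h) (hy h), Set.Subset.antisymm
      (Set.iUnion_subset fun n => hJ.out (x n).2 (y n).2) fun t ht => ?_⟩
  obtain ⟨n, h1, h2⟩ := ((hxt.eventually_le_atBot ⟨t, ht⟩).and (hyt.eventually_ge_atTop ⟨t, ht⟩)).exists
  exact Set.mem_iUnion.2 ⟨n, h1, h2⟩

end RealLine

/-! ### From weak solutions on hyperbolic space to the abstract evolution. -/

namespace IsSolution

variable {V : E3 → ℝ} {J : Set ℝ} {u : ℝ → E3 → ℝ} {p : ℝ → E3 → Fin 3 → ℝ} {v : ℝ → E3 → ℝ}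
  {U : ℝ → Jet} {y : ℝ → L2 ℝ}

theorem continuousOn_state (h : IsSolution V J u p v) (hU : ∀ t ∈ J, Jet.IsConj (U t) (u t) (p t)) :
    ContinuousOn U J := by
  intro t ht
  rw [ContinuousWithinAt, tendsto_iff_norm_sub_tendsto_zero]
  have h1 : Tendsto (fun s => 2 * h1DistSq (u s) (p s) (u t) (p t)) (𝓝[J] t) (𝓝 0) := by
    simpa using ENNReal.Tendsto.const_mul (h.cont_u t ht) (Or.inr (by simp : (2 : ℝ≥0∞) ≠ ⊤))
  have h2 : Tendsto (fun s => ENNReal.ofReal (‖U s - U t‖ ^ 2)) (𝓝[J] t) (𝓝 0) := by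
    refine tendsto_of_tendsto_of_tendsto_of_le_of_le' tendsto_const_nhds h1 (Eventually.of_forall fun _ => zero_le) ?_
    filter_upwards [self_mem_nhdsWithin] with s hs
    exact (hU s hs).norm_sub_sq_le (hU t ht)
  have h3 := (ENNReal.tendsto_toReal (by simp)).comp h2
  have h4 := (Real.continuous_sqrt.tendsto _).comp h3
  simpa [Function.comp_def, ENNReal.toReal_ofReal, Real.sqrt_sq] using h4

theorem continuousOn_velocity (h : IsSolution V J u p v)
    (hy : ∀ t ∈ J, y t =ᵐ[volume] fun x => rootDensity x * v t x) : ContinuousOn y J := by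
  intro t ht
  rw [ContinuousWithinAt, tendsto_iff_edist_tendsto_0]
  refine (h.cont_v t ht).congr' ?_
  filter_upwards [self_mem_nhdsWithin] with s hs
  rw [← eLpNorm_rootDensity_mul, Lp.edist_def]
  refine eLpNorm_congr_ae ?_
  filter_upwards [hy s hs, hy t ht] with x a b
  rw [Pi.sub_apply, Pi.sub_apply, a, b, mul_sub]

theorem aemeasurable_eLpNorm (h : IsSolution V J u p v) :
    AEMeasurable (fun t => eLpNorm (u t) 10 vol ^ 5) (volume.restrict J) := by
  have h1 := ((h.meas.enorm.pow_const 10).lintegral_prod_right').pow_const (1 / 2 : ℝ)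
  refine h1.congr (Eventually.of_forall fun t => ?_)
  have h2 := eLpNorm_pow_eq_lintegral (μ := vol) (u t) (n := 10) (by simp)
  change (∫⁻ x, ‖u t x‖ₑ ^ 10 ∂vol) ^ (1 / 2 : ℝ) = eLpNorm (u t) 10 vol ^ 5
  rw [← h2, ← ENNReal.rpow_natCast, ← ENNReal.rpow_natCast, ← ENNReal.rpow_mul]
  norm_num

theorem ae_eLpNorm_lt_top (h : IsSolution V J u p v) (hJ : J.OrdConnected) :
    ∀ᵐ t ∂volume.restrict J, eLpNorm (u t) 10 vol < ⊤ := by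
  rcases J.eq_empty_or_nonempty with rfl | hne
  · simp
  obtain ⟨a, b, ha, hb, -, hab⟩ := exists_iUnion_Icc_eq hJ hne
  rw [← hab, ae_restrict_iUnion_iff]
  intro n
  have h1 := ae_lt_top' (h.aemeasurable_eLpNorm.mono_measure (Measure.restrict_mono_set _ (hJ.out (ha n) (hb n))))
    (h.strichartz _ (ha n) _ (hb n)).ne
  filter_upwards [h1] with t ht
  by_contra hc
  rw [not_lt, top_le_iff] at hc
  rw [hc] at ht
  simp at ht

theorem ae_memLp_quintic (h : IsSolution V J u p v) (hJ : J.OrdConnected)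
    (hU : ∀ t ∈ J, Jet.IsConj (U t) (u t) (p t)) :
    ∀ᵐ t ∂volume.restrict J, MemLp (fun x => quintic x (Jet.val (U t) x)) 2 (volume : Measure E3) := by
  filter_upwards [h.ae_eLpNorm_lt_top hJ, ae_restrict_mem hJ.measurableSet] with t h1 h2
  exact memLp_quintic (hU t h2) h1

/-- Measurability in time comes from the continuous truncated forces, which converge almost
everywhere; integrability is the Strichartz bound. -/
theorem integrableOn_force (h : IsSolution V J u p v) (hJ : J.OrdConnected)
    (hU : ∀ t ∈ J, Jet.IsConj (U t) (u t) (p t)) {a b : ℝ} (ha : a ∈ J) (hb : b ∈ J) :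
    IntegrableOn (fun τ => quinticL2 (Jet.val (U τ))) (Set.Icc a b) volume := by
  have hs : Set.Icc a b ⊆ J := hJ.out ha hb
  have cU : ContinuousOn (fun τ => Jet.val (U τ)) (Set.Icc a b) :=
    Jet.val.continuous.comp_continuousOn ((h.continuousOn_state hU).mono hs)
  refine ⟨aestronglyMeasurable_of_tendsto_ae atTop (f := fun n τ => nemL2 n (Jet.val (U τ)))
    (fun n => ((continuous_nemL2 n).comp_continuousOn cU).aestronglyMeasurable measurableSet_Icc) ?_, ?_⟩
  · filter_upwards [ae_restrict_of_ae_restrict_of_subset hs (h.ae_memLp_quintic hJ hU)] with τ hτ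
    exact tendsto_nemL2 hτ
  · refine lt_of_le_of_lt (lintegral_mono_ae ?_) (h.strichartz a ha b hb)
    filter_upwards [ae_restrict_mem measurableSet_Icc] with τ hτ
    exact enorm_quinticL2_le (hU τ (hs hτ))

theorem intervalIntegrable_force (h : IsSolution V J u p v) (hJ : J.OrdConnected)
    (hU : ∀ t ∈ J, Jet.IsConj (U t) (u t) (p t)) {a b : ℝ} (ha : a ∈ J) (hb : b ∈ J) :
    IntervalIntegrable (fun τ => quinticL2 (Jet.val (U τ))) volume a b :=
  ⟨(h.integrableOn_force hJ hU ha hb).mono_set Set.Ioc_subset_Icc_self,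
    (h.integrableOn_force hJ hU hb ha).mono_set Set.Ioc_subset_Icc_self⟩

theorem state_eq (h : IsSolution V J u p v) (hJ : J.OrdConnected) (hU : ∀ t ∈ J, Jet.IsConj (U t) (u t) (p t))
    (hy : ∀ t ∈ J, y t =ᵐ[volume] fun x => rootDensity x * v t x) {s t : ℝ} (hs : s ∈ J) (ht : t ∈ J) :
    Jet.val (U t) - Jet.val (U s) = ∫ τ in s..t, y τ := by
  have cy : ContinuousOn y (Set.uIcc s t) := (h.continuousOn_velocity hy).mono (hJ.uIcc_subset hs ht)
  have key : ∀ z : L2 ℝ, inner ℝ z (Jet.val (U t) - Jet.val (U s)) = inner ℝ z (∫ τ in s..t, y τ) := by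
    refine L2_induction (isClosed_eq (by fun_prop) (by fun_prop)) fun χ z hχ hz => ?_
    -- Testing the hyperbolic equation with `κ⁻¹ χ` gives the Lebesgue pairing of the conjugated
    -- solution with `χ`, and such `χ` are dense in `L²`.
    set φ : E3 → ℝ := fun x => (rootDensity x)⁻¹ * χ x with hφ
    have tφ : IsTest φ := hχ.mul_left contDiff_rootDensity_inv
    have hz' : z =ᵐ[volume] fun x => rootDensity x * φ x := hz.trans (Eventually.of_forall fun x => by
      simp only [hφ]
      rw [← mul_assoc, mul_inv_cancel₀ (rootDensity_pos x).ne', one_mul])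
    have hd : ∀ τ ∈ J, HasDerivWithinAt (fun s => inner ℝ z (Jet.val (U s))) (inner ℝ z (y τ)) J τ := by
      intro τ hτ
      have h1 := h.deriv_u φ tφ τ hτ
      rw [inner_eq_integral_vol (hy τ hτ) hz', real_inner_comm] at h1
      refine h1.congr (fun r hr => ?_) ?_
      · rw [inner_eq_integral_vol (hU r hr).1 hz', real_inner_comm]
      · rw [inner_eq_integral_vol (hU τ hτ).1 hz', real_inner_comm]
    have hi := sub_eq_integral_of_hasDerivWithinAt hJ hd hs ht
      (ContinuousOn.intervalIntegrable (continuousOn_const.inner cy)) (Eventually.of_forall fun _ => rfl)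
    rw [inner_sub_right, hi]
    exact (innerSL ℝ z).intervalIntegral_comp_comm cy.intervalIntegrable
  exact ext_inner_left ℝ key

end IsSolution

namespace IsSolution

variable {V : E3 → ℝ} {J : Set ℝ} {u : ℝ → E3 → ℝ} {p : ℝ → E3 → Fin 3 → ℝ} {v : ℝ → E3 → ℝ}
  {U : ℝ → Jet} {y : ℝ → L2 ℝ} {m : BoundedContinuousFunction E3 ℝ}

/-- The functional `φ ↦ -(Q(U, φ) + ⟪N, φ⟫)`. -/
def force (m : BoundedContinuousFunction E3 ℝ) (w : Jet) : Jet →L[ℝ] ℝ :=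
  -(Jet.form m w + (innerSL ℝ (quinticL2 (Jet.val w))).comp Jet.val)

theorem force_apply (m : BoundedContinuousFunction E3 ℝ) (w z : Jet) :
    force m w z = -(Jet.form m w z + inner ℝ (quinticL2 (Jet.val w)) (Jet.val z)) := rfl

theorem intervalIntegrable_functional (h : IsSolution V J u p v) (hJ : J.OrdConnected)
    (hU : ∀ t ∈ J, Jet.IsConj (U t) (u t) (p t)) {s t : ℝ} (hs : s ∈ J) (ht : t ∈ J) :
    IntervalIntegrable (fun τ => force m (U τ)) volume s t := by
  have cU : ContinuousOn U (Set.uIcc s t) := (h.continuousOn_state hU).mono (hJ.uIcc_subset hs ht)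
  have i1 : IntervalIntegrable (fun τ => Jet.form m (U τ)) volume s t :=
    ((Jet.form m).continuous.comp_continuousOn cU).intervalIntegrable
  have i0 := h.intervalIntegrable_force hJ hU hs ht
  set T : L2 ℝ →L[ℝ] Jet →L[ℝ] ℝ :=
    ((ContinuousLinearMap.compL ℝ Jet (L2 ℝ) ℝ).flip Jet.val).comp (innerSL ℝ) with hT
  have i2 : IntervalIntegrable (fun τ => T (quinticL2 (Jet.val (U τ)))) volume s t :=
    ⟨T.integrable_comp i0.1, T.integrable_comp i0.2⟩
  exact (i1.add i2).neg

theorem velocity_test (h : IsSolution V J u p v) (hJ : J.OrdConnected) (hm : ∀ x, m x = centrifugal x + V x)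
    (hU : ∀ t ∈ J, Jet.IsConj (U t) (u t) (p t)) (hy : ∀ t ∈ J, y t =ᵐ[volume] fun x => rootDensity x * v t x)
    {φ : E3 → ℝ} (hφ : IsTest φ) {z : Jet} (hz : Jet.IsConj z φ (diff φ)) {s t : ℝ} (hs : s ∈ J) (ht : t ∈ J) :
    inner ℝ (y t - y s) (Jet.val z) = ∫ τ in s..t, force m (U τ) z := by
  have hd : ∀ τ ∈ J, HasDerivWithinAt (fun s => inner ℝ (y s) (Jet.val z))
      (-∫ x, (cometric x (p τ x) (diff φ x) + V x * u τ x * φ x + |u τ x| ^ 4 * u τ x * φ x) ∂vol) J τ := by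
    intro τ hτ
    refine (h.deriv_v φ hφ τ hτ).congr (fun r hr => ?_) ?_
    · rw [inner_eq_integral_vol (hy r hr) hz.1]
    · rw [inner_eq_integral_vol (hy τ hτ) hz.1]
  have hi := h.intervalIntegrable_functional (m := m) hJ hU hs ht
  have hiz : IntervalIntegrable (fun τ => force m (U τ) z) volume s t :=
    ⟨(ContinuousLinearMap.apply ℝ ℝ z).integrable_comp hi.1, (ContinuousLinearMap.apply ℝ ℝ z).integrable_comp hi.2⟩
  rw [inner_sub_left]
  refine sub_eq_integral_of_hasDerivWithinAt hJ hd hs ht hiz ?_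
  have hst := hJ.uIcc_subset hs ht
  filter_upwards [ae_restrict_of_ae_restrict_of_subset hst (h.ae_memLp_quintic hJ hU),
    ae_restrict_mem measurableSet_uIcc] with τ h1 h2
  rw [force_apply, weak_equation_rhs hm (hU τ (hst h2)) hz h1]

/-- The time integral of `force` is a single continuous functional on jets, so the equation extends
from test functions to the whole energy space. -/
theorem velocity_eq (h : IsSolution V J u p v) (hJ : J.OrdConnected) (hm : ∀ x, m x = centrifugal x + V x)
    (hU : ∀ t ∈ J, Jet.IsConj (U t) (u t) (p t)) (hy : ∀ t ∈ J, y t =ᵐ[volume] fun x => rootDensity x * v t x)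
    {z : Jet} (hz : z ∈ Jet.energySpace) {s t : ℝ} (hs : s ∈ J) (ht : t ∈ J) :
    inner ℝ (y t - y s) (Jet.val z) = ∫ τ in s..t, force m (U τ) z := by
  have hi := h.intervalIntegrable_functional (m := m) hJ hU hs ht
  have e : ∀ z, (∫ τ in s..t, force m (U τ) z) = (∫ τ in s..t, force m (U τ)) z := fun z =>
    (ContinuousLinearMap.intervalIntegral_apply hi z).symm
  rw [e]
  refine Jet.energySpace_induction
    (p := fun z => inner ℝ (y t - y s) (Jet.val z) = (∫ τ in s..t, force m (U τ)) z) ?_ (fun ψ z hψ hz => ?_) z hz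
  · exact isClosed_eq (continuous_const.inner Jet.val.continuous) (ContinuousLinearMap.continuous _)
  · set φ : E3 → ℝ := fun x => (rootDensity x)⁻¹ * ψ x with hφ
    have tφ : IsTest φ := hψ.mul_left contDiff_rootDensity_inv
    have eψ : ψ = fun x => rootDensity x * φ x := by
      ext x
      simp only [hφ]
      rw [← mul_assoc, mul_inv_cancel₀ (rootDensity_pos x).ne', one_mul]
    rw [eψ] at hz
    rw [← e]
    exact h.velocity_test hJ hm hU hy tφ (hz.isConj tφ) hs ht

theorem defocusingEvolution (h : IsSolution V J u p v) (hJ : J.OrdConnected) (hm : ∀ x, m x = centrifugal x + V x)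
    (hE : ∀ t ∈ J, U t ∈ Jet.energySpace)
    (hU : ∀ t ∈ J, Jet.IsConj (U t) (u t) (p t)) (hy : ∀ t ∈ J, y t =ᵐ[volume] fun x => rootDensity x * v t x) :
    DefocusingEvolution m J U y where
  weak :=
    { ordConnected := hJ
      continuous_state := h.continuousOn_state hU
      continuous_velocity := h.continuousOn_velocity hy
      integrable_force := fun _ ha _ hb => h.intervalIntegrable_force hJ hU ha hb
      mem := hE
      state := fun _ hs _ ht => h.state_eq hJ hU hy hs ht
      velocity := fun _ hφ _ hs _ ht => h.velocity_eq hJ hm hU hy hφ hs ht }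
  memLp := h.ae_memLp_quintic hJ hU

theorem exists_defocusingEvolution (h : IsSolution V J u p v) (hJ : J.OrdConnected)
    (hm : ∀ x, m x = centrifugal x + V x) :
    ∃ (U : ℝ → Jet) (y : ℝ → L2 ℝ), DefocusingEvolution m J U y ∧ (∀ t ∈ J, Jet.IsConj (U t) (u t) (p t)) ∧
      ∀ t ∈ J, y t =ᵐ[volume] fun x => rootDensity x * v t x := by
  have hex : ∀ t, ∃ (w : Jet) (y : L2 ℝ), t ∈ J → w ∈ Jet.energySpace ∧ Jet.IsConj w (u t) (p t) ∧
      y =ᵐ[volume] fun x => rootDensity x * v t x := by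
    intro t
    by_cases ht : t ∈ J
    · obtain ⟨w, hw, hw'⟩ := (h.memH1 t ht).exists_isConj
      exact ⟨w, (memLp_rootDensity_mul (h.memL2 t ht)).toLp, fun _ => ⟨hw, hw', MemLp.coeFn_toLp _⟩⟩
    · exact ⟨0, 0, fun h => absurd h ht⟩
  choose U y hUy using hex
  exact ⟨U, y, h.defocusingEvolution hJ hm (fun t ht => (hUy t ht).1) (fun t ht => (hUy t ht).2.1)
    (fun t ht => (hUy t ht).2.2), fun t ht => (hUy t ht).2.1, fun t ht => (hUy t ht).2.2⟩

theorem lintegral_pow_eq (h : IsSolution V J u p v) :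
    eLpNorm (Function.uncurry u) 6 ((volume.restrict J).prod vol) ^ 6
      = ∫⁻ τ in J, ∫⁻ x, ‖u τ x‖ₑ ^ 6 ∂vol := by
  have h1 := eLpNorm_pow_eq_lintegral (μ := (volume.restrict J).prod vol) (Function.uncurry u) (n := 6) (by simp)
  rw [lintegral_prod _ (h.meas.enorm.pow_const 6)] at h1
  exact_mod_cast h1

theorem lintegral_pow_eq_ofReal {w : Jet} {f : E3 → ℝ} {q : E3 → Fin 3 → ℝ} (hw : Jet.IsConj w f q)
    (hi : MemLp (fun x => quintic x (Jet.val w x)) 2 (volume : Measure E3)) :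
    ∫⁻ x, ‖f x‖ₑ ^ 6 ∂vol = ENNReal.ofReal (∫ x, sextic x (Jet.val w x)) := by
  rw [ofReal_integral_eq_lintegral_ofReal (integrable_sextic hi)
    (Eventually.of_forall fun x => sextic_nonneg x _), lintegral_vol]
  refine lintegral_congr_ae ?_
  filter_upwards [hw.1] with x a
  rw [a, sextic_rootDensity_mul, ENNReal.ofReal_mul (sq_nonneg _), ← Real.enorm_of_nonneg
    (Even.pow_nonneg (by decide) (f x)), enorm_pow]

/-- The spacetime estimate for potentials with nonpositive radial derivative. -/
theorem lintegral_le (h : IsSolution V J u p v) (hJ : J.OrdConnected) (hm : ∀ x, m x = centrifugal x + V x)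
    (hV : ContDiff ℝ ∞ V) (hV0 : ∀ x, 0 ≤ V x) (hVe : ∀ x, euler V x ≤ 0) {t : ℝ} (ht : t ∈ J) :
    ∫⁻ τ in J, ∫⁻ x, ‖u τ x‖ₑ ^ 6 ∂vol ≤ ENNReal.ofReal (3 * energy V (u t) (p t) (v t)) := by
  obtain ⟨U, y, hD, hU, hy⟩ := h.exists_defocusingEvolution hJ hm
  obtain ⟨a, b, ha, hb, hmono, hab⟩ := exists_iUnion_Icc_eq hJ ⟨t, ht⟩
  have e : ∫⁻ τ in J, ∫⁻ x, ‖u τ x‖ₑ ^ 6 ∂vol = ∫⁻ τ in J, ENNReal.ofReal (∫ x, sextic x (Jet.val (U τ) x)) := by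
    refine lintegral_congr_ae ?_
    filter_upwards [hD.memLp, ae_restrict_mem hJ.measurableSet] with τ h1 h2
    exact lintegral_pow_eq_ofReal (hU τ h2) h1
  rw [e, energy_eq_jetEnergy hm (hU t ht) (hy t ht)]
  nth_rewrite 1 [← hab]
  -- The bound on each compact interval does not depend on the interval, so it survives the
  -- increasing union; intervals without interior are null.
  rw [setLIntegral_iUnion_of_directed _ (directed_of_isDirected_le hmono)]
  refine iSup_le fun n => ?_
  rcases lt_or_ge (a n) (b n) with hn | hn
  · exact hD.lintegral_sextic_le hV hm hV0 hVe (ha n) (hb n) ht hn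
  · have h0 : volume (Set.Icc (a n) (b n)) = 0 := by rw [Real.volume_Icc]; simpa using hn
    rw [Measure.restrict_eq_zero.2 h0, lintegral_zero_measure]
    exact zero_le

end IsSolution

/-! ### Repulsive potentials. -/

section Potential

/-- Away from the origin `x · ∇` is the positive multiple `tanh r` of `∂_r` at `r = arsinh ‖x‖`; at
the origin the field vanishes. -/
theorem IsRepulsive.euler_nonpos {V : E3 → ℝ} (h : IsRepulsive V) (x : E3) : euler V x ≤ 0 := by
  rcases eq_or_ne x 0 with rfl | hx
  · simp [euler]
  have hn : 0 < ‖x‖ := norm_pos_iff.2 hx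
  set θ : E3 := ‖x‖⁻¹ • x with hθ
  have hθ1 : ‖θ‖ = 1 := by rw [hθ, norm_smul, norm_inv, norm_norm, inv_mul_cancel₀ hn.ne']
  have hr : 0 < Real.arsinh ‖x‖ := Real.arsinh_pos_iff.2 hn
  have hx' : Real.sinh (Real.arsinh ‖x‖) • θ = x := by
    rw [Real.sinh_arsinh, hθ, smul_smul, mul_inv_cancel₀ hn.ne', one_smul]
  have h1 : HasDerivAt (fun ρ => Real.sinh ρ • θ) (Real.cosh (Real.arsinh ‖x‖) • θ) (Real.arsinh ‖x‖) :=
    (Real.hasDerivAt_sinh _).smul_const θ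
  have h2 : HasFDerivAt V (fderiv ℝ V x) (Real.sinh (Real.arsinh ‖x‖) • θ) := by
    rw [hx']
    exact (h.smooth.differentiable (by simp) x).hasFDerivAt
  have h3 := (h2.comp_hasDerivAt _ h1).deriv
  have h4 := h.repulsive θ hθ1 _ hr
  have h5 : deriv (fun ρ : ℝ => V (Real.sinh ρ • θ)) (Real.arsinh ‖x‖)
      = Real.cosh (Real.arsinh ‖x‖) * (‖x‖⁻¹ * euler V x) := by
    refine h3.trans ?_
    rw [hθ, map_smul, map_smul, smul_eq_mul, smul_eq_mul, euler]
  rw [h5] at h4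
  have h6 := nonpos_of_mul_nonpos_right h4 (Real.cosh_pos _)
  exact nonpos_of_mul_nonpos_right h6 (inv_pos.2 hn)

theorem exists_boundedContinuous {V : E3 → ℝ} (hV : Continuous V) (hs : HasCompactSupport V) :
    ∃ m : BoundedContinuousFunction E3 ℝ, ∀ x, m x = centrifugal x + V x := by
  obtain ⟨C, hC⟩ := hV.bounded_above_of_compact_support hs
  refine ⟨BoundedContinuousFunction.ofNormedAddCommGroup (fun x => centrifugal x + V x)
    (contDiff_centrifugal.continuous.add hV) (1 / 4 + C) fun x => ?_, fun x => rfl⟩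
  refine (norm_add_le _ _).trans (add_le_add ?_ (hC x))
  rw [Real.norm_of_nonneg (centrifugal_nonneg x)]
  exact centrifugal_le x

end Potential

end HypWave

end

theorem mainTheorem7 :
    ∃ C : ℝ, 0 < C ∧
      ∀ V : HypWave.E3 → ℝ, (V = 0 ∨ HypWave.IsRepulsive V) →
      ∀ J : Set ℝ, J.OrdConnected →
      ∀ (u : ℝ → HypWave.E3 → ℝ) (p : ℝ → HypWave.E3 → Fin 3 → ℝ) (v : ℝ → HypWave.E3 → ℝ),
        HypWave.IsSolution V J u p v →
        MemLp (Function.uncurry u) 6 ((volume.restrict J).prod HypWave.vol) ∧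
        ∀ t ∈ J,
          eLpNorm (Function.uncurry u) 6 ((volume.restrict J).prod HypWave.vol) ^ 6 ≤
            ENNReal.ofReal (C * HypWave.energy V (u t) (p t) (v t)) := by
  refine ⟨3, by norm_num, fun V hV J hJ u p v h => ?_⟩
  obtain ⟨hs, hc, h0, he⟩ : ContDiff ℝ ∞ V ∧ HasCompactSupport V ∧ (∀ x, 0 ≤ V x) ∧
      ∀ x, HypWave.euler V x ≤ 0 := by
    rcases hV with rfl | hV
    · exact ⟨contDiff_const, HasCompactSupport.zero, fun _ => le_rfl, fun x => by simp [HypWave.euler]⟩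
    · exact ⟨hV.smooth, hV.compact, hV.nonneg, hV.euler_nonpos⟩
  obtain ⟨m, hm⟩ := HypWave.exists_boundedContinuous hs.continuous hc
  have key : ∀ t ∈ J, eLpNorm (Function.uncurry u) 6 ((volume.restrict J).prod HypWave.vol) ^ 6 ≤
      ENNReal.ofReal (3 * HypWave.energy V (u t) (p t) (v t)) := fun t ht => by
    rw [h.lintegral_pow_eq]
    exact h.lintegral_le hJ hm hs h0 he ht
  refine ⟨⟨h.meas, ?_⟩, key⟩
  rcases J.eq_empty_or_nonempty with rfl | ⟨t, ht⟩
  · simp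
  -- Membership in `L⁶` follows from the estimate at any one time, whose right side is finite.
  · exact (ENNReal.pow_lt_top_iff.1 ((key t ht).trans_lt ENNReal.ofReal_lt_top)).resolve_right (by norm_num)
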